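/- **Conventions.** Let $1<\alpha\le 2$. For $z\in\mathbb C$ and $\beta>0$ put $z^{<\beta>}=|z|^{\beta-1}\bar z$ (so $0^{<\beta>}=0$); for vectors $(\cdot)^{<\beta>}$ is taken coordinatewise. For jointly symmetric $\alpha$-stable (S$\alpha$S) complex random variables $X=X_1+iX_2$, $Y=Y_1+iY_2$ the covariation is $$[X,Y]_\alpha=\int_{S_4}(x_1+ix_2)(y_1+iy_2)^{<\alpha-1>}\,d\Gamma(x_1,x_2,y_1,y_2),$$ where $\Gamma$ is a finite symmetric measure on the unit sphere $S_4\subset\mathbb R^4$ with $E\exp(i\langle t,V\rangle)=\exp(-\int|\langle t,x\rangle|^\alpha d\Gamma(x))$ for all $t\in\mathbb R^4$, $V=(X_1,X_2,Y_1,Y_2)$; and $\|X\|_\alpha=[X,X]_\alpha^{1/\alpha}$. Let $\vec Z(\theta)$, $\theta\in[-\pi,\pi]$, be a $\mathbb C^T$-valued S$\alpha$S process with independent increments which has an absolutely continuous finite matrix-valued spectral measure $\mu$ with density $f$. This means that $f$ is an integrable function on $(-\pi,\pi]$ with values in the complex $T\times T$ matrices and that, for all $-\pi\le s\le t\le\pi$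 and $u,v\in\mathbb C^T$, $$\big[u^\top(\vec Z(t)-\vec Z(s)),\,v^\top(\vec Z(t)-\vec Z(s))\big]_\alpha=u^\top\Big(\int_s^t f(\theta)\,d\theta\Big)v^{<\alpha-1>} .$$ (For $T=1$ this says $\|Z(t)-Z(s)\|_\alpha^\alpha=\int_s^t f$.) For $a:(-\pi,\pi]\to\mathbb C^T$, the convergence $a_n\to a$ in $L^\alpha(\mu)$ means $\int_{-\pi}^{\pi}(a-a_n)^\top f\,(a-a_n)^{<\alpha-1>}d\theta\to0$, and $\int a^\top d\vec Z$ is the limit in probability of $\int a_n^\top d\vec Z$ for step functions $a_n\to a$ in $L^\alpha(\mu)$. **Theorem.** Let $\vec\xi(n)=\int_{-\pi}^{\pi}e^{in\theta}d\vec Z(\theta)$, $n\in\mathbb Z$, be a $T$-dimensional harmonizable S$\alpha$S sequence with such a spectral process $\vec Z$ and spectral density $f$, and suppose that $f$ satisfies the minimality condition: $f(\theta)$ is positive definite for almost all $\theta$ and $$\int_{-\pi}^{\pi}\mathrm{Tr}\big[f(\theta)^{-1/(\alpha-1)}\big]d\theta<\infty .$$ Let $N\ge0$, $\vec a(0),\dots,\vec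 a(N)\in\mathbb C^T$, $A_N\vec\xi=\sum_{j=0}^N\vec a(j)^\top\vec\xi(j)$ and $A_N(e^{i\theta})=\sum_{j=0}^N\vec a(j)e^{ij\theta}$. Let $H^N(\xi)$ be the $\|\cdot\|_\alpha$-closed linear span of the observed values $\xi_k(j)$, $1\le k\le T$, $j\in\mathbb Z\setminus\{0,\dots,N\}$, and let $L^\alpha_N(\mu)$ be the closed linear span in $L^\alpha(\mu)$ of the functions $e^{ij\theta}\delta_k$ with the same $j,k$, where $\delta_1,\dots,\delta_T$ is the standard basis of $\mathbb C^T$. The optimal linear estimate $\hat A_N\vec\xi$ is the element of $H^N(\xi)$ that minimizes $\|A_N\vec\xi-\eta\|_\alpha$ over $\eta\in H^N(\xi)$. Then $\hat A_N\vec\xi$ exists and is unique almost surely. For $C_N(e^{i\theta})=\sum_{j=0}^N\vec c(j)e^{-ij\theta}$, the system of equations $$\int_{-\pi}^{\pi}e^{-ik\theta}\Big[A_N(e^{i\theta})-\big(f(\theta)^{-1}C_N(e^{i\theta})\big)^{<\frac1{\alpha-1}>}\Big]d\theta=0,\qquad k=0,1,\dots,N,$$ (the integrand being integrable) has exactly one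 solution $\vec c(0),\dots,\vec c(N)\in\mathbb C^T$, and with these coefficients $$\hat A_N\vec\xi=\int_{-\pi}^{\pi}h(\theta)^\top d\vec Z(\theta),\qquad h(\theta)=A_N(e^{i\theta})-\big(f(\theta)^{-1}C_N(e^{i\theta})\big)^{<\frac1{\alpha-1}>},$$ where $h\in L^\alpha_N(\mu)$, and $h$ is, up to almost everywhere equality, the only function whose integral is $\hat A_N\vec\xi$. The error of the estimate is finite and equals $$\|A_N\vec\xi-\hat A_N\vec\xi\|_\alpha^\alpha=\int_{-\pi}^{\pi}\Big[\big(f^{-1}C_N\big)^{<\frac1{\alpha-1}>}\Big]^\top f\,\Big(\big(f^{-1}C_N\big)^{<\frac1{\alpha-1}>}\Big)^{<\alpha-1>}d\theta,$$ and for $T=1$ $$\|A_N\xi-\hat A_N\xi\|_\alpha^\alpha=\int_{-\pi}^{\pi}\Big|\big(f^{-1}C_N\big)^{<\frac1{\alpha-1}>}\Big|^\alpha f\,d\theta ,$$ all integrands being integrable. -/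

import Mathlib

open MeasureTheory ProbabilityTheory Filter Topology Matrix
open scoped ENNReal ComplexOrder

noncomputable section

namespace HSaS

/-! ### Stable random variables, covariation and the norm `‖·‖_α` -/

/-- `z^{<β>} = |z|^{β-1} * conj z`. -/
def spow (β : ℝ) (z : ℂ) : ℂ := ((‖z‖ ^ (β - 1) : ℝ) : ℂ) * (starRingEnd ℂ) z

/-- `v^{<β>}` for a vector `v`, taken coordinate by coordinate. -/
def vpow {T : ℕ} (β : ℝ) (v : Fin T → ℂ) : Fin T → ℂ := fun k => spow β (v k)

variable {Ω : Type*} [MeasurableSpace Ω]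

/-- The real random variable `Y` is symmetric `α`-stable: `E exp(itY) = exp(-c|t|^α)`, `c ≥ 0`. -/
def IsSaS (P : Measure Ω) (α : ℝ) (Y : Ω → ℝ) : Prop :=
  AEMeasurable Y P ∧ ∃ c : ℝ, 0 ≤ c ∧ ∀ t : ℝ,
    ∫ ω, Complex.exp (Complex.I * ((t * Y ω : ℝ) : ℂ)) ∂P
      = ((Real.exp (-(c * |t| ^ α)) : ℝ) : ℂ)

/-- A family of complex random variables is (jointly) symmetric `α`-stable: all finite real linear
combinations of the real and imaginary parts of its members are symmetric `α`-stable. (The real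
part of `∑ aᵢ Xᵢ` with `aᵢ = u - i v` is `∑ (u Re Xᵢ + v Im Xᵢ)`.) -/
def IsSaSFamily (P : Measure Ω) (α : ℝ) {ι : Type*} (X : ι → Ω → ℂ) : Prop :=
  ∀ (s : Finset ι) (a : ι → ℂ), IsSaS P α (fun ω => (∑ i ∈ s, a i * X i ω).re)

/-- `Γ` is a spectral measure of the real random vector `V`: a finite symmetric measure on the
Euclidean unit sphere with `E exp(i⟨t,V⟩) = exp(-∫ |⟨t,x⟩|^α dΓ(x))` for all `t`. -/
structure IsSphereSpectralMeasure (P : Measure Ω) (α : ℝ) {n : ℕ} (V : Fin n → Ω → ℝ)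
    (Γ : Measure (EuclideanSpace ℝ (Fin n))) : Prop where
  aemeasurable : ∀ i, AEMeasurable (V i) P
  finite : IsFiniteMeasure Γ
  sphere : Γ (Metric.sphere (0 : EuclideanSpace ℝ (Fin n)) 1)ᶜ = 0
  symm : Γ.map (fun x => -x) = Γ
  charFun : ∀ t : Fin n → ℝ,
    ∫ ω, Complex.exp (Complex.I * ((∑ i, t i * V i ω : ℝ) : ℂ)) ∂P
      = ((Real.exp (-∫ x, |∑ i, t i * x i| ^ α ∂Γ) : ℝ) : ℂ)

/-- `X` and `Y` are jointly symmetric `α`-stable and their covariation `[X, Y]_α` equals `c`,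
i.e. `c = ∫ (x₁ + i x₂) (y₁ + i y₂)^{<α-1>} dΓ` for the spectral measure `Γ` of
`(Re X, Im X, Re Y, Im Y)`. -/
def HasCovariation (P : Measure Ω) (α : ℝ) (X Y : Ω → ℂ) (c : ℂ) : Prop :=
  ∃ Γ : Measure (EuclideanSpace ℝ (Fin 4)),
    IsSphereSpectralMeasure P α
      ![fun ω => (X ω).re, fun ω => (X ω).im, fun ω => (Y ω).re, fun ω => (Y ω).im] Γ ∧
    c = ∫ x, ((x 0 : ℂ) + Complex.I * (x 1 : ℂ)) *
          spow (α - 1) ((x 2 : ℂ) + Complex.I * (x 3 : ℂ)) ∂Γ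

/-- `‖X‖_α = [X, X]_α^{1/α}`, with value `∞` if `X` is not symmetric `α`-stable. -/
def stableNorm (P : Measure Ω) (α : ℝ) (X : Ω → ℂ) : ℝ≥0∞ :=
  ⨅ (c : ℂ) (_ : HasCovariation P α X X c), ENNReal.ofReal (c.re ^ (1 / α))

/-! ### Processes with independent increments and integrals with respect to them -/

/-- The parameter set `[-π, π]` of the spectral process. -/
abbrev Freq : Type := Set.Icc (-Real.pi) Real.pi

/-- Lebesgue measure on `(-π, π]`. -/
def leb : Measure ℝ := volume.restrict (Set.Ioc (-Real.pi) Real.pi)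

/-- `Z` has an absolutely continuous finite matrix-valued spectral measure
`μ((s,t]) = ∫_s^t f(θ) dθ`: for `ΔZ = Z(t) - Z(s)` and all `u, v ∈ ℂ^T`,
`[uᵀ ΔZ, vᵀ ΔZ]_α = uᵀ μ((s,t]) v^{<α-1>}`. For `T = 1` this says `μ((s,t]) = ‖Z(t) - Z(s)‖_α^α`.
-/
def HasSpectralDensity (P : Measure Ω) (α : ℝ) {T : ℕ} (Z : Freq → Ω → (Fin T → ℂ))
    (f : ℝ → Matrix (Fin T) (Fin T) ℂ) : Prop :=
  (∀ k l, Integrable (fun θ => f θ k l) leb) ∧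
  ∀ s t : Freq, s ≤ t → ∀ u v : Fin T → ℂ,
    HasCovariation P α (fun ω => u ⬝ᵥ (Z t ω - Z s ω)) (fun ω => v ⬝ᵥ (Z t ω - Z s ω))
      (∑ k, ∑ l, u k * (∫ θ in (s : ℝ)..(t : ℝ), f θ k l) * vpow (α - 1) v l)

/-- A `ℂ^T`-valued step function `∑ uᵢ 1_{(sᵢ, tᵢ]}` on `[-π, π]`. -/
structure StepFn (T : ℕ) where
  n : ℕ
  left : Fin n → Freq
  right : Fin n → Freq
  le : ∀ i, left i ≤ right i
  coef : Fin n → Fin T → ℂ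

/-- The step function as a function of `θ`. -/
def StepFn.toFun {T : ℕ} (S : StepFn T) (θ : ℝ) : Fin T → ℂ :=
  ∑ i, (Set.Ioc (S.left i : ℝ) (S.right i : ℝ)).indicator (fun _ => S.coef i) θ

/-- `∫ Sᵀ dZ = ∑ uᵢᵀ (Z(tᵢ) - Z(sᵢ))`. -/
def StepFn.integral {T : ℕ} (S : StepFn T) (Z : Freq → Ω → (Fin T → ℂ)) (ω : Ω) : ℂ :=
  ∑ i, S.coef i ⬝ᵥ (Z (S.right i) ω - Z (S.left i) ω)

/-- `∫ aᵀ f a^{<α-1>} dθ`, the `α`-th power of the norm of the space `L^α(μ)`, `dμ = f dθ`. -/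
def energy {T : ℕ} (α : ℝ) (f : ℝ → Matrix (Fin T) (Fin T) ℂ) (a : ℝ → Fin T → ℂ) : ℝ≥0∞ :=
  ∫⁻ θ, ENNReal.ofReal ((a θ ⬝ᵥ (f θ *ᵥ vpow (α - 1) (a θ))).re) ∂leb

/-- `X = ∫ aᵀ dZ`: there are step functions converging to `a` in `L^α(μ)` whose integrals converge
to `X` in probability. -/
def IsStochIntegral (P : Measure Ω) (α : ℝ) {T : ℕ} (Z : Freq → Ω → (Fin T → ℂ))
    (f : ℝ → Matrix (Fin T) (Fin T) ℂ) (a : ℝ → Fin T → ℂ) (X : Ω → ℂ) : Prop :=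
  AEMeasurable a leb ∧ ∃ S : ℕ → StepFn T,
    Tendsto (fun n => energy α f (fun θ => a θ - (S n).toFun θ)) atTop (𝓝 0) ∧
    TendstoInMeasure P (fun n => (S n).integral Z) atTop X

/-! ### Harmonizable sequences -/

/-- `e^{ijθ} δ_k`. -/
def expVec {T : ℕ} (j : ℤ) (k : Fin T) (θ : ℝ) : Fin T → ℂ :=
  Pi.single k (Complex.exp (Complex.I * (j : ℂ) * (θ : ℂ)))

/-- `ξ` is a `T`-dimensional harmonizable symmetric `α`-stable sequence with spectral process `Z`
and spectral density `f`: `ξ(n) = ∫ e^{inθ} dZ(θ)`. (The formula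
`[ξ_k(n), ξ_l(m)]_α = ∫ e^{i(n-m)θ} f_{kl}(θ) dθ` is a consequence.) -/
structure IsHarmonizable (P : Measure Ω) (α : ℝ) {T : ℕ} (ξ : ℤ → Ω → (Fin T → ℂ))
    (Z : Freq → Ω → (Fin T → ℂ)) (f : ℝ → Matrix (Fin T) (Fin T) ℂ) : Prop where
  stable : IsSaSFamily P α (fun (p : ℤ × Fin T) ω => ξ p.1 ω p.2)
  stable_process : IsSaSFamily P α (fun (p : Freq × Fin T) ω => Z p.1 ω p.2)
  indep : HasIndepIncrements Z P
  density : HasSpectralDensity P α Z f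
  representation : ∀ (n : ℤ) (k : Fin T), IsStochIntegral P α Z f (expVec n k) (fun ω => ξ n ω k)

/-- The minimality condition `∫ Tr[f(θ)^{-1/(α-1)}] dθ < ∞`; it presupposes that `f(θ)` is
a positive definite matrix for almost all `θ`. -/
def Minimality {T : ℕ} (α : ℝ) (f : ℝ → Matrix (Fin T) (Fin T) ℂ) : Prop :=
  (∀ᵐ θ ∂leb, (f θ).PosDef) ∧
  Integrable (fun θ => (cfc (fun x : ℝ => x ^ (-(1 / (α - 1)))) (f θ)).trace) leb

/-! ### The interpolation problem -/

/-- The functional `A_N ξ = ∑_{j=0}^N a(j)ᵀ ξ(j)`. -/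
def functional {T N : ℕ} (a : Fin (N + 1) → Fin T → ℂ) (ξ : ℤ → Ω → (Fin T → ℂ)) (ω : Ω) : ℂ :=
  ∑ j : Fin (N + 1), a j ⬝ᵥ ξ ((j : ℕ) : ℤ) ω

/-- The linear span of the observed values `ξ_k(j)`, `j ∈ ℤ \ {0, …, N}`. -/
def observedSpan {T : ℕ} (N : ℕ) (ξ : ℤ → Ω → (Fin T → ℂ)) : Submodule ℂ (Ω → ℂ) :=
  Submodule.span ℂ {x | ∃ (j : ℤ) (k : Fin T), ¬ (0 ≤ j ∧ j ≤ N) ∧ x = fun ω => ξ j ω k}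

/-- Membership in `H^N(ξ)`, the `‖·‖_α`-closure of the span of the observed values. -/
def MemObserved (P : Measure Ω) (α : ℝ) {T : ℕ} (N : ℕ) (ξ : ℤ → Ω → (Fin T → ℂ))
    (η : Ω → ℂ) : Prop :=
  ∀ ε : ℝ≥0∞, 0 < ε → ∃ ζ ∈ observedSpan N ξ, stableNorm P α (η - ζ) < ε

/-- `Â` is an optimal linear estimate of `X`: a point of `H^N(ξ)` at minimal `‖·‖_α`-distance
from `X`. -/
def IsOptimalEstimate (P : Measure Ω) (α : ℝ) {T : ℕ} (N : ℕ) (ξ : ℤ → Ω → (Fin T → ℂ))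
    (X Ahat : Ω → ℂ) : Prop :=
  MemObserved P α N ξ Ahat ∧
  ∀ η : Ω → ℂ, MemObserved P α N ξ η → stableNorm P α (X - Ahat) ≤ stableNorm P α (X - η)

/-- The span of the functions `e^{ijθ} δ_k`, `j ∈ ℤ \ {0, …, N}`. -/
def trigSpan (T N : ℕ) : Submodule ℂ (ℝ → Fin T → ℂ) :=
  Submodule.span ℂ {p | ∃ (j : ℤ) (k : Fin T), ¬ (0 ≤ j ∧ j ≤ N) ∧ p = expVec j k}

/-- Membership in `L^α_N(μ)`, the closure of `trigSpan` in `L^α(μ)`, `dμ = f dθ`. -/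
def MemLN {T : ℕ} (α : ℝ) (N : ℕ) (f : ℝ → Matrix (Fin T) (Fin T) ℂ)
    (h : ℝ → Fin T → ℂ) : Prop :=
  AEMeasurable h leb ∧
  ∀ ε : ℝ≥0∞, 0 < ε → ∃ p ∈ trigSpan T N, energy α f (h - p) < ε

/-- `A_N(e^{iθ}) = ∑_{j=0}^N a(j) e^{ijθ}`. -/
def polyA {T N : ℕ} (a : Fin (N + 1) → Fin T → ℂ) (θ : ℝ) : Fin T → ℂ :=
  ∑ j : Fin (N + 1), Complex.exp (Complex.I * (((j : ℕ) : ℤ) : ℂ) * (θ : ℂ)) • a j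

/-- `C_N(e^{iθ}) = ∑_{j=0}^N c(j) e^{-ijθ}`. -/
def polyC {T N : ℕ} (c : Fin (N + 1) → Fin T → ℂ) (θ : ℝ) : Fin T → ℂ :=
  ∑ j : Fin (N + 1), Complex.exp (-(Complex.I * (((j : ℕ) : ℤ) : ℂ) * (θ : ℂ))) • c j

/-- `(f(θ)^{-1} C_N(e^{iθ}))^{<1/(α-1)>}`. -/
def errChar {T N : ℕ} (α : ℝ) (f : ℝ → Matrix (Fin T) (Fin T) ℂ)
    (c : Fin (N + 1) → Fin T → ℂ) (θ : ℝ) : Fin T → ℂ :=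
  vpow (1 / (α - 1)) ((f θ)⁻¹ *ᵥ polyC c θ)

/-- `h(θ) = A_N(e^{iθ}) - (f(θ)^{-1} C_N(e^{iθ}))^{<1/(α-1)>}`. -/
def specChar {T N : ℕ} (α : ℝ) (f : ℝ → Matrix (Fin T) (Fin T) ℂ)
    (a c : Fin (N + 1) → Fin T → ℂ) (θ : ℝ) : Fin T → ℂ :=
  polyA a θ - errChar α f c θ

/-- The system `∫ e^{-ikθ} [A_N(e^{iθ}) - (f(θ)^{-1} C_N(e^{iθ}))^{<1/(α-1)>}] dθ = 0`,
`k = 0, …, N`, for the coefficients `c`; the integrals are required to exist. -/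
def SolvesSystem {T N : ℕ} (α : ℝ) (f : ℝ → Matrix (Fin T) (Fin T) ℂ)
    (a c : Fin (N + 1) → Fin T → ℂ) : Prop :=
  Integrable (specChar α f a c) leb ∧
  ∀ k : Fin (N + 1),
    ∫ θ, Complex.exp (-(Complex.I * (((k : ℕ) : ℤ) : ℂ) * (θ : ℂ))) • specChar α f a c θ ∂leb = 0

end HSaS

end

open MeasureTheory ProbabilityTheory Filter Topology Matrix
open scoped ENNReal ComplexOrder

noncomputable section

namespace HSaS

/-! ### Pointwise inequalities for signed powers and for the form of one density matrix. -/

section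

/-! ### Signed powers -/

/-! The map sending `h` to its stochastic integral is an isometry from `L^α(μ)` onto its image in
the stable variables with `‖·‖_α`. It turns the interpolation problem into best approximation of
`polyA a` by `L^α_N(μ)`, which is solved there by convex duality.

Geometry of `L^α(μ)`. For `α = 2` the form of `f(θ)` is Hermitian. For `α < 2` the covariation
identity forces `f(θ)` to be diagonal: it makes `‖Y + sX‖_α^α` contain the term `s^{α-1} μ_{kl}`,
while this function of `s` is Lipschitz near `0` (`eq_zero_of_hasCovariation_add`,
`HasSpectralDensity.ae_eq_zero`). In both cases `wᵀ f w^{<α-1>}` equals `∑ |(Ww)_k|^α` for an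
injective matrix `W` (`Admissible.exists_factor`). Hence there are a Minkowski inequality and a
Young inequality `Re wᵀ f g^{<α-1>} ≤ form(w)/α + (1 - 1/α) form(g)` with equality only for `w = g`
(`Admissible.young`).

Fourier side. The minimality condition embeds `L^α(μ)` continuously into `L¹`
(`RegularDensity.lintegral_norm_le`), so Fourier coefficients are continuous on it. With density of
trigonometric polynomials this identifies `L^α_N(μ)` with the functions of finite energy whose
coefficients `0, …, N` vanish.

Extremal problem. Put `g = (f⁻¹ C)^{<1/(α-1)>}`, so that `f g^{<α-1>} = C`. If `c` solves the system
and `h` lies in `L^α_N(μ)`, then `w = A - h` and `g` share the coefficients `0, …, N`; therefore `Re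
∫ Cᵀ w = Re ∫ Cᵀ g` is the energy of `g`. Integrating Young's inequality gives energy(g) ≤
energy(w), with equality only for `w = g` (`RegularDensity.energy_errChar_le`). The system is the
Euler equation of a coercive convex functional of `c`, which yields a solution
(`RegularDensity.exists_coeff_eq`); strict monotonicity makes it unique
(`RegularDensity.coeff_errChar_injective`).

Probability. A complex stable variable is described by a finite measure on the unit circle, and
`‖X‖_α^α` is its mass (`HasScale`). Averaging over rotations shows that the mass depends only on the
law. Scales add for independent summands, pass to limits in probability, and tend to `0` exactly
when the variables tend to `0` in probability. Thus the isometry, clear for step functions, extends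
to all stochastic integrals, and `H^N(ξ)` corresponds to `L^α_N(μ)`. -/

@[simp] lemma spow_zero (β : ℝ) : spow β 0 = 0 := by simp [spow]

lemma norm_spow {β : ℝ} (hβ : 0 < β) (z : ℂ) : ‖spow β z‖ = ‖z‖ ^ β := by
  rcases eq_or_ne z 0 with rfl | hz
  · simp [Real.zero_rpow hβ.ne']
  · have hz' : 0 < ‖z‖ := norm_pos_iff.2 hz
    have h0 : 0 ≤ ‖z‖ ^ (β - 1) := by positivity
    rw [spow, norm_mul, Complex.norm_real, Real.norm_of_nonneg h0, RCLike.norm_conj]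
    nth_rewrite 2 [← Real.rpow_one ‖z‖]
    rw [← Real.rpow_add hz']
    congr 1; ring

lemma spow_mul (β : ℝ) (z w : ℂ) : spow β (z * w) = spow β z * spow β w := by
  simp only [spow, norm_mul, map_mul, Real.mul_rpow (norm_nonneg z) (norm_nonneg w)]
  push_cast
  ring

lemma spow_spow_inv {β : ℝ} (hβ : 0 < β) (z : ℂ) : spow β (spow (1 / β) z) = z := by
  rcases eq_or_ne z 0 with rfl | hz
  · simp
  · have hz' : 0 < ‖z‖ := norm_pos_iff.2 hz
    have hβ' : 0 < 1 / β := by positivity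
    conv_lhs => rw [spow, norm_spow hβ' z]
    rw [spow, map_mul, Complex.conj_conj, Complex.conj_ofReal, ← mul_assoc, ← Complex.ofReal_mul,
      ← Real.rpow_mul hz'.le, ← Real.rpow_add hz']
    have : 1 / β * (β - 1) + (1 / β - 1) = 0 := by field_simp; ring
    rw [this]; simp

lemma mul_spow_self {α : ℝ} (hα : 1 < α) (z : ℂ) :
    z * spow (α - 1) z = ((‖z‖ ^ α : ℝ) : ℂ) := by
  rcases eq_or_ne z 0 with rfl | hz
  · simp [Real.zero_rpow (by linarith : α ≠ 0)]
  · have hz' : 0 < ‖z‖ := norm_pos_iff.2 hz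
    have : z * spow (α - 1) z = ((‖z‖ ^ (α - 1 - 1) : ℝ) : ℂ) * (z * (starRingEnd ℂ) z) := by
      rw [spow]; ring
    rw [this, Complex.mul_conj, Complex.normSq_eq_norm_sq, ← Complex.ofReal_mul,
      ← Real.rpow_natCast, ← Real.rpow_add hz']
    congr 2; push_cast; ring

lemma continuous_spow {β : ℝ} (hβ : 0 < β) : Continuous (spow β) := by
  rw [continuous_iff_continuousAt]
  intro z
  rcases eq_or_ne z 0 with rfl | hz
  · rw [ContinuousAt, spow_zero, tendsto_zero_iff_norm_tendsto_zero]
    simp_rw [norm_spow hβ]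
    have : Continuous fun z : ℂ => ‖z‖ ^ β := continuous_norm.rpow_const fun _ => Or.inr hβ.le
    simpa [Real.zero_rpow hβ.ne'] using this.tendsto 0
  · unfold spow
    refine ContinuousAt.mul (Complex.continuous_ofReal.continuousAt.comp ?_)
      Complex.continuous_conj.continuousAt
    exact continuous_norm.continuousAt.rpow_const (Or.inl (norm_ne_zero_iff.2 hz))

lemma measurable_spow (β : ℝ) : Measurable (spow β) := by
  unfold spow
  have h1 : Measurable fun z : ℂ => ‖z‖ ^ (β - 1) := measurable_norm.pow_const _
  exact (Complex.measurable_ofReal.comp h1).mul Complex.continuous_conj.measurable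

lemma continuous_vpow {T : ℕ} {β : ℝ} (hβ : 0 < β) : Continuous (vpow (T := T) β) :=
  continuous_pi fun k => (continuous_spow hβ).comp (continuous_apply k)

lemma measurable_vpow {T : ℕ} (β : ℝ) : Measurable (vpow (T := T) β) :=
  measurable_pi_lambda _ fun k => (measurable_spow β).comp (measurable_pi_apply k)

lemma vpow_vpow_inv {T : ℕ} {β : ℝ} (hβ : 0 < β) (v : Fin T → ℂ) :
    vpow β (vpow (1 / β) v) = v :=
  funext fun k => spow_spow_inv hβ (v k)

lemma vpow_smul {T : ℕ} (β : ℝ) (c : ℂ) (v : Fin T → ℂ) :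
    vpow β (c • v) = spow β c • vpow β v :=
  funext fun k => by simp [vpow, spow_mul]

@[simp] lemma vpow_zero {T : ℕ} (β : ℝ) : vpow β (0 : Fin T → ℂ) = 0 := funext fun k => by
  simp [vpow]

/-! ### Young's inequality with its case of equality -/

/-- Strict Bernoulli inequality `(1 + s)^α > 1 + αs` at `s = x/y - 1`, multiplied by `y^α`; the case
`y = 0` is separate. -/
lemma young_rpow {α : ℝ} (hα : 1 < α) {x y : ℝ} (hx : 0 ≤ x) (hy : 0 ≤ y) :
    x * y ^ (α - 1) ≤ x ^ α / α + (1 - 1 / α) * y ^ α ∧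
    (x * y ^ (α - 1) = x ^ α / α + (1 - 1 / α) * y ^ α → x = y) := by
  have hα0 : 0 < α := by linarith
  rcases hy.eq_or_lt with rfl | hy
  · rw [Real.zero_rpow (by linarith : α - 1 ≠ 0), Real.zero_rpow hα0.ne']
    simp only [mul_zero, add_zero]
    refine ⟨by positivity, fun h => ?_⟩
    by_contra hne
    have : 0 < x ^ α / α := by
      have : 0 < x := lt_of_le_of_ne hx (Ne.symm hne)
      positivity
    linarith
  · have key : x ≠ y → x * y ^ (α - 1) < x ^ α / α + (1 - 1 / α) * y ^ α := by
      intro hne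
      have h := one_add_mul_self_lt_rpow_one_add (s := x / y - 1)
        (by have : 0 ≤ x / y := by positivity
            linarith) (by
          intro h
          apply hne
          have : x / y = 1 := by linarith
          rwa [div_eq_one_iff_eq hy.ne'] at this) hα
      rw [add_sub_cancel, Real.div_rpow hx hy.le, lt_div_iff₀ (by positivity)] at h
      have e : y ^ α = y * y ^ (α - 1) := by
        nth_rewrite 2 [← Real.rpow_one y]
        rw [← Real.rpow_add hy]; congr 1; ring
      have e2 : (1 + α * (x / y - 1)) * y ^ α = α * (x * y ^ (α - 1)) - (α - 1) * y ^ α := by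
        rw [e]; field_simp; ring
      rw [e2] at h
      have : x ^ α / α + (1 - 1 / α) * y ^ α = (x ^ α + (α - 1) * y ^ α) / α := by
        field_simp
      rw [this, lt_div_iff₀ hα0]
      linarith
    by_cases hne : x = y
    · subst hne
      refine ⟨le_of_eq ?_, fun _ => rfl⟩
      have e : x ^ α = x * x ^ (α - 1) := by
        nth_rewrite 2 [← Real.rpow_one x]
        rw [← Real.rpow_add hy]; congr 1; ring
      rw [e]; field_simp; ring
    · exact ⟨(key hne).le, fun h => absurd h (key hne).ne⟩

/-- Bounding the real part by the modulus reduces the inequality to the real one. Equality forces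
`|z| = |w|` and `Re(z w̄) = |z||w|`, hence `|z - w|² = 0`. -/
lemma re_mul_spow_le {α : ℝ} (hα : 1 < α) (z w : ℂ) :
    (z * spow (α - 1) w).re ≤ ‖z‖ ^ α / α + (1 - 1 / α) * ‖w‖ ^ α ∧
    ((z * spow (α - 1) w).re = ‖z‖ ^ α / α + (1 - 1 / α) * ‖w‖ ^ α → z = w) := by
  have hle : (z * spow (α - 1) w).re ≤ ‖z‖ * ‖w‖ ^ (α - 1) := by
    refine (Complex.re_le_norm _).trans ?_
    rw [norm_mul, norm_spow (by linarith)]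
  obtain ⟨y1, y2⟩ := young_rpow hα (norm_nonneg z) (norm_nonneg w)
  refine ⟨hle.trans y1, fun h => ?_⟩
  have h1 : ‖z‖ = ‖w‖ := y2 (le_antisymm y1 (h ▸ hle))
  rcases eq_or_ne w 0 with rfl | hw
  · simpa using h1
  have hw' : 0 < ‖w‖ := norm_pos_iff.2 hw
  have h2 : (z * spow (α - 1) w).re = ‖z‖ * ‖w‖ ^ (α - 1) := le_antisymm hle (h ▸ y1)
  have h3 : (z * spow (α - 1) w).re = ‖w‖ ^ (α - 1 - 1) * (z * (starRingEnd ℂ) w).re := by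
    have : z * spow (α - 1) w = ((‖w‖ ^ (α - 1 - 1) : ℝ) : ℂ) * (z * (starRingEnd ℂ) w) := by
      rw [spow]; ring
    rw [this, Complex.re_ofReal_mul]
  have h4 : ‖w‖ ^ (α - 1) = ‖w‖ ^ (α - 1 - 1) * ‖w‖ := by
    nth_rewrite 3 [← Real.rpow_one ‖w‖]
    rw [← Real.rpow_add hw']; congr 1; ring
  have h5 : (z * (starRingEnd ℂ) w).re = ‖z‖ * ‖w‖ := by
    have hp : 0 < ‖w‖ ^ (α - 1 - 1) := by positivity
    have := h2.symm.trans h3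
    rw [h4] at this
    have : ‖w‖ ^ (α - 1 - 1) * (z * (starRingEnd ℂ) w).re = ‖w‖ ^ (α - 1 - 1) * (‖z‖ * ‖w‖) := by
      rw [← this]; ring
    exact mul_left_cancel₀ hp.ne' this
  have h6 : Complex.normSq (z - w) = 0 := by
    rw [Complex.normSq_sub, h5, Complex.normSq_eq_norm_sq, Complex.normSq_eq_norm_sq, h1]; ring
  exact sub_eq_zero.1 (Complex.normSq_eq_zero.1 h6)

/-! ### The pointwise form `wᵀ F w^{<α-1>}` -/

/-- The matrices that occur as values of a spectral density: positive definite, and diagonal unless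
`α = 2`. -/
def Admissible {T : ℕ} (α : ℝ) (F : Matrix (Fin T) (Fin T) ℂ) : Prop :=
  F.PosDef ∧ (α = 2 ∨ F.IsDiag)

/-- `Re wᵀ F w^{<α-1>}`. -/
def form {T : ℕ} (α : ℝ) (F : Matrix (Fin T) (Fin T) ℂ) (w : Fin T → ℂ) : ℝ :=
  (w ⬝ᵥ (F *ᵥ vpow (α - 1) w)).re

variable {T : ℕ} {α : ℝ} {F : Matrix (Fin T) (Fin T) ℂ}

open scoped MatrixOrder in
lemma exists_eq_conjTranspose_mul_self (hF : F.PosDef) :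
    ∃ B : Matrix (Fin T) (Fin T) ℂ, F = Bᴴ * B :=
  CStarAlgebra.nonneg_iff_eq_star_mul_self.1 hF.posSemidef.nonneg

/-- The form of an admissible matrix is the `ℓ^α`-form in suitable coordinates. -/
lemma Admissible.exists_factor (hα : 1 < α) (hF : Admissible α F) :
    ∃ W : Matrix (Fin T) (Fin T) ℂ, Function.Injective (fun w => W *ᵥ w) ∧ ∀ w g : Fin T → ℂ,
      w ⬝ᵥ (F *ᵥ vpow (α - 1) g) = ∑ k, (W *ᵥ w) k * spow (α - 1) ((W *ᵥ g) k) := by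
  obtain ⟨hpd, rfl | hd⟩ := hF
  -- For `α = 2` the signed power is conjugation. With `F = Bᴴ B` the entrywise conjugate of `B`,
  -- written `Bᴴᵀ`, serves as `W`, and `F` being definite makes it injective.
  · obtain ⟨B, rfl⟩ : ∃ B : Matrix (Fin T) (Fin T) ℂ, F = Bᴴ * B :=
      exists_eq_conjTranspose_mul_self hpd
    have hs : ∀ z : ℂ, spow (2 - 1) z = (starRingEnd ℂ) z := fun z => by
      rw [spow, show (2 : ℝ) - 1 - 1 = 0 by norm_num, Real.rpow_zero]
      simp
    have hv : ∀ g : Fin T → ℂ, vpow (2 - 1) g = star g := fun g => funext fun k => hs _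
    have hW : ∀ w : Fin T → ℂ, Bᴴᵀ *ᵥ w = star (B *ᵥ star w) := fun w => by
      rw [Matrix.star_mulVec, star_star, Matrix.mulVec_transpose]
    have hmain : ∀ w g : Fin T → ℂ, w ⬝ᵥ ((Bᴴ * B) *ᵥ vpow (2 - 1) g) =
        ∑ k, (Bᴴᵀ *ᵥ w) k * spow (2 - 1) ((Bᴴᵀ *ᵥ g) k) := fun w g => by
      have : ∀ k, spow (2 - 1) ((Bᴴᵀ *ᵥ g) k) = (B *ᵥ star g) k := fun k => by
        rw [hs, hW]; simp
      simp_rw [this]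
      rw [hv, ← Matrix.mulVec_mulVec, Matrix.dotProduct_mulVec, ← Matrix.mulVec_transpose]
      rfl
    refine ⟨Bᴴᵀ, fun w w' h => ?_, hmain⟩
    by_contra hne
    have h0 : Bᴴᵀ *ᵥ (w - w') = 0 := by
      have h : Bᴴᵀ *ᵥ w = Bᴴᵀ *ᵥ w' := h
      rw [Matrix.mulVec_sub, h, sub_self]
    have h1 := hpd.dotProduct_mulVec_pos (x := star (w - w')) (by
      simpa [sub_eq_zero] using hne)
    have h2 := hmain (w - w') (w - w')
    rw [hv, h0] at h2
    simp only [star_star] at h1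
    rw [h2] at h1
    simp at h1
  -- In the diagonal case `W = diag(F_kk^{1/α})`, because `r · r^{<α-1>} = r^α` for `r > 0`.
  · have hdiag : ∀ k, 0 < F k k := fun k => hpd.diag_pos
    have hre : ∀ k, 0 < (F k k).re ∧ F k k = ((F k k).re : ℂ) := fun k => by
      have := Complex.pos_iff.1 (hdiag k)
      exact ⟨this.1, Complex.ext rfl (by simp [← this.2])⟩
    set r : Fin T → ℝ := fun k => (F k k).re ^ (1 / α) with hr
    have hr0 : ∀ k, 0 < r k := fun k => Real.rpow_pos_of_pos (hre k).1 _
    have hW : ∀ (w : Fin T → ℂ) k, (Matrix.diagonal (fun k => (r k : ℂ)) *ᵥ w) k = r k * w k :=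
      fun w k => by rw [Matrix.mulVec_diagonal]
    refine ⟨Matrix.diagonal fun k => (r k : ℂ), fun w w' h => funext fun k => ?_, fun w g => ?_⟩
    · have := congrFun h k
      simp only [hW] at this
      exact mul_left_cancel₀ (by exact_mod_cast (hr0 k).ne') this
    · simp only [hW, spow_mul]
      rw [← hd.diagonal_diag, dotProduct]
      refine Finset.sum_congr rfl fun k _ => ?_
      rw [Matrix.mulVec_diagonal, Matrix.diag_apply, vpow]
      have h1 : (r k : ℂ) * spow (α - 1) (r k : ℂ) = F k k := by
        rw [mul_spow_self hα, Complex.norm_real, Real.norm_of_nonneg (hr0 k).le, hr,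
          ← Real.rpow_mul (hre k).1.le, one_div_mul_cancel (by linarith), Real.rpow_one]
        exact (hre k).2.symm
      rw [← h1]; ring

lemma Admissible.exists_norm (hα : 1 < α) (hF : Admissible α F) :
    ∃ W : Matrix (Fin T) (Fin T) ℂ, Function.Injective (fun w => W *ᵥ w) ∧
      (∀ w g : Fin T → ℂ, w ⬝ᵥ (F *ᵥ vpow (α - 1) g) =
        ∑ k, (W *ᵥ w) k * spow (α - 1) ((W *ᵥ g) k)) ∧
      (∀ w : Fin T → ℂ, w ⬝ᵥ (F *ᵥ vpow (α - 1) w) = ((∑ k, ‖(W *ᵥ w) k‖ ^ α : ℝ) : ℂ)) ∧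
      ∀ w : Fin T → ℂ, form α F w = ∑ k, ‖(W *ᵥ w) k‖ ^ α := by
  obtain ⟨W, hW, h⟩ := hF.exists_factor hα
  have h' : ∀ w : Fin T → ℂ,
      w ⬝ᵥ (F *ᵥ vpow (α - 1) w) = ((∑ k, ‖(W *ᵥ w) k‖ ^ α : ℝ) : ℂ) := fun w => by
    rw [h]
    simp_rw [mul_spow_self hα]
    push_cast; rfl
  refine ⟨W, hW, h, h', fun w => ?_⟩
  rw [form, h', Complex.ofReal_re]

lemma Admissible.ofReal_form (hα : 1 < α) (hF : Admissible α F) (w : Fin T → ℂ) :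
    ((form α F w : ℝ) : ℂ) = w ⬝ᵥ (F *ᵥ vpow (α - 1) w) := by
  obtain ⟨W, -, -, h, h'⟩ := hF.exists_norm hα
  rw [h, h']

lemma Admissible.form_nonneg (hα : 1 < α) (hF : Admissible α F) (w : Fin T → ℂ) :
    0 ≤ form α F w := by
  obtain ⟨W, -, -, -, h'⟩ := hF.exists_norm hα
  rw [h']; positivity

@[simp] lemma form_zero : form α F 0 = 0 := by simp [form]

lemma Admissible.form_eq_zero (hα : 1 < α) (hF : Admissible α F) {w : Fin T → ℂ} :
    form α F w = 0 ↔ w = 0 := by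
  refine ⟨fun h => ?_, fun h => by simp [h]⟩
  obtain ⟨W, hW, -, -, h'⟩ := hF.exists_norm hα
  rw [h', Finset.sum_eq_zero_iff_of_nonneg fun _ _ => by positivity] at h
  apply hW
  simp only [Matrix.mulVec_zero]
  funext k
  have := h k (Finset.mem_univ k)
  rw [Real.rpow_eq_zero (norm_nonneg _) (by linarith)] at this
  simpa using this

/-- The scalar inequality summed over the coordinates `Ww`, `Wg`. Equality of the sums forces
equality in each term, so `Ww = Wg`, and injectivity of `W` gives `w = g`. -/
lemma Admissible.young (hα : 1 < α) (hF : Admissible α F) (w g : Fin T → ℂ) :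
    (w ⬝ᵥ (F *ᵥ vpow (α - 1) g)).re ≤ form α F w / α + (1 - 1 / α) * form α F g ∧
    ((w ⬝ᵥ (F *ᵥ vpow (α - 1) g)).re = form α F w / α + (1 - 1 / α) * form α F g → w = g) := by
  obtain ⟨W, hW, h, -, h'⟩ := hF.exists_norm hα
  have e : form α F w / α + (1 - 1 / α) * form α F g =
      ∑ k, (‖(W *ᵥ w) k‖ ^ α / α + (1 - 1 / α) * ‖(W *ᵥ g) k‖ ^ α) := by
    rw [h', h', Finset.sum_add_distrib, Finset.sum_div, Finset.mul_sum]
  rw [e, h, Complex.re_sum]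
  refine ⟨Finset.sum_le_sum fun k _ => (re_mul_spow_le hα _ _).1,
    fun heq => hW (funext fun k => ?_)⟩
  exact (re_mul_spow_le hα _ _).2 ((Finset.sum_eq_sum_iff_of_le
    fun k _ => (re_mul_spow_le hα _ _).1).1 heq k (Finset.mem_univ k))

/-- Minkowski's inequality in `ℓ^α` for the coordinates `Ww` and `Wg`. -/
lemma Admissible.form_add_rpow_le (hα : 1 < α) (hF : Admissible α F) (w g : Fin T → ℂ) :
    form α F (w + g) ^ (1 / α) ≤ form α F w ^ (1 / α) + form α F g ^ (1 / α) := by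
  obtain ⟨W, -, -, -, h'⟩ := hF.exists_norm hα
  simp only [h', Matrix.mulVec_add, Pi.add_apply]
  have := Real.Lp_add_le Finset.univ (fun k => ‖(W *ᵥ w) k‖) (fun k => ‖(W *ᵥ g) k‖) hα.le
  simp only [abs_norm] at this
  refine le_trans ?_ this
  have h0 : 0 ≤ 1 / α := by positivity
  refine Real.rpow_le_rpow (by positivity) (Finset.sum_le_sum fun k _ => ?_) h0
  refine Real.rpow_le_rpow (by positivity) ((norm_add_le _ _).trans (le_abs_self _)) (by linarith)

lemma form_smul (hα : 1 < α) (c : ℂ) (w : Fin T → ℂ) :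
    form α F (c • w) = ‖c‖ ^ α * form α F w := by
  rw [form, vpow_smul, Matrix.mulVec_smul, smul_dotProduct, dotProduct_smul, smul_smul,
    mul_spow_self hα, smul_eq_mul, Complex.re_ofReal_mul, form]

lemma form_le (hα : 1 < α) (w : Fin T → ℂ) :
    form α F w ≤ (∑ k, ∑ l, ‖F k l‖) * ‖w‖ ^ α := by
  refine (Complex.re_le_norm _).trans ?_
  rw [dotProduct]
  refine (norm_sum_le _ _).trans ?_
  rw [Finset.sum_mul]
  refine Finset.sum_le_sum fun k _ => ?_
  rw [norm_mul, Matrix.mulVec, dotProduct]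
  have e : ‖w‖ ^ α = ‖w‖ * ‖w‖ ^ (α - 1) := by
    have := Real.rpow_add' (norm_nonneg w) (y := 1) (z := α - 1) (by linarith)
    rw [Real.rpow_one] at this
    rw [← this]; congr 1; ring
  calc ‖w k‖ * ‖∑ l, F k l * vpow (α - 1) w l‖
      ≤ ‖w‖ * ∑ l, ‖F k l‖ * ‖w‖ ^ (α - 1) := by
        refine mul_le_mul (norm_le_pi_norm w k) ((norm_sum_le _ _).trans ?_) (norm_nonneg _)
          (norm_nonneg _)
        refine Finset.sum_le_sum fun l _ => ?_
        rw [norm_mul, vpow, norm_spow (by linarith)]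
        exact mul_le_mul_of_nonneg_left (Real.rpow_le_rpow (norm_nonneg _) (norm_le_pi_norm w l)
          (by linarith)) (norm_nonneg _)
    _ = (∑ l, ‖F k l‖) * ‖w‖ ^ α := by rw [← Finset.sum_mul, e]; ring

/-- The solution `g` of `F g^{<α-1>} = C`. -/
def dualVec (α : ℝ) (F : Matrix (Fin T) (Fin T) ℂ) (C : Fin T → ℂ) : Fin T → ℂ :=
  vpow (1 / (α - 1)) (F⁻¹ *ᵥ C)

lemma Admissible.mulVec_vpow_dualVec (hα : 1 < α) (hF : Admissible α F) (C : Fin T → ℂ) :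
    F *ᵥ vpow (α - 1) (dualVec α F C) = C := by
  rw [dualVec, vpow_vpow_inv (by linarith), Matrix.mulVec_mulVec,
    Matrix.mul_nonsing_inv _ ((Matrix.isUnit_iff_isUnit_det _).1 hF.1.isUnit), Matrix.one_mulVec]

lemma Admissible.form_dualVec (hα : 1 < α) (hF : Admissible α F) (C : Fin T → ℂ) :
    form α F (dualVec α F C) = (dualVec α F C ⬝ᵥ C).re := by
  rw [form, hF.mulVec_vpow_dualVec hα]

lemma dualVec_smul (c : ℂ) (C : Fin T → ℂ) :
    dualVec α F (c • C) = spow (1 / (α - 1)) c • dualVec α F C := by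
  rw [dualVec, Matrix.mulVec_smul, vpow_smul, dualVec]

/-- The first factor depends on `F` alone. It is the quantity that the minimality condition makes
integrable, and it dominates every `errChar` in the sequel. -/
lemma norm_dualVec_le (hα : 1 < α) (C : Fin T → ℂ) :
    ‖dualVec α F C‖ ≤
      (∑ k, (∑ l, ‖F⁻¹ k l‖) ^ (1 / (α - 1))) * ‖C‖ ^ (1 / (α - 1)) := by
  have hp : 0 < 1 / (α - 1) := by have : 0 < α - 1 := by linarith
                                  positivity
  rw [pi_norm_le_iff_of_nonneg (by positivity)]
  intro k
  rw [dualVec, vpow, norm_spow hp]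
  have h1 : ‖(F⁻¹ *ᵥ C) k‖ ≤ (∑ l, ‖F⁻¹ k l‖) * ‖C‖ := by
    rw [Matrix.mulVec, dotProduct, Finset.sum_mul]
    refine (norm_sum_le _ _).trans (Finset.sum_le_sum fun l _ => ?_)
    rw [norm_mul]
    exact mul_le_mul_of_nonneg_left (norm_le_pi_norm C l) (norm_nonneg _)
  refine (Real.rpow_le_rpow (norm_nonneg _) h1 hp.le).trans ?_
  rw [Real.mul_rpow (by positivity) (norm_nonneg _)]
  refine mul_le_mul_of_nonneg_right ?_ (by positivity)
  exact Finset.single_le_sum (f := fun k => (∑ l, ‖F⁻¹ k l‖) ^ (1 / (α - 1)))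
    (fun k _ => by positivity) (Finset.mem_univ k)

end

/-! ### Complex stable variables, their circle measures and the stable norm. -/

section

/-! ### Spectral measures on the unit circle -/

instance instMeasurableSpaceCircle : MeasurableSpace Circle := borel Circle

instance instBorelSpaceCircle : BorelSpace Circle := ⟨rfl⟩

variable {Ω : Type*} [MeasurableSpace Ω] {P : Measure Ω} {α : ℝ}

/-- `Γ` is a finite measure on the circle with
`E exp(i Re(wX)) = exp(-∫ |Re(wz)|^α dΓ(z))` for all `w`. -/
structure IsCircleSpectral (P : Measure Ω) (α : ℝ) (X : Ω → ℂ) (Γ : Measure Circle) : Prop where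
  aemeasurable : AEMeasurable X P
  finite : IsFiniteMeasure Γ
  charFun : ∀ w : ℂ, ∫ ω, Complex.exp (Complex.I * ((w * X ω).re : ℂ)) ∂P
      = ((Real.exp (-∫ z, |(w * (z : ℂ)).re| ^ α ∂Γ) : ℝ) : ℂ)

/-- `X` is symmetric `α`-stable with `‖X‖_α^α = c`. -/
def HasScale (P : Measure Ω) (α : ℝ) (X : Ω → ℂ) (c : ℝ) : Prop :=
  ∃ Γ : Measure Circle, IsCircleSpectral P α X Γ ∧ c = Γ.real Set.univ

lemma HasScale.aemeasurable {X : Ω → ℂ} {c : ℝ} (h : HasScale P α X c) : AEMeasurable X P := by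
  obtain ⟨Γ, h, -⟩ := h
  exact h.aemeasurable

lemma HasScale.nonneg {X : Ω → ℂ} {c : ℝ} (h : HasScale P α X c) : 0 ≤ c := by
  obtain ⟨Γ, -, rfl⟩ := h
  exact measureReal_nonneg

lemma continuous_circle_coe : Continuous fun z : Circle => (z : ℂ) := by fun_prop

lemma continuous_abs_re_rpow (hα : 1 < α) (w : ℂ) :
    Continuous fun z : Circle => |(w * (z : ℂ)).re| ^ α :=
  (Complex.continuous_re.comp (continuous_const.mul continuous_circle_coe)).abs.rpow_const
    fun _ => Or.inr (by linarith)

lemma integrable_circle {E : Type*} [NormedAddCommGroup E] {Γ : Measure Circle} [IsFiniteMeasure Γ]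
    {g : Circle → E} [SecondCountableTopology E] (hg : Continuous g) : Integrable g Γ := by
  obtain ⟨B, hB⟩ := isCompact_univ.exists_bound_of_continuousOn hg.continuousOn
  exact Integrable.of_bound (C := B) hg.aestronglyMeasurable (ae_of_all _ fun x => hB x trivial)

/-! ### Averaging over the circle -/

/-- The mean of `|Re u|^α` over the unit circle. -/
def circleMean (α : ℝ) : ℝ := ∫ u : Circle, |(u : ℂ).re| ^ α ∂Measure.haar

lemma circleMean_pos (hα : 1 < α) : 0 < circleMean α := by
  have hc : Continuous fun z : Circle => |(z : ℂ).re| ^ α := by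
    simpa using continuous_abs_re_rpow hα 1
  refine hc.integral_pos_of_hasCompactSupport_nonneg_nonzero
    (HasCompactSupport.of_compactSpace _) (fun u => by positivity) (x := 1) ?_
  simp

/-- The argument of `z` is absorbed by invariance of Haar measure on the circle, leaving only the
modulus. -/
lemma integral_abs_re_mul_rpow (z : ℂ) :
    ∫ u : Circle, |((u : ℂ) * z).re| ^ α ∂Measure.haar = circleMean α * ‖z‖ ^ α := by
  have hz : z = (‖z‖ : ℂ) * (Circle.exp (Complex.arg z) : ℂ) := by
    rw [Circle.coe_exp, Complex.norm_mul_exp_arg_mul_I]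
  have h1 : ∀ u : Circle, |((u : ℂ) * z).re| ^ α =
      |((u * Circle.exp (Complex.arg z) : Circle) : ℂ).re| ^ α * ‖z‖ ^ α := fun u => by
    have : (u : ℂ) * z = (‖z‖ : ℂ) * ((u * Circle.exp (Complex.arg z) : Circle) : ℂ) := by
      conv_lhs => rw [hz]
      push_cast; ring
    rw [this, Complex.re_ofReal_mul, abs_mul, abs_norm,
      Real.mul_rpow (norm_nonneg _) (abs_nonneg _), mul_comm]
  simp_rw [h1]
  rw [integral_mul_const, integral_mul_right_eq_self (μ := (Measure.haar : Measure Circle))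
    (fun u : Circle => |(u : ℂ).re| ^ α)]
  rfl

lemma integral_integral_abs_re (hα : 1 < α) {E : Type*} [MeasurableSpace E] {ν : Measure E}
    [IsFiniteMeasure ν] {L : E → ℂ} (hL : Measurable L) {B : ℝ} (hB : ∀ᵐ x ∂ν, ‖L x‖ ≤ B) :
    ∫ u : Circle, ∫ x, |((u : ℂ) * L x).re| ^ α ∂ν ∂Measure.haar
      = circleMean α * ∫ x, ‖L x‖ ^ α ∂ν := by
  rw [integral_integral_swap]
  · simp_rw [integral_abs_re_mul_rpow]
    rw [integral_const_mul]
  · refine Integrable.of_bound (C := B ^ α) ?_ ?_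
    · apply Measurable.aestronglyMeasurable
      have h1 : Measurable fun p : Circle × E => ((p.1 : ℂ) * L p.2).re :=
        Complex.measurable_re.comp ((continuous_circle_coe.measurable.comp measurable_fst).mul
          (hL.comp measurable_snd))
      exact (h1.abs).pow_const α
    · have := (Measure.quasiMeasurePreserving_snd (μ := (Measure.haar : Measure Circle))
        (ν := ν)).ae hB
      filter_upwards [this] with p hp
      simp only [Function.uncurry]
      rw [Real.norm_of_nonneg (by positivity)]
      refine Real.rpow_le_rpow (abs_nonneg _) ((Complex.abs_re_le_norm _).trans ?_) (by linarith)
      simpa [norm_mul, Circle.norm_coe] using hp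

/-- The scale of `X` is determined by the characteristic function of `X`. -/
lemma HasScale.eq_integral (hα : 1 < α) {X : Ω → ℂ} {c : ℝ} (h : HasScale P α X c)
    {E : Type*} [MeasurableSpace E] {ν : Measure E} [IsFiniteMeasure ν] {L : E → ℂ}
    (hL : Measurable L) {B : ℝ} (hB : ∀ᵐ x ∂ν, ‖L x‖ ≤ B)
    (hcf : ∀ u : Circle, ∫ ω, Complex.exp (Complex.I * (((u : ℂ) * X ω).re : ℂ)) ∂P
      = ((Real.exp (-∫ x, |((u : ℂ) * L x).re| ^ α ∂ν) : ℝ) : ℂ)) :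
    c = ∫ x, ‖L x‖ ^ α ∂ν := by
  obtain ⟨Γ, hΓ, rfl⟩ := h
  have := hΓ.finite
  have h1 : ∀ u : Circle, ∫ z : Circle, |((u : ℂ) * (z : ℂ)).re| ^ α ∂Γ =
      ∫ x, |((u : ℂ) * L x).re| ^ α ∂ν := fun u => by
    have := (hΓ.charFun u).symm.trans (hcf u)
    have := Real.exp_injective (Complex.ofReal_injective this)
    linarith
  -- The two exponents agree for each `u`. Averaging them over `u` replaces `|Re(uz)|^α` by
  -- `circleMean α · |z|^α`, and the positive factor cancels. No uniqueness of spectral measures is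
  -- needed.
  have h2 := integral_integral_abs_re (B := 1) (L := fun z : Circle => (z : ℂ)) hα (ν := Γ)
    continuous_circle_coe.measurable (ae_of_all _ fun z => (Circle.norm_coe z).le)
  simp_rw [h1] at h2
  rw [integral_integral_abs_re hα hL hB] at h2
  have h3 := mul_left_cancel₀ (circleMean_pos hα).ne' h2
  simp only [Circle.norm_coe, Real.one_rpow, integral_const, smul_eq_mul, mul_one] at h3
  exact h3.symm

lemma HasScale.unique (hα : 1 < α) {X : Ω → ℂ} {c d : ℝ} (h : HasScale P α X c)
    (h' : HasScale P α X d) : c = d := by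
  obtain ⟨Γ, hΓ, rfl⟩ := h'
  have := hΓ.finite
  rw [h.eq_integral hα (ν := Γ) (L := fun z : Circle => (z : ℂ)) (B := 1)
    continuous_circle_coe.measurable (ae_of_all _ fun z => (Circle.norm_coe z).le)
    (fun u => hΓ.charFun u)]
  simp only [Circle.norm_coe, Real.one_rpow, integral_const, smul_eq_mul, mul_one]

/-! ### Comparison with the covariation -/

lemma ae_norm_eq_one {n : ℕ} {V : Fin n → Ω → ℝ} {Γ : Measure (EuclideanSpace ℝ (Fin n))}
    (h : IsSphereSpectralMeasure P α V Γ) : ∀ᵐ x ∂Γ, ‖x‖ = 1 := by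
  have h1 := h.sphere
  rw [ae_iff]
  convert h1 using 2
  ext x; simp

lemma integrable_sphere {n : ℕ} {V : Fin n → Ω → ℝ} {Γ : Measure (EuclideanSpace ℝ (Fin n))}
    (h : IsSphereSpectralMeasure P α V Γ) {E : Type*} [NormedAddCommGroup E]
    [SecondCountableTopology E] {g : EuclideanSpace ℝ (Fin n) → E}
    (hg : Continuous g) : Integrable g Γ := by
  have := h.finite
  obtain ⟨B, hB⟩ := (isCompact_sphere (0 : EuclideanSpace ℝ (Fin n)) 1).exists_bound_of_continuousOn
    hg.continuousOn
  refine Integrable.of_bound (C := B) hg.aestronglyMeasurable ?_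
  filter_upwards [ae_norm_eq_one h] with x hx
  exact hB x (by simpa using hx)

lemma continuous_abs_sum_rpow (hα : 1 < α) {n : ℕ} (t : Fin n → ℝ) :
    Continuous fun x : EuclideanSpace ℝ (Fin n) => |∑ i, t i * x i| ^ α := by
  refine Continuous.rpow_const (Continuous.abs ?_) fun _ => Or.inr (by linarith)
  fun_prop

/-- A vanishing linear combination has characteristic function `1`, so the exponent `∫ |⟨t,x⟩|^α dΓ`
is zero: linear relations of the vector are inherited by the support of its spectral measure. -/
lemma ae_sum_eq_zero [IsProbabilityMeasure P] (hα : 1 < α) {n : ℕ} {V : Fin n → Ω → ℝ}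
    {Γ : Measure (EuclideanSpace ℝ (Fin n))}
    (h : IsSphereSpectralMeasure P α V Γ) (t : Fin n → ℝ) (ht : ∀ ω, ∑ i, t i * V i ω = 0) :
    ∀ᵐ x ∂Γ, ∑ i, t i * x i = 0 := by
  have h1 := h.charFun t
  simp only [ht] at h1
  simp only [Complex.ofReal_zero, mul_zero, Complex.exp_zero, integral_const, probReal_univ,
    one_smul] at h1
  have h2 : ∫ x, |∑ i, t i * x i| ^ α ∂Γ = 0 := by
    have : Real.exp (-∫ x, |∑ i, t i * x i| ^ α ∂Γ) = 1 := by exact_mod_cast h1.symm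
    rw [Real.exp_eq_one_iff] at this
    linarith
  rw [integral_eq_zero_iff_of_nonneg (fun x => by positivity)
    (integrable_sphere h (continuous_abs_sum_rpow hα t))] at h2
  filter_upwards [h2] with x hx
  simp only [Pi.zero_apply] at hx
  rwa [Real.rpow_eq_zero (abs_nonneg _) (by linarith), abs_eq_zero] at hx

/-- `x₀ + i x₁`. -/
def cfst (x : EuclideanSpace ℝ (Fin 4)) : ℂ := (x 0 : ℂ) + Complex.I * (x 1 : ℂ)

/-- `x₂ + i x₃`. -/
def csnd (x : EuclideanSpace ℝ (Fin 4)) : ℂ := (x 2 : ℂ) + Complex.I * (x 3 : ℂ)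

lemma continuous_cfst : Continuous cfst := by unfold cfst; fun_prop

lemma continuous_csnd : Continuous csnd := by unfold csnd; fun_prop

/-- With both variables equal, the sphere measure sits on the diagonal `x₀ = x₂`, `x₁ = x₃`, which
is a circle; normalising by the argument of `x₀ + i x₁` pushes it to the unit circle. -/
lemma HasCovariation.hasScale [IsProbabilityMeasure P] (hα : 1 < α) {X : Ω → ℂ} {c : ℂ}
    (h : HasCovariation P α X X c) : HasScale P α X c.re ∧ c = (c.re : ℂ) := by
  obtain ⟨Γ, hΓ, hc⟩ := h
  have := hΓ.finite
  have hα0 : 0 < α := by linarith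
  have e0 : ∀ᵐ x ∂Γ, x 0 = x 2 := by
    filter_upwards [ae_sum_eq_zero hα hΓ ![1, 0, -1, 0]
      (fun ω => by simp [Fin.sum_univ_four])] with x hx
    simp [Fin.sum_univ_four] at hx; linarith
  have e1 : ∀ᵐ x ∂Γ, x 1 = x 3 := by
    filter_upwards [ae_sum_eq_zero hα hΓ ![0, 1, 0, -1]
      (fun ω => by simp [Fin.sum_univ_four])] with x hx
    simp [Fin.sum_univ_four] at hx; linarith
  -- A unit vector `(z, z)` of `ℂ²` has `|z| = 1/√2`. The push-forward is weighted by `r^α` to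
  -- compensate for rescaling to modulus one.
  set r : ℝ := (√2)⁻¹ with hr
  have hr0 : 0 < r := by positivity
  have hn : ∀ᵐ x ∂Γ, ‖cfst x‖ = r := by
    filter_upwards [e0, e1, ae_norm_eq_one hΓ] with x h0 h1 hx
    have h2 : ‖x‖ ^ 2 = 1 := by rw [hx]; norm_num
    rw [EuclideanSpace.norm_sq_eq, Fin.sum_univ_four, ← h0, ← h1] at h2
    simp only [Real.norm_eq_abs, sq_abs] at h2
    have h3 : ‖cfst x‖ ^ 2 = r ^ 2 := by
      rw [← Complex.normSq_eq_norm_sq, cfst, mul_comm, Complex.normSq_add_mul_I, hr, inv_pow,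
        Real.sq_sqrt (by norm_num)]
      linarith
    exact (pow_left_inj₀ (norm_nonneg _) hr0.le (by norm_num)).1 h3
  have hzz : ∀ᵐ x ∂Γ, csnd x = cfst x := by
    filter_upwards [e0, e1] with x h0 h1
    rw [csnd, cfst, h0, h1]
  set Φ : EuclideanSpace ℝ (Fin 4) → Circle := fun x => Circle.exp (Complex.arg (cfst x)) with hΦ
  have hΦm : Measurable Φ := Circle.exp.continuous.measurable.comp
    (Complex.measurable_arg.comp continuous_cfst.measurable)
  have hΦe : ∀ᵐ x ∂Γ, cfst x = (r : ℂ) * (Φ x : ℂ) := by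
    filter_upwards [hn] with x hx
    rw [hΦ, ← hx, Circle.coe_exp, Complex.norm_mul_exp_arg_mul_I]
  have hcr : c = ((r ^ α * Γ.real Set.univ : ℝ) : ℂ) := by
    rw [hc]
    have : ∀ᵐ x ∂Γ, ((x 0 : ℂ) + Complex.I * (x 1 : ℂ)) *
          spow (α - 1) ((x 2 : ℂ) + Complex.I * (x 3 : ℂ)) = ((r ^ α : ℝ) : ℂ) := by
      filter_upwards [hzz, hn] with x h1 h2
      change cfst x * spow (α - 1) (csnd x) = _
      rw [h1, mul_spow_self hα, h2]
    rw [integral_congr_ae this, integral_const, Complex.real_smul]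
    push_cast; ring
  refine ⟨⟨ENNReal.ofReal (r ^ α) • Γ.map Φ, ⟨?_, ?_, fun w => ?_⟩, ?_⟩, ?_⟩
  · have h0 := hΓ.aemeasurable 0
    have h1 := hΓ.aemeasurable 1
    simp only [Matrix.cons_val_zero, Matrix.cons_val_one] at h0 h1
    have := (Complex.measurable_ofReal.comp_aemeasurable h0).add
      ((Complex.measurable_ofReal.comp_aemeasurable h1).mul_const Complex.I)
    refine this.congr (ae_of_all _ fun ω => ?_)
    simp [Complex.re_add_im]
  · exact Measure.smul_finite _ ENNReal.ofReal_ne_top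
  · have h1 := hΓ.charFun ![w.re, -w.im, 0, 0]
    have e1 : ∀ ω, (∑ i, ![w.re, -w.im, 0, 0] i * (![fun ω => (X ω).re, fun ω => (X ω).im,
        fun ω => (X ω).re, fun ω => (X ω).im] : Fin 4 → Ω → ℝ) i ω) = (w * X ω).re := fun ω => by
      simp [Fin.sum_univ_four, Complex.mul_re]; ring
    simp only [e1] at h1
    rw [h1]
    congr 3
    rw [integral_smul_measure, ENNReal.toReal_ofReal (by positivity),
      integral_map hΦm.aemeasurable (continuous_abs_re_rpow hα w).aestronglyMeasurable,
      smul_eq_mul, ← integral_const_mul]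
    refine integral_congr_ae ?_
    filter_upwards [hΦe] with x hx
    have : ∑ i, ![w.re, -w.im, 0, 0] i * x i = (w * cfst x).re := by
      simp [Fin.sum_univ_four, Complex.mul_re, cfst]; ring
    rw [this, hx, mul_left_comm, Complex.re_ofReal_mul, abs_mul, abs_of_pos hr0,
      Real.mul_rpow hr0.le (abs_nonneg _)]
  · rw [hcr, Complex.ofReal_re, measureReal_def, measureReal_def, Measure.smul_apply,
      Measure.map_apply hΦm MeasurableSet.univ, smul_eq_mul, ENNReal.toReal_mul,
      ENNReal.toReal_ofReal (by positivity)]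
    simp
  · rw [hcr, Complex.ofReal_re]

/-- The circle is embedded in the diagonal of `ℂ²` and the image is symmetrised, as a spectral
measure on the sphere is required to be symmetric. -/
lemma HasScale.hasCovariation (hα : 1 < α) {X : Ω → ℂ} {c : ℝ} (h : HasScale P α X c) :
    HasCovariation P α X X (c : ℂ) := by
  obtain ⟨Γ, hΓ, rfl⟩ := h
  have := hΓ.finite
  set r : ℝ := (√2)⁻¹ with hr
  have hr0 : 0 < r := by positivity
  have hr2 : r ^ 2 = 1 / 2 := by rw [hr, inv_pow, Real.sq_sqrt (by norm_num)]; norm_num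
  set Ψ : Circle → EuclideanSpace ℝ (Fin 4) := fun u => WithLp.toLp 2
    ![r * (u : ℂ).re, r * (u : ℂ).im, r * (u : ℂ).re, r * (u : ℂ).im] with hΨ
  have hΨc : Continuous Ψ := by
    refine (PiLp.continuous_toLp 2 _).comp (continuous_pi fun i => ?_)
    have h1 : Continuous fun u : Circle => r * (u : ℂ).re :=
      continuous_const.mul (Complex.continuous_re.comp continuous_circle_coe)
    have h2 : Continuous fun u : Circle => r * (u : ℂ).im :=
      continuous_const.mul (Complex.continuous_im.comp continuous_circle_coe)
    fin_cases i <;> simpa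
  have hneg : Continuous fun u => -Ψ u := hΨc.neg
  -- The half accounts for the two copies in the symmetrisation, the other factor for the radius `r`
  -- of the embedded circle; hence `2κ r^α = 1`.
  set κ : ℝ := (r ^ α)⁻¹ / 2 with hκ
  have hrα : 0 < r ^ α := by positivity
  have hκ0 : 0 < κ := by positivity
  set Γ' : Measure (EuclideanSpace ℝ (Fin 4)) :=
    ENNReal.ofReal κ • (Γ.map Ψ + Γ.map fun u => -Ψ u) with hΓ'
  have hint : ∀ {E : Type} [NormedAddCommGroup E] [NormedSpace ℝ E] [SecondCountableTopology E]
      (g : EuclideanSpace ℝ (Fin 4) → E), Continuous g → (∀ x, g (-x) = g x) →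
      ∫ x, g x ∂Γ' = (2 * κ) • ∫ u, g (Ψ u) ∂Γ := by
    intro E _ _ _ g hg hs
    rw [hΓ', integral_smul_measure, ENNReal.toReal_ofReal hκ0.le, integral_add_measure,
      integral_map hΨc.measurable.aemeasurable hg.aestronglyMeasurable,
      integral_map hneg.measurable.aemeasurable hg.aestronglyMeasurable]
    · simp only [hs]
      rw [← two_smul ℝ, smul_smul, mul_comm]
    · exact (integrable_map_measure hg.aestronglyMeasurable hΨc.measurable.aemeasurable).2
        (integrable_circle (hg.comp hΨc))
    · exact (integrable_map_measure hg.aestronglyMeasurable hneg.measurable.aemeasurable).2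
        (integrable_circle (hg.comp hneg))
  have hX := hΓ.aemeasurable
  have hXre := Complex.measurable_re.comp_aemeasurable hX
  have hXim := Complex.measurable_im.comp_aemeasurable hX
  have hc1 : ∀ u : Circle, cfst (Ψ u) = r * u := fun u => by
    apply Complex.ext <;> simp [cfst, hΨ]
  have hc2 : ∀ u : Circle, csnd (Ψ u) = r * u := fun u => by
    apply Complex.ext <;> simp [csnd, hΨ]
  have hκr : 2 * κ * r ^ α = 1 := by rw [hκ]; field_simp
  refine ⟨Γ', ⟨fun i => ?_, ?_, ?_, ?_, fun t => ?_⟩, ?_⟩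
  · fin_cases i
    · exact hXre
    · exact hXim
    · exact hXre
    · exact hXim
  · exact Measure.smul_finite _ ENNReal.ofReal_ne_top
  · have hm : MeasurableSet (Metric.sphere (0 : EuclideanSpace ℝ (Fin 4)) 1)ᶜ :=
      Metric.isClosed_sphere.measurableSet.compl
    have h1 : ∀ u, ‖Ψ u‖ = 1 := fun u => by
      have hu : (u : ℂ).re ^ 2 + (u : ℂ).im ^ 2 = 1 := by
        have := Circle.normSq_coe u
        rw [Complex.normSq_apply] at this
        nlinarith
      have : ‖Ψ u‖ ^ 2 = 1 := by
        rw [EuclideanSpace.norm_sq_eq, Fin.sum_univ_four]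
        simp only [Real.norm_eq_abs, sq_abs, hΨ]
        simp
        rw [mul_pow, mul_pow, hr2]; linarith
      nlinarith [norm_nonneg (Ψ u)]
    rw [hΓ', Measure.smul_apply, Measure.add_apply, Measure.map_apply hΨc.measurable hm,
      Measure.map_apply hneg.measurable hm]
    have e1 : Ψ ⁻¹' (Metric.sphere (0 : EuclideanSpace ℝ (Fin 4)) 1)ᶜ = ∅ := by
      ext u; simp [h1]
    have e2 : (fun u => -Ψ u) ⁻¹' (Metric.sphere (0 : EuclideanSpace ℝ (Fin 4)) 1)ᶜ = ∅ := by
      ext u; simp [h1]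
    rw [e1, e2]; simp
  · rw [hΓ', Measure.map_smul, Measure.map_add _ _ measurable_neg,
      Measure.map_map measurable_neg hΨc.measurable,
      Measure.map_map measurable_neg hneg.measurable]
    have : ((fun x : EuclideanSpace ℝ (Fin 4) => -x) ∘ fun u => -Ψ u) = Ψ := by
      funext u; simp
    rw [this, add_comm]
    rfl
  · have h1 := hΓ.charFun ((t 0 + t 2 : ℝ) - (t 1 + t 3 : ℝ) * Complex.I)
    have e1 : ∀ ω, (∑ i, t i * (![fun ω => (X ω).re, fun ω => (X ω).im,
        fun ω => (X ω).re, fun ω => (X ω).im] : Fin 4 → Ω → ℝ) i ω) =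
        ((((t 0 + t 2 : ℝ) : ℂ) - ((t 1 + t 3 : ℝ) : ℂ) * Complex.I) * X ω).re := fun ω => by
      simp [Fin.sum_univ_four, Complex.mul_re]; ring
    simp only [e1]
    rw [h1, hint _ (continuous_abs_sum_rpow hα t), smul_eq_mul, ← integral_const_mul]
    · congr 4
      funext u
      have : ∑ i, t i * Ψ u i =
          r * ((((t 0 + t 2 : ℝ) : ℂ) - ((t 1 + t 3 : ℝ) : ℂ) * Complex.I) * u).re := by
        simp [Fin.sum_univ_four, Complex.mul_re, hΨ]; ring
      rw [this, abs_mul, abs_of_pos hr0, Real.mul_rpow hr0.le (abs_nonneg _), ← mul_assoc, hκr,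
        one_mul]
    · intro x
      congr 1
      rw [← abs_neg]
      congr 1
      simp [Finset.sum_neg_distrib]
  · change _ = ∫ x, cfst x * spow (α - 1) (csnd x) ∂Γ'
    have hs : Continuous fun x => cfst x * spow (α - 1) (csnd x) :=
      continuous_cfst.mul ((continuous_spow (by linarith)).comp continuous_csnd)
    rw [hint _ hs]
    · simp only [hc1, hc2, mul_spow_self hα]
      simp only [norm_mul, Complex.norm_real, Real.norm_of_nonneg hr0.le, Circle.norm_coe, mul_one,
        integral_const]
      rw [Complex.real_smul, Complex.real_smul]
      norm_cast
      rw [mul_comm (Γ.real _), ← mul_assoc, hκr, one_mul]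
    · intro x
      have h1 : cfst (-x) = -1 * cfst x := by simp [cfst]; ring
      have h2 : csnd (-x) = -1 * csnd x := by simp [csnd]; ring
      rw [h1, h2, spow_mul]
      have : spow (α - 1) (-1) = -1 := by simp [spow]
      rw [this]; ring

/-! ### The stable norm -/

/-- The infimum defining `stableNorm` runs over covariations that all have the same real part, by
uniqueness of the scale. -/
lemma HasScale.stableNorm_eq [IsProbabilityMeasure P] (hα : 1 < α) {X : Ω → ℂ} {c : ℝ}
    (h : HasScale P α X c) : stableNorm P α X = ENNReal.ofReal (c ^ (1 / α)) := by
  refine le_antisymm ?_ ?_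
  · refine (iInf₂_le (c : ℂ) (h.hasCovariation hα)).trans ?_
    simp
  · refine le_iInf₂ fun d hd => ?_
    rw [h.unique hα (hd.hasScale hα).1]

/-- A value below some bound means that the infimum is not over the empty set; this is how
membership in the `‖·‖_α`-closure yields stability of the differences. -/
lemma exists_hasScale_of_stableNorm_lt [IsProbabilityMeasure P] (hα : 1 < α) {X : Ω → ℂ}
    {ε : ℝ≥0∞} (h : stableNorm P α X < ε) :
    ∃ c, HasScale P α X c ∧ ENNReal.ofReal (c ^ (1 / α)) < ε := by
  simp only [stableNorm, iInf_lt_iff] at h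
  obtain ⟨c, hc, h⟩ := h
  exact ⟨c.re, (hc.hasScale hα).1, h⟩

end

/-! ### Sums, limits and tails of stable variables; diagonality of the spectral density for `α < 2`.
-/

section

variable {Ω : Type*} [MeasurableSpace Ω] {P : Measure Ω} {α : ℝ}

/-! ### Sums, limits and tails -/

lemma measurable_exp_re (w : ℂ) : Measurable fun z : ℂ =>
    Complex.exp (Complex.I * ((w * z).re : ℂ)) := by
  have : Continuous fun z : ℂ => Complex.exp (Complex.I * ((w * z).re : ℂ)) := by fun_prop
  exact this.measurable

lemma hasScale_zero [IsProbabilityMeasure P] : HasScale P α (fun _ => 0) 0 :=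
  ⟨0, ⟨aemeasurable_const, inferInstance, fun w => by simp⟩, by simp⟩

/-- Characteristic functions multiply under independence, so the circle measures add. -/
lemma HasScale.add (hα : 1 < α) {X Y : Ω → ℂ} {c d : ℝ} (hX : HasScale P α X c)
    (hY : HasScale P α Y d) (h : IndepFun X Y P) : HasScale P α (X + Y) (c + d) := by
  obtain ⟨Γ, hΓ, rfl⟩ := hX
  obtain ⟨Γ', hΓ', rfl⟩ := hY
  have := hΓ.finite
  have := hΓ'.finite
  refine ⟨Γ + Γ', ⟨hΓ.aemeasurable.add hΓ'.aemeasurable, inferInstance, fun w => ?_⟩, ?_⟩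
  · have h1 : ∀ ω, Complex.exp (Complex.I * ((w * (X + Y) ω).re : ℂ)) =
        Complex.exp (Complex.I * ((w * X ω).re : ℂ)) *
          Complex.exp (Complex.I * ((w * Y ω).re : ℂ)) := fun ω => by
      rw [← Complex.exp_add, Pi.add_apply, mul_add, Complex.add_re]; push_cast; ring_nf
    simp_rw [h1]
    have hm := measurable_exp_re w
    refine ((h.comp hm hm).integral_fun_mul_eq_mul_integral
      (hm.comp_aemeasurable hΓ.aemeasurable).aestronglyMeasurable
      (hm.comp_aemeasurable hΓ'.aemeasurable).aestronglyMeasurable).trans ?_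
    simp only [Function.comp_apply]
    rw [hΓ.charFun, hΓ'.charFun, integral_add_measure
      (integrable_circle (continuous_abs_re_rpow hα w))
      (integrable_circle (continuous_abs_re_rpow hα w)), neg_add, Real.exp_add]
    push_cast; rfl
  · rw [measureReal_add_apply]

lemma HasScale.sum [IsProbabilityMeasure P] (hα : 1 < α) {ι : Type*} {X : ι → Ω → ℂ}
    {c : ι → ℝ} (hX : ∀ i, HasScale P α (X i) (c i)) (h : iIndepFun X P) (s : Finset ι) :
    HasScale P α (∑ i ∈ s, X i) (∑ i ∈ s, c i) := by
  classical
  induction s using Finset.induction_on with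
  | empty => simpa using! hasScale_zero
  | insert i s hi ih =>
    rw [Finset.sum_insert hi, Finset.sum_insert hi, add_comm, add_comm (c i)]
    exact ih.add hα (hX i)
      (h.indepFun_finsetSum_of_notMem₀ (fun i => (hX i).aemeasurable) hi)

/-- The integrand is Lipschitz where `|X - Y| < ε` and bounded by `2` elsewhere. -/
lemma norm_integral_exp_sub_le [IsProbabilityMeasure P] {X Y : Ω → ℂ} (hX : AEMeasurable X P)
    (hY : AEMeasurable Y P) (w : ℂ) {ε : ℝ} (hε : 0 < ε) :
    ‖∫ ω, Complex.exp (Complex.I * ((w * X ω).re : ℂ)) ∂P -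
      ∫ ω, Complex.exp (Complex.I * ((w * Y ω).re : ℂ)) ∂P‖
      ≤ ‖w‖ * ε + 2 * P.real {ω | ε ≤ ‖X ω - Y ω‖} := by
  have hm := measurable_exp_re w
  have hi : ∀ {X : Ω → ℂ}, AEMeasurable X P →
      Integrable (fun ω => Complex.exp (Complex.I * ((w * X ω).re : ℂ))) P := fun {X} hX => by
    refine Integrable.of_bound (C := 1) (hm.comp_aemeasurable hX).aestronglyMeasurable
      (ae_of_all _ fun ω => ?_)
    rw [Complex.norm_exp_I_mul_ofReal]
  have hs : NullMeasurableSet {ω | ε ≤ ‖X ω - Y ω‖} P :=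
    nullMeasurableSet_le aemeasurable_const (hX.sub hY).norm
  rw [← integral_sub (hi hX) (hi hY)]
  have key : ∀ ω, ‖Complex.exp (Complex.I * ((w * X ω).re : ℂ)) -
      Complex.exp (Complex.I * ((w * Y ω).re : ℂ))‖ ≤
      ‖w‖ * ε + {ω | ε ≤ ‖X ω - Y ω‖}.indicator (fun _ => (2 : ℝ)) ω := fun ω => by
    by_cases h : ε ≤ ‖X ω - Y ω‖
    · rw [Set.indicator_of_mem (show ω ∈ {ω | ε ≤ ‖X ω - Y ω‖} from h)]
      refine (norm_sub_le _ _).trans ?_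
      rw [Complex.norm_exp_I_mul_ofReal, Complex.norm_exp_I_mul_ofReal]
      have : 0 ≤ ‖w‖ * ε := by positivity
      linarith
    · rw [Set.indicator_of_notMem (show ω ∉ {ω | ε ≤ ‖X ω - Y ω‖} from h), add_zero]
      have e : Complex.exp (Complex.I * ((w * X ω).re : ℂ)) -
          Complex.exp (Complex.I * ((w * Y ω).re : ℂ)) =
          Complex.exp (Complex.I * ((w * Y ω).re : ℂ)) *
            (Complex.exp (Complex.I * ((w * (X ω - Y ω)).re : ℂ)) - 1) := by
        rw [mul_sub, ← Complex.exp_add, mul_one, mul_sub, Complex.sub_re]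
        push_cast; ring_nf
      rw [e, norm_mul, Complex.norm_exp_I_mul_ofReal, one_mul]
      refine Real.norm_exp_I_mul_ofReal_sub_one_le.trans ?_
      refine (Complex.abs_re_le_norm _).trans ?_
      rw [norm_mul]
      exact mul_le_mul_of_nonneg_left (not_le.1 h).le (norm_nonneg _)
  refine (norm_integral_le_integral_norm _).trans ?_
  have hI : Integrable ({ω | ε ≤ ‖X ω - Y ω‖}.indicator (fun _ => (2 : ℝ))) P :=
    (integrable_const _).indicator₀ hs
  refine (integral_mono_of_nonneg (ae_of_all _ fun _ => norm_nonneg _)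
    ((integrable_const _).add hI) (ae_of_all _ key)).trans ?_
  rw [integral_add' (integrable_const _) hI, integral_indicator₀ hs, integral_const,
    setIntegral_const, probReal_univ]
  simp [mul_comm]

lemma tendsto_integral_exp [IsProbabilityMeasure P] {ι : Type*} {l : Filter ι} {X : ι → Ω → ℂ}
    {Y : Ω → ℂ} (hX : ∀ i, AEMeasurable (X i) P) (hY : AEMeasurable Y P)
    (h : TendstoInMeasure P X l Y) (w : ℂ) :
    Tendsto (fun i => ∫ ω, Complex.exp (Complex.I * ((w * X i ω).re : ℂ)) ∂P) l
      (𝓝 (∫ ω, Complex.exp (Complex.I * ((w * Y ω).re : ℂ)) ∂P)) := by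
  rw [tendstoInMeasure_iff_measureReal_norm] at h
  rw [Metric.tendsto_nhds]
  intro δ hδ
  set ε : ℝ := δ / (2 * (‖w‖ + 1)) with hε
  have hε0 : 0 < ε := by positivity
  filter_upwards [(h ε hε0).eventually (gt_mem_nhds (show (0 : ℝ) < δ / 4 by positivity))] with i hi
  rw [dist_eq_norm]
  refine (norm_integral_exp_sub_le (hX i) hY w hε0).trans_lt ?_
  have : ‖w‖ * ε < δ / 2 := by
    rw [hε, ← mul_div_assoc, div_lt_iff₀ (by positivity)]
    nlinarith [norm_nonneg w]
  linarith

/-- Symmetric stable variables are closed under convergence in probability with convergent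
scales. -/
lemma HasScale.of_tendstoInMeasure [IsProbabilityMeasure P] (hα : 1 < α) {X : ℕ → Ω → ℂ}
    {c : ℕ → ℝ} {Y : Ω → ℂ} {d : ℝ} (hX : ∀ n, HasScale P α (X n) (c n))
    (h : TendstoInMeasure P X atTop Y) (hc : Tendsto c atTop (𝓝 d)) : HasScale P α Y d := by
  have hYm : AEMeasurable Y P := h.aemeasurable fun n => (hX n).aemeasurable
  choose Γ hΓ hΓc using hX
  have hfin : ∀ n, IsFiniteMeasure (Γ n) := fun n => (hΓ n).finite
  obtain ⟨C, hC⟩ := hc.bddAbove_range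
  set G : ℕ → FiniteMeasure Circle := fun n => ⟨Γ n, hfin n⟩ with hG
  have hmass : ∀ n, (G n).mass ≤ C.toNNReal := fun n => by
    rw [← NNReal.coe_le_coe]
    have h1 : ((G n).mass : ℝ) = c n := by rw [hΓc]; rfl
    rw [h1]
    exact (hC (Set.mem_range_self n)).trans (Real.le_coe_toNNReal C)
  -- Finite measures of bounded mass on the compact circle form a compact set, so the spectral
  -- measures converge along an ultrafilter. Both the exponents and the masses are integrals of
  -- continuous functions and pass to the limit, while the full sequences of characteristic
  -- functions and scales already converge.
  set U : Ultrafilter ℕ := Ultrafilter.of atTop with hU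
  have hUle : (U : Filter ℕ) ≤ atTop := Ultrafilter.of_le atTop
  obtain ⟨Γ₀, -, hΓ₀⟩ := (isCompact_setOfPred_finiteMeasure_le_of_compactSpace Circle
    C.toNNReal).ultrafilter_le_nhds (U.map G) (by
      rw [le_principal_iff]
      exact Ultrafilter.mem_map.2 (Filter.mem_of_superset univ_mem fun n _ => hmass n))
  have hlim : Tendsto G U (𝓝 Γ₀) := hΓ₀
  rw [FiniteMeasure.tendsto_iff_forall_integral_tendsto] at hlim
  have hlim' : ∀ g : Circle → ℝ, Continuous g →
      Tendsto (fun n => ∫ z, g z ∂Γ n) U (𝓝 (∫ z, g z ∂(Γ₀ : Measure Circle))) := fun g hg =>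
    hlim (BoundedContinuousFunction.mkOfCompact ⟨g, hg⟩)
  refine ⟨Γ₀, ⟨hYm, inferInstance, fun w => ?_⟩, ?_⟩
  · have h1 := (tendsto_integral_exp (fun n => (hΓ n).aemeasurable) hYm h w).mono_left hUle
    simp_rw [(hΓ _).charFun] at h1
    refine tendsto_nhds_unique h1 ?_
    exact (Complex.continuous_ofReal.tendsto _).comp ((Real.continuous_exp.tendsto _).comp
      (hlim' _ (continuous_abs_re_rpow hα w)).neg)
  · have h1 := hlim' (fun _ => 1) continuous_const
    simp only [integral_const, smul_eq_mul, mul_one] at h1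
    simp_rw [← hΓc] at h1
    exact tendsto_nhds_unique (hc.mono_left hUle) h1

lemma integral_abs_re_le (hα : 1 < α) {Γ : Measure Circle} [IsFiniteMeasure Γ] (w : ℂ) :
    ∫ z, |(w * (z : ℂ)).re| ^ α ∂Γ ≤ ‖w‖ ^ α * Γ.real Set.univ := by
  calc _ ≤ ∫ _, ‖w‖ ^ α ∂Γ := by
        refine integral_mono (integrable_circle (continuous_abs_re_rpow hα w))
          (integrable_const _) fun z => ?_
        refine Real.rpow_le_rpow (abs_nonneg _) ((Complex.abs_re_le_norm _).trans ?_) (by linarith)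
        rw [norm_mul, Circle.norm_coe, mul_one]
    _ = _ := by simp [mul_comm]

/-- The tail is bounded by an average of `|1 - φ(t)|` over `|t| ≤ 2/r`, where `1 - e^{-x} ≤ x` and
the exponent is at most `|t|^α` times the scale. -/
lemma HasScale.measureReal_re_le [IsProbabilityMeasure P] (hα : 1 < α) {X : Ω → ℂ} {c : ℝ}
    (h : HasScale P α X c) {w : ℂ} (hw : ‖w‖ = 1) {r : ℝ} (hr : 0 < r) :
    P.real {ω | r < |(w * X ω).re|} ≤ 2 * (2 / r) ^ α * c := by
  obtain ⟨Γ, hΓ, rfl⟩ := h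
  have := hΓ.finite
  have hXm : AEMeasurable (fun ω => (w * X ω).re) P :=
    Complex.measurable_re.comp_aemeasurable (hΓ.aemeasurable.const_mul w)
  have := Measure.isProbabilityMeasure_map hXm
  have h1 := measureReal_abs_gt_le_integral_charFun (μ := P.map fun ω => (w * X ω).re) hr
  have h2 : (P.map fun ω => (w * X ω).re).real {x | r < |x|} = P.real {ω | r < |(w * X ω).re|} := by
    rw [measureReal_def, Measure.map_apply_of_aemeasurable hXm
      (measurableSet_lt measurable_const measurable_abs)]
    rfl
  have h3 : ∀ t ∈ Set.uIoc (-2 * r⁻¹) (2 * r⁻¹), ‖1 - charFun (P.map fun ω => (w * X ω).re) t‖ ≤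
      (2 / r) ^ α * Γ.real Set.univ := fun t ht => by
    rw [Set.uIoc_of_le (by have : 0 < r⁻¹ := by positivity
                           linarith)] at ht
    have e : charFun (P.map fun ω => (w * X ω).re) t =
        ((Real.exp (-∫ z, |((t * w) * (z : ℂ)).re| ^ α ∂Γ) : ℝ) : ℂ) := by
      rw [charFun_apply_real, integral_map hXm (by fun_prop), ← hΓ.charFun]
      congr 1; funext ω
      rw [mul_assoc (t : ℂ) w, Complex.re_ofReal_mul]; push_cast; ring_nf
    rw [e, ← Complex.ofReal_one, ← Complex.ofReal_sub, Complex.norm_real]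
    have e0 : 0 ≤ ∫ z, |((t * w) * (z : ℂ)).re| ^ α ∂Γ := integral_nonneg fun z => by positivity
    rw [Real.norm_of_nonneg (by
      have := Real.exp_le_one_iff.2 (neg_nonpos.2 e0)
      linarith)]
    have e1 := Real.add_one_le_exp (-∫ z, |((t * w) * (z : ℂ)).re| ^ α ∂Γ)
    have e2 := integral_abs_re_le (Γ := Γ) hα (t * w)
    have e3 : ‖(t : ℂ) * w‖ ^ α ≤ (2 / r) ^ α := by
      refine Real.rpow_le_rpow (norm_nonneg _) ?_ (by linarith)
      rw [norm_mul, hw, mul_one, Complex.norm_real, Real.norm_eq_abs, abs_le, div_eq_mul_inv]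
      exact ⟨by linarith [ht.1], ht.2⟩
    have e4 := mul_le_mul_of_nonneg_right e3 (measureReal_nonneg (μ := Γ) (s := Set.univ))
    linarith
  have h4 := intervalIntegral.norm_integral_le_of_norm_le_const h3
  rw [h2] at h1
  refine h1.trans ?_
  have h5 : |2 * r⁻¹ - -2 * r⁻¹| = 4 * r⁻¹ := by
    have : 0 < r⁻¹ := by positivity
    rw [abs_of_nonneg (by linarith)]
    ring
  rw [h5] at h4
  calc _ ≤ 2⁻¹ * r * ((2 / r) ^ α * Γ.real Set.univ * (4 * r⁻¹)) :=
        mul_le_mul_of_nonneg_left h4 (by positivity)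
    _ = _ := by field_simp; ring

/-- The factors `1` and `-i` give the real and the imaginary part. The threshold `r/4` instead of
`r/2` leaves slack for the non-strict inequality defining the event. -/
lemma HasScale.measureReal_norm_le [IsProbabilityMeasure P] (hα : 1 < α) {X : Ω → ℂ} {c : ℝ}
    (h : HasScale P α X c) {r : ℝ} (hr : 0 < r) :
    P.real {ω | r ≤ ‖X ω‖} ≤ 4 * (8 / r) ^ α * c := by
  have h1 := h.measureReal_re_le hα (w := 1) (by simp) (r := r / 4) (by positivity)
  have h2 := h.measureReal_re_le hα (w := -Complex.I) (by simp) (r := r / 4) (by positivity)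
  have h3 : {ω | r ≤ ‖X ω‖} ⊆
      {ω | r / 4 < |(1 * X ω).re|} ∪ {ω | r / 4 < |(-Complex.I * X ω).re|} := by
    intro ω hω
    by_contra hcon
    simp only [Set.mem_union, Set.mem_ofPred_eq, not_or, not_lt] at hcon hω
    have := Complex.norm_le_abs_re_add_abs_im (X ω)
    simp at hcon
    linarith [hcon.1, hcon.2]
  have h4 := (measureReal_mono h3 (by finiteness)).trans (measureReal_union_le (μ := P) _ _)
  have h5 : 2 / (r / 4) = 8 / r := by field_simp; norm_num
  rw [h5] at h1 h2
  linarith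

lemma tendstoInMeasure_zero_of_hasScale [IsProbabilityMeasure P] (hα : 1 < α) {ι : Type*}
    {l : Filter ι} {X : ι → Ω → ℂ} {c : ι → ℝ} (hX : ∀ i, HasScale P α (X i) (c i))
    (hc : Tendsto c l (𝓝 0)) : TendstoInMeasure P X l (fun _ => 0) := by
  rw [tendstoInMeasure_iff_measureReal_norm]
  intro ε hε
  simp only [sub_zero]
  refine squeeze_zero (fun i => measureReal_nonneg) (fun i => (hX i).measureReal_norm_le hα hε) ?_
  simpa using hc.const_mul (4 * (8 / ε) ^ α)

/-- Since `α ≤ 2`, points of the unit circle satisfy `|x|^α + |y|^α ≥ x² + y² = 1`. The scale is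
therefore at most the sum of the exponents at `w = 1` and `w = -i`, and these tend to `0` because
the characteristic functions tend to `1`. -/
lemma tendsto_scale_zero [IsProbabilityMeasure P] (hα : 1 < α) (hα' : α ≤ 2) {ι : Type*}
    {l : Filter ι} {X : ι → Ω → ℂ} {c : ι → ℝ} (hX : ∀ i, HasScale P α (X i) (c i))
    (h : TendstoInMeasure P X l (fun _ => 0)) : Tendsto c l (𝓝 0) := by
  have hX' := hX
  choose Γ hΓ hc using hX'
  have hlim : ∀ w : ℂ, Tendsto (fun i => ∫ z, |(w * (z : ℂ)).re| ^ α ∂Γ i) l (𝓝 0) := fun w => by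
    have h1 := tendsto_integral_exp (fun i => (hX i).aemeasurable) aemeasurable_const h w
    simp_rw [(hΓ _).charFun] at h1
    have h2 := (Complex.continuous_re.tendsto _).comp h1
    simp only [Function.comp_def, Complex.ofReal_re] at h2
    have h3 := (Real.continuousAt_log (x := 1) one_ne_zero).tendsto.comp
      (by simpa using h2)
    simpa [Function.comp_def, Real.log_exp] using h3.neg
  have hlim2 := (hlim 1).add (hlim (-Complex.I))
  rw [add_zero] at hlim2
  refine squeeze_zero (fun i => (hX i).nonneg) (fun i => ?_) hlim2
  have := (hΓ i).finite
  rw [hc i, ← integral_add (integrable_circle (continuous_abs_re_rpow hα _))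
    (integrable_circle (continuous_abs_re_rpow hα _))]
  calc (Γ i).real Set.univ = ∫ _, (1 : ℝ) ∂Γ i := by simp
    _ ≤ _ := by
      refine integral_mono (integrable_const _)
        ((integrable_circle (continuous_abs_re_rpow hα _)).add
          (integrable_circle (continuous_abs_re_rpow hα _))) fun z => ?_
      have hz := Circle.normSq_coe z
      rw [Complex.normSq_apply] at hz
      have aux : ∀ x : ℝ, x * x ≤ 1 → x * x ≤ |x| ^ α := fun x hx => by
        have h1 : |x| ≤ 1 := by rw [abs_le]; constructor <;> nlinarith
        have h2 := Real.rpow_le_rpow_of_exponent_ge_of_imp (abs_nonneg x) h1 hα'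
          (fun _ h => by linarith)
        have h3 : |x| ^ (2 : ℝ) = x * x := by
          rw [Real.rpow_two, sq_abs, sq]
        linarith
      have e1 : (1 * (z : ℂ)).re = (z : ℂ).re := by simp
      have e2 : (-Complex.I * (z : ℂ)).re = (z : ℂ).im := by simp
      simp only [e1, e2]
      have h1 := aux (z : ℂ).re (by nlinarith)
      have h2 := aux (z : ℂ).im (by nlinarith)
      linarith

/-! ### The spectral density is diagonal unless `α = 2` -/

/-- Young's inequality is the tangent-line bound `x^α - y^α ≤ α x^{α-1}(x - y)`, and `α x^{α-1} ≤ 2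
· 2` on `[0, 2]`. -/
lemma abs_rpow_sub_rpow_le (hα : 1 < α) (hα' : α ≤ 2) {x y : ℝ} (hx : 0 ≤ x) (hy : 0 ≤ y)
    (hx2 : x ≤ 2) (hy2 : y ≤ 2) : |x ^ α - y ^ α| ≤ 4 * |x - y| := by
  have aux : ∀ {x y : ℝ}, 0 ≤ x → 0 ≤ y → x ≤ 2 → y ≤ x → x ^ α - y ^ α ≤ 4 * (x - y) := by
    intro x y hx hy hx2 hyx
    have h := (young_rpow hα hy hx).1
    have e : x ^ α = x * x ^ (α - 1) := by
      have := Real.rpow_add' hx (y := 1) (z := α - 1) (by linarith)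
      rw [Real.rpow_one] at this
      rw [← this]; congr 1; ring
    have h1 : x ^ α - y ^ α ≤ α * (x ^ (α - 1) * (x - y)) := by
      have h2 : y ^ α / α + (1 - 1 / α) * x ^ α = (y ^ α + (α - 1) * x ^ α) / α := by
        field_simp
      rw [h2, le_div_iff₀ (by linarith)] at h
      have : α * (x ^ (α - 1) * (x - y)) = α * x ^ α - y * x ^ (α - 1) * α := by rw [e]; ring
      linarith
    refine h1.trans ?_
    have h3 : x ^ (α - 1) ≤ 2 := by
      calc x ^ (α - 1) ≤ 2 ^ (α - 1) := Real.rpow_le_rpow hx hx2 (by linarith)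
        _ ≤ 2 ^ (1 : ℝ) := Real.rpow_le_rpow_of_exponent_le (by norm_num) (by linarith)
        _ = 2 := by norm_num
    have h4 : 0 ≤ x ^ (α - 1) := by positivity
    have h5 : α * x ^ (α - 1) ≤ 4 := by nlinarith
    rw [← mul_assoc]
    exact mul_le_mul_of_nonneg_right h5 (by linarith)
  rcases le_total y x with h | h
  · rw [abs_of_nonneg (sub_nonneg.2 (Real.rpow_le_rpow hy h (by linarith))),
      abs_of_nonneg (sub_nonneg.2 h)]
    exact aux hx hy hx2 h
  · rw [abs_sub_comm, abs_sub_comm x, abs_of_nonneg (sub_nonneg.2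
      (Real.rpow_le_rpow hx h (by linarith))), abs_of_nonneg (sub_nonneg.2 h)]
    exact aux hy hx hy2 h

lemma norm_cfst_csnd_le {n : EuclideanSpace ℝ (Fin 4)} (hn : ‖n‖ = 1) :
    ‖cfst n‖ ≤ 1 ∧ ‖csnd n‖ ≤ 1 := by
  have h2 : ‖n‖ ^ 2 = 1 := by rw [hn]; norm_num
  rw [EuclideanSpace.norm_sq_eq, Fin.sum_univ_four] at h2
  simp only [Real.norm_eq_abs, sq_abs] at h2
  have h3 : ‖cfst n‖ ^ 2 = n 0 ^ 2 + n 1 ^ 2 := by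
    rw [← Complex.normSq_eq_norm_sq, cfst, mul_comm, Complex.normSq_add_mul_I]
  have h4 : ‖csnd n‖ ^ 2 = n 2 ^ 2 + n 3 ^ 2 := by
    rw [← Complex.normSq_eq_norm_sq, csnd, mul_comm, Complex.normSq_add_mul_I]
  constructor
  · nlinarith [norm_nonneg (cfst n), sq_nonneg (n 2), sq_nonneg (n 3)]
  · nlinarith [norm_nonneg (csnd n), sq_nonneg (n 0), sq_nonneg (n 1)]

/-- If `‖Y + sX‖_α^α = A + s^α B + s C + s^{α-1} D` for all `s ≥ 0`, then `D = 0`. -/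
lemma eq_zero_of_hasCovariation_add [IsProbabilityMeasure P] (hα : 1 < α) (hα' : α < 2)
    {X Y : Ω → ℂ} {c A B C D : ℂ} (hXY : HasCovariation P α X Y c)
    (h : ∀ s : ℝ, 0 ≤ s → HasCovariation P α (fun ω => Y ω + s * X ω) (fun ω => Y ω + s * X ω)
      (A + ((s ^ α : ℝ) : ℂ) * B + s * C + ((s ^ (α - 1) : ℝ) : ℂ) * D)) : D = 0 := by
  obtain ⟨Γ, hΓ, -⟩ := hXY
  have := hΓ.finite
  -- `G(s) = ‖Y + sX‖_α^α` computed from the joint spectral measure of `(X, Y)`. It differs from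
  -- `G(0)` by `O(s)`, as do the terms in `B` and `C`; hence `s^{α-1} D = O(s)`, so `‖D‖ =
  -- O(s^{2-α})`, which tends to `0` since `α < 2`.
  set G : ℝ → ℝ := fun s => ∫ x, ‖csnd x + s * cfst x‖ ^ α ∂Γ with hG
  have hcont : ∀ s : ℝ, Continuous fun x => csnd x + (s : ℂ) * cfst x := fun s =>
    continuous_csnd.add (continuous_const.mul continuous_cfst)
  have hbd : ∀ s : ℝ, 0 ≤ s → s ≤ 1 → ∀ᵐ x ∂Γ, ‖csnd x + (s : ℂ) * cfst x‖ ≤ 2 := fun s h0 h1 => by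
    filter_upwards [ae_norm_eq_one hΓ] with x hx
    obtain ⟨h2, h3⟩ := norm_cfst_csnd_le hx
    refine (norm_add_le _ _).trans ?_
    rw [norm_mul, Complex.norm_real, Real.norm_of_nonneg h0]
    nlinarith [norm_nonneg (cfst x)]
  have hGs : ∀ s : ℝ, 0 ≤ s → s ≤ 1 →
      A + ((s ^ α : ℝ) : ℂ) * B + s * C + ((s ^ (α - 1) : ℝ) : ℂ) * D = (G s : ℂ) :=
    fun s h0 h1 => by
    obtain ⟨h2, h3⟩ := (h s h0).hasScale hα
    rw [h3, h2.eq_integral hα (hcont s).measurable (hbd s h0 h1) fun u => ?_]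
    have h4 := hΓ.charFun ![s * (u : ℂ).re, -(s * (u : ℂ).im), (u : ℂ).re, -(u : ℂ).im]
    convert h4 using 4
    · congr 2
      simp [Fin.sum_univ_four, Complex.mul_re]; ring
    · congr 2
      funext x
      congr 2
      simp [Fin.sum_univ_four, Complex.mul_re, cfst, csnd]; ring
  have hG0 : A = (G 0 : ℂ) := by
    have := hGs 0 le_rfl zero_le_one
    rw [Real.zero_rpow (by linarith), Real.zero_rpow (by linarith)] at this
    simpa using this
  have hdiff : ∀ s : ℝ, 0 ≤ s → s ≤ 1 → |G s - G 0| ≤ 4 * Γ.real Set.univ * s := fun s h0 h1 => by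
    have hi : ∀ s : ℝ, Integrable (fun x => ‖csnd x + (s : ℂ) * cfst x‖ ^ α) Γ := fun s =>
      integrable_sphere hΓ ((hcont s).norm.rpow_const fun _ => Or.inr (by linarith))
    rw [hG, ← integral_sub (hi s) (hi 0)]
    have := norm_integral_le_of_norm_le_const (μ := Γ) (C := 4 * s)
      (f := fun x => ‖csnd x + (s : ℂ) * cfst x‖ ^ α - ‖csnd x + ((0 : ℝ) : ℂ) * cfst x‖ ^ α) (by
        filter_upwards [hbd s h0 h1, hbd 0 le_rfl zero_le_one, ae_norm_eq_one hΓ] with x h2 h3 h4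
        refine (abs_rpow_sub_rpow_le hα hα'.le (norm_nonneg _) (norm_nonneg _) h2 h3).trans ?_
        refine mul_le_mul_of_nonneg_left ((abs_norm_sub_norm_le _ _).trans ?_) (by norm_num)
        have : csnd x + (s : ℂ) * cfst x - (csnd x + ((0 : ℝ) : ℂ) * cfst x) = s * cfst x := by
          push_cast; ring
        rw [this, norm_mul, Complex.norm_real, Real.norm_of_nonneg h0]
        nlinarith [(norm_cfst_csnd_le h4).1])
    rw [Real.norm_eq_abs] at this
    linarith
  have hD : ∀ s : ℝ, 0 < s → s ≤ 1 →
      ‖D‖ ≤ (4 * Γ.real Set.univ + ‖B‖ + ‖C‖) * s ^ (2 - α) := fun s h0 h1 => by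
    have e1 : ((s ^ (α - 1) : ℝ) : ℂ) * D =
        ((G s - G 0 : ℝ) : ℂ) - ((s ^ α : ℝ) : ℂ) * B - s * C := by
      have := hGs s h0.le h1
      rw [hG0] at this
      push_cast
      linear_combination this
    have hsα : 0 < s ^ (α - 1) := by positivity
    have e2 : s ^ (α - 1) * ‖D‖ ≤ (4 * Γ.real Set.univ + ‖B‖ + ‖C‖) * s := by
      have h2 : ‖((s ^ (α - 1) : ℝ) : ℂ) * D‖ = s ^ (α - 1) * ‖D‖ := by
        rw [norm_mul, Complex.norm_real, Real.norm_of_nonneg hsα.le]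
      rw [← h2, e1]
      refine (norm_sub_le _ _).trans ((add_le_add_left (norm_sub_le _ _) _).trans ?_)
      rw [norm_mul, norm_mul, Complex.norm_real, Complex.norm_real, Complex.norm_real,
        Real.norm_of_nonneg h0.le, Real.norm_of_nonneg (by positivity : 0 ≤ s ^ α)]
      have h3 := hdiff s h0.le h1
      rw [← Real.norm_eq_abs] at h3
      have h4 : s ^ α ≤ s := by
        simpa using Real.rpow_le_rpow_of_exponent_ge h0 h1 hα.le
      have h5 := mul_le_mul_of_nonneg_right h4 (norm_nonneg B)
      nlinarith
    have e3 : s = s ^ (α - 1) * s ^ (2 - α) := by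
      rw [← Real.rpow_add h0]; ring_nf; simp
    have e4 : s ^ (α - 1) * ‖D‖ ≤
        s ^ (α - 1) * ((4 * Γ.real Set.univ + ‖B‖ + ‖C‖) * s ^ (2 - α)) := by
      refine e2.trans (le_of_eq ?_)
      conv_lhs => rw [e3]
      ring
    exact le_of_mul_le_mul_left e4 hsα
  have hlim : Tendsto (fun s : ℝ => (4 * Γ.real Set.univ + ‖B‖ + ‖C‖) * s ^ (2 - α)) (𝓝[>] 0)
      (𝓝 0) := by
    have h1 : Continuous fun s : ℝ => (4 * Γ.real Set.univ + ‖B‖ + ‖C‖) * s ^ (2 - α) :=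
      continuous_const.mul (continuous_id.rpow_const fun _ => Or.inr (by linarith))
    have h2 := h1.tendsto 0
    rw [Real.zero_rpow (by linarith), mul_zero] at h2
    exact h2.mono_left nhdsWithin_le_nhds
  have : ‖D‖ ≤ 0 := by
    refine ge_of_tendsto hlim ?_
    filter_upwards [Ioc_mem_nhdsGT (zero_lt_one' ℝ)] with s hs
    exact hD s hs.1 hs.2
  simpa using this

/-- For `v = δ_k + rδ_l` the density formula gives `‖ΔZ_k + rΔZ_l‖_α^α = M_kk + r^α M_ll + r M_lk +
r^{α-1} M_kl`, whose last term must vanish by the preceding expansion lemma. -/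
lemma HasSpectralDensity.integral_eq_zero [IsProbabilityMeasure P] (hα : 1 < α) (hα' : α < 2)
    {T : ℕ} {Z : Freq → Ω → (Fin T → ℂ)} {f : ℝ → Matrix (Fin T) (Fin T) ℂ}
    (h : HasSpectralDensity P α Z f) {k l : Fin T} (hkl : k ≠ l) {s t : Freq} (hst : s ≤ t) :
    ∫ θ in (s : ℝ)..(t : ℝ), f θ k l = 0 := by
  set M : Matrix (Fin T) (Fin T) ℂ := Matrix.of fun k l => ∫ θ in (s : ℝ)..(t : ℝ), f θ k l with hM
  have hc : ∀ u v : Fin T → ℂ, (∑ k, ∑ l, u k * (∫ θ in (s : ℝ)..(t : ℝ), f θ k l) *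
      vpow (α - 1) v l) = u ⬝ᵥ (M *ᵥ vpow (α - 1) v) := fun u v => by
    simp only [dotProduct, Matrix.mulVec, Finset.mul_sum, hM, Matrix.of_apply, mul_assoc]
  have h2 := h.2 s t hst
  simp only [hc] at h2
  have key := eq_zero_of_hasCovariation_add (D := M k l) (A := M k k) (B := M l l) (C := M l k)
    hα hα' (h2 (Pi.single l 1) (Pi.single k 1)) fun r hr => ?_
  · exact key
  · have h3 := h2 (Pi.single k 1 + (r : ℂ) • Pi.single l 1)
      (Pi.single k 1 + (r : ℂ) • Pi.single l 1)
    have e1 : vpow (α - 1) (Pi.single k 1 + (r : ℂ) • Pi.single l 1 : Fin T → ℂ) =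
        Pi.single k 1 + ((r ^ (α - 1) : ℝ) : ℂ) • Pi.single l 1 := by
      funext j
      have hr1 : spow (α - 1) (r : ℂ) = ((r ^ (α - 1) : ℝ) : ℂ) := by
        rcases hr.eq_or_lt with rfl | hr
        · simp [Real.zero_rpow (by linarith : α - 1 ≠ 0)]
        · rw [spow, Complex.norm_real, Real.norm_of_nonneg hr.le, Complex.conj_ofReal,
            ← Complex.ofReal_mul]
          congr 1
          nth_rewrite 2 [← Real.rpow_one r]
          rw [← Real.rpow_add hr]; congr 1; ring
      have h1' : spow (α - 1) 1 = 1 := by simp [spow]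
      by_cases hjk : j = k
      · subst hjk
        simp [vpow, hkl, h1']
      · by_cases hjl : j = l
        · subst hjl
          simp [vpow, hjk, hr1]
        · simp [vpow, hjk, hjl]
    have e2 : (r : ℂ) * ((r ^ (α - 1) : ℝ) : ℂ) = ((r ^ α : ℝ) : ℂ) := by
      rw [← Complex.ofReal_mul]
      congr 1
      have := Real.rpow_add' hr (y := 1) (z := α - 1) (by linarith)
      rw [Real.rpow_one] at this
      rw [← this]; congr 1; ring
    have e3 : (Pi.single k 1 + (r : ℂ) • Pi.single l 1) ⬝ᵥ (M *ᵥ (Pi.single k 1 +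
        ((r ^ (α - 1) : ℝ) : ℂ) • Pi.single l 1)) =
        M k k + ((r ^ α : ℝ) : ℂ) * M l l + r * M l k + ((r ^ (α - 1) : ℝ) : ℂ) * M k l := by
      simp only [Matrix.mulVec_add, Matrix.mulVec_smul, add_dotProduct, dotProduct_add,
        smul_dotProduct, dotProduct_smul, Matrix.mulVec_single_one, single_one_dotProduct,
        Matrix.col_apply, smul_eq_mul]
      rw [← e2]; ring
    rw [e1, e3] at h3
    have e4 : (fun ω => (Pi.single k 1 + (r : ℂ) • Pi.single l 1) ⬝ᵥ (Z t ω - Z s ω)) =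
        fun ω => Pi.single k 1 ⬝ᵥ (Z t ω - Z s ω) + r * (Pi.single l 1 ⬝ᵥ (Z t ω - Z s ω)) := by
      funext ω; simp [add_dotProduct]; ring
    rw [e4] at h3
    exact h3

end

/-! ### The space `L^α(μ)`: regularity of the density, completeness, embedding into `L¹`. -/

section

/-! ### Regular densities -/

/-- An integrable density with admissible values whose inverse satisfies the integrability condition
of the minimality property. -/
structure RegularDensity {T : ℕ} (α : ℝ) (f : ℝ → Matrix (Fin T) (Fin T) ℂ) : Prop where
  integrable : ∀ k l, Integrable (fun θ => f θ k l) leb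
  admissible : ∀ᵐ θ ∂leb, Admissible α (f θ)
  dual : Integrable (fun θ => ∑ k, (∑ l, ‖(f θ)⁻¹ k l‖) ^ (1 / (α - 1))) leb

variable {T : ℕ} {α : ℝ}

/-- In `F = UΛU*` with `F` diagonal, `U_ki ≠ 0` only if `λ_i = F_kk`. Thus `g(F)_kk = ∑
g(λ_i)|U_ki|² = g(F_kk) ∑ |U_ki|²`, and the rows of `U` are unit vectors. -/
lemma cfc_apply_of_isDiag {F : Matrix (Fin T) (Fin T) ℂ} (hF : F.IsHermitian) (hd : F.IsDiag)
    (g : ℝ → ℝ) (k : Fin T) : cfc g F k k = ((g (F k k).re : ℝ) : ℂ) := by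
  set U : Matrix (Fin T) (Fin T) ℂ := hF.eigenvectorUnitary.1 with hU
  have hUU : U * star U = 1 := Unitary.coe_mul_star_self hF.eigenvectorUnitary
  have hUU' : star U * U = 1 := Unitary.coe_star_mul_self hF.eigenvectorUnitary
  have h1 : F = U * diagonal (fun i => (hF.eigenvalues i : ℂ)) * star U := by
    conv_lhs => rw [hF.spectral_theorem, Unitary.conjStarAlgAut_apply]
    rfl
  have h2 : F * U = U * diagonal (fun i => (hF.eigenvalues i : ℂ)) := by
    conv_lhs => rw [h1]
    rw [mul_assoc, hUU', mul_one]
  have h3 : ∀ i, U k i ≠ 0 → hF.eigenvalues i = (F k k).re := fun i hi => by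
    have h4 := congrFun (congrFun h2 k) i
    have h5 : (F * U) k i = F k k * U k i := by
      conv_lhs => rw [← hd.diagonal_diag, diagonal_mul, diag_apply]
    rw [h5, mul_diagonal, mul_comm] at h4
    rw [mul_left_cancel₀ hi h4, Complex.ofReal_re]
  rw [hF.cfc_eq, IsHermitian.cfc, Unitary.conjStarAlgAut_apply]
  change (U * diagonal (fun i => ((g (hF.eigenvalues i) : ℝ) : ℂ)) * star U) k k = _
  have h4 := congrFun (congrFun hUU k) k
  rw [one_apply_eq, mul_apply] at h4
  rw [mul_apply]
  simp only [mul_diagonal]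
  calc _ = ∑ i, ((g (F k k).re : ℝ) : ℂ) * (U k i * star U i k) := by
        refine Finset.sum_congr rfl fun i _ => ?_
        by_cases hi : U k i = 0
        · simp [hi]
        · rw [h3 i hi]; ring
    _ = _ := by rw [← Finset.mul_sum, h4, mul_one]

lemma cfc_rpow_neg_one {F : Matrix (Fin T) (Fin T) ℂ} (hF : F.PosDef) :
    cfc (fun x : ℝ => x ^ (-(1 / ((2 : ℝ) - 1)))) F = F⁻¹ := by
  have h1 : (fun x : ℝ => x ^ (-(1 / ((2 : ℝ) - 1)))) = fun x => x⁻¹ := by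
    funext x
    rw [show -(1 / ((2 : ℝ) - 1)) = -1 by norm_num, Real.rpow_neg_one]
  rw [h1]
  have h2 := cfc_inv_id (R := ℝ) (p := IsSelfAdjoint) hF.isUnit.unit hF.1
  rw [Matrix.coe_units_inv] at h2
  exact h2

/-- Links the trace in the minimality condition with the entries of the inverse. For `α = 2`, write
`F⁻¹ = BᴴB` and use `|ab| ≤ (a² + b²)/2` to bound the sum of all entries by `T` times the trace. In
the diagonal case the left side equals the trace, and `T + 1` serves both. -/
lemma Admissible.sum_inv_le (hα : 1 < α) {F : Matrix (Fin T) (Fin T) ℂ} (hF : Admissible α F) :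
    ∑ k, (∑ l, ‖F⁻¹ k l‖) ^ (1 / (α - 1)) ≤
      (T + 1) * ‖(cfc (fun x : ℝ => x ^ (-(1 / (α - 1)))) F).trace‖ := by
  obtain ⟨hpd, rfl | hd⟩ := hF
  · rw [cfc_rpow_neg_one hpd]
    obtain ⟨B, hB⟩ := exists_eq_conjTranspose_mul_self hpd.inv
    set b : Fin T → ℝ := fun k => ∑ i, ‖B i k‖ ^ 2 with hb
    have hdiag : ∀ k, F⁻¹ k k = (b k : ℂ) := fun k => by
      rw [hB, mul_apply, hb]
      push_cast
      refine Finset.sum_congr rfl fun i _ => ?_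
      rw [conjTranspose_apply, ← Complex.conj_mul']; rfl
    have hoff : ∀ k l, ‖F⁻¹ k l‖ ≤ (b k + b l) / 2 := fun k l => by
      rw [hB, mul_apply, hb, ← Finset.sum_add_distrib, Finset.sum_div]
      refine (norm_sum_le _ _).trans (Finset.sum_le_sum fun i _ => ?_)
      rw [norm_mul, conjTranspose_apply, norm_star]
      nlinarith [sq_nonneg (‖B i k‖ - ‖B i l‖)]
    have hb0 : ∀ k, 0 ≤ b k := fun k => by positivity
    have htr : ‖(F⁻¹).trace‖ = ∑ k, b k := by
      rw [trace]
      simp only [diag_apply, hdiag]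
      rw [← Complex.ofReal_sum, Complex.norm_real, Real.norm_of_nonneg
        (Finset.sum_nonneg fun k _ => hb0 k)]
    have hs : 0 ≤ ∑ k, b k := Finset.sum_nonneg fun k _ => hb0 k
    have hp : (1 : ℝ) / (2 - 1) = 1 := by norm_num
    rw [hp, htr]
    simp only [Real.rpow_one]
    calc _ ≤ ∑ k, ∑ l, (b k + b l) / 2 :=
          Finset.sum_le_sum fun k _ => Finset.sum_le_sum fun l _ => hoff k l
      _ = T * ∑ k, b k := by
          simp only [add_div, Finset.sum_add_distrib, Finset.sum_const, Finset.card_univ,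
            Fintype.card_fin, nsmul_eq_mul, ← Finset.mul_sum, ← Finset.sum_div]
          ring
      _ ≤ _ := by nlinarith
  · have hdp : ∀ k, 0 < (F k k).re ∧ F k k = ((F k k).re : ℂ) := fun k => by
      have := Complex.pos_iff.1 (hpd.diag_pos (i := k))
      exact ⟨this.1, Complex.ext rfl (by simp [← this.2])⟩
    have hu : IsUnit F.diag := by
      rw [Pi.isUnit_iff]
      intro k
      rw [diag_apply, (hdp k).2]
      exact (Complex.ofReal_ne_zero.2 (hdp k).1.ne').isUnit
    have hinv : ∀ k l, ‖F⁻¹ k l‖ = if k = l then ((F k k).re)⁻¹ else 0 := fun k l => by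
      have h1 : F⁻¹ = diagonal fun k => (((F k k).re)⁻¹ : ℂ) := by
        rw [Matrix.inv_eq_right_inv]
        rw [← hd.diagonal_diag, diagonal_mul_diagonal, ← diagonal_one]
        congr 1
        funext k
        simp only [diag_apply, diagonal_apply_eq]
        nth_rewrite 1 [(hdp k).2]
        exact mul_inv_cancel₀ (Complex.ofReal_ne_zero.2 (hdp k).1.ne')
      rw [h1, diagonal_apply]
      split_ifs with h
      · rw [← Complex.ofReal_inv, Complex.norm_real, Real.norm_of_nonneg
          (inv_nonneg.2 (hdp k).1.le)]
      · simp
    have h0 : ∀ k, 0 ≤ (F k k).re ^ (-(1 / (α - 1))) := fun k => Real.rpow_nonneg (hdp k).1.le _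
    have htr : ‖(cfc (fun x : ℝ => x ^ (-(1 / (α - 1)))) F).trace‖ =
        ∑ k, (F k k).re ^ (-(1 / (α - 1))) := by
      rw [trace]
      simp only [diag_apply, cfc_apply_of_isDiag hpd.1 hd]
      rw [← Complex.ofReal_sum, Complex.norm_real, Real.norm_of_nonneg
        (Finset.sum_nonneg fun k _ => h0 k)]
    have hl : ∑ k, (∑ l, ‖F⁻¹ k l‖) ^ (1 / (α - 1)) = ∑ k, (F k k).re ^ (-(1 / (α - 1))) := by
      refine Finset.sum_congr rfl fun k _ => ?_
      simp only [hinv, Finset.sum_ite_eq, Finset.mem_univ, if_true]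
      rw [Real.inv_rpow (hdp k).1.le, Real.rpow_neg (hdp k).1.le]
    rw [hl, htr]
    have hs : 0 ≤ ∑ k, (F k k).re ^ (-(1 / (α - 1))) := Finset.sum_nonneg fun k _ => h0 k
    have hT : (0 : ℝ) ≤ T := by positivity
    nlinarith

/-- Cramer's rule: determinant and adjugate are polynomial in the entries. -/
lemma measurable_inv_apply (k l : Fin T) :
    Measurable fun A : Fin T → Fin T → ℂ => (Matrix.of A)⁻¹ k l := by
  have h1 : Continuous fun A : Fin T → Fin T → ℂ => (Matrix.of A).det :=
    Continuous.matrix_det (continuous_matrix fun i j => by simp only [of_apply]; fun_prop)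
  have h2 : Continuous fun A : Fin T → Fin T → ℂ => (Matrix.of A).adjugate k l :=
    (Continuous.matrix_adjugate (continuous_matrix fun i j => by
      simp only [of_apply]; fun_prop)).matrix_elem k l
  have h3 : (fun A : Fin T → Fin T → ℂ => (Matrix.of A)⁻¹ k l) =
      fun A => ((Matrix.of A).det)⁻¹ * (Matrix.of A).adjugate k l := by
    funext A
    rw [inv_def, Matrix.smul_apply, smul_eq_mul, Ring.inverse_eq_inv]
  rw [h3]
  exact h1.measurable.inv.mul h2.measurable

lemma aemeasurable_inv_apply {f : ℝ → Matrix (Fin T) (Fin T) ℂ}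
    (hf : ∀ k l, AEMeasurable (fun θ => f θ k l) leb) (k l : Fin T) :
    AEMeasurable (fun θ => (f θ)⁻¹ k l) leb :=
  (measurable_inv_apply k l).comp_aemeasurable
    (aemeasurable_pi_lambda _ fun i => aemeasurable_pi_lambda _ fun j => hf i j)

variable {Ω : Type*} [MeasurableSpace Ω] {P : Measure Ω}

/-- The primitive of `f_kl` vanishes identically on `[-π, π]`, and Lebesgue's differentiation
theorem recovers `f_kl` as its derivative almost everywhere. -/
lemma HasSpectralDensity.ae_eq_zero [IsProbabilityMeasure P] (hα : 1 < α) (hα' : α < 2)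
    {Z : Freq → Ω → (Fin T → ℂ)} {f : ℝ → Matrix (Fin T) (Fin T) ℂ}
    (h : HasSpectralDensity P α Z f) {k l : Fin T} (hkl : k ≠ l) :
    ∀ᵐ θ ∂leb, f θ k l = 0 := by
  have hpi : -Real.pi ≤ Real.pi := by linarith [Real.pi_pos]
  have hi : IntervalIntegrable (fun θ => f θ k l) volume (-Real.pi) Real.pi := by
    rw [intervalIntegrable_iff_integrableOn_Ioc_of_le hpi]
    exact h.1 k l
  have h1 := hi.ae_hasDerivAt_integral
  rw [leb, ae_restrict_iff' measurableSet_Ioc]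
  -- The endpoint is discarded so that the primitive is zero on a full neighbourhood of the point.
  have h2 : ∀ᵐ x : ℝ, x ≠ Real.pi := by simp [ae_iff, measure_singleton]
  filter_upwards [h1, h2] with x hx hxpi hxI
  have hx1 : x ∈ Set.Ioo (-Real.pi) Real.pi := ⟨hxI.1, lt_of_le_of_ne hxI.2 hxpi⟩
  rw [Set.uIcc_of_le hpi] at hx
  have hd := hx ⟨hxI.1.le, hxI.2⟩ (-Real.pi) ⟨le_rfl, hpi⟩
  refine hd.unique ?_
  refine (hasDerivAt_const x (0 : ℂ)).congr_of_eventuallyEq ?_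
  filter_upwards [isOpen_Ioo.mem_nhds hx1] with y hy
  exact h.integral_eq_zero hα hα' hkl (s := ⟨-Real.pi, le_rfl, hpi⟩) (t := ⟨y, hy.1.le, hy.2.le⟩)
    hy.1.le

lemma HasSpectralDensity.regularDensity [IsProbabilityMeasure P] (hα : 1 < α) (hα' : α ≤ 2)
    {Z : Freq → Ω → (Fin T → ℂ)} {f : ℝ → Matrix (Fin T) (Fin T) ℂ}
    (h : HasSpectralDensity P α Z f) (hf : Minimality α f) : RegularDensity α f := by
  have hadm : ∀ᵐ θ ∂leb, Admissible α (f θ) := by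
    rcases hα'.eq_or_lt with h2 | h2
    · filter_upwards [hf.1] with θ hθ
      exact ⟨hθ, Or.inl h2⟩
    · have : ∀ᵐ θ ∂leb, ∀ k l, k ≠ l → f θ k l = 0 := by
        rw [ae_all_iff]; intro k
        rw [ae_all_iff]; intro l
        by_cases hkl : k = l
        · simp [hkl]
        · filter_upwards [h.ae_eq_zero hα h2 hkl] with θ hθ _ using hθ
      filter_upwards [hf.1, this] with θ hθ hd
      exact ⟨hθ, Or.inr fun k l hkl => hd k l hkl⟩
  refine ⟨h.1, hadm, ?_⟩
  refine Integrable.mono' ((hf.2.norm).const_mul (T + 1)) ?_ ?_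
  · refine AEMeasurable.aestronglyMeasurable (Finset.aemeasurable_fun_sum _ fun k _ => ?_)
    refine AEMeasurable.pow_const (Finset.aemeasurable_fun_sum _ fun l _ => ?_) _
    exact (aemeasurable_inv_apply (fun k l => (h.1 k l).aemeasurable) k l).norm
  · filter_upwards [hadm] with θ hθ
    rw [Real.norm_of_nonneg (by positivity)]
    exact hθ.sum_inv_le hα

/-! ### The energy -/

variable {f : ℝ → Matrix (Fin T) (Fin T) ℂ}

lemma energy_eq_lintegral (a : ℝ → Fin T → ℂ) :
    energy α f a = ∫⁻ θ, ENNReal.ofReal (form α (f θ) (a θ)) ∂leb := rfl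

lemma RegularDensity.aemeasurable_form (hf : RegularDensity α f) {a : ℝ → Fin T → ℂ}
    (ha : AEMeasurable a leb) : AEMeasurable (fun θ => form α (f θ) (a θ)) leb := by
  unfold form dotProduct mulVec dotProduct
  refine Complex.measurable_re.comp_aemeasurable (Finset.aemeasurable_fun_sum _ fun k _ => ?_)
  refine ((measurable_pi_apply k).comp_aemeasurable ha).mul
    (Finset.aemeasurable_fun_sum _ fun l _ => ?_)
  exact (hf.integrable k l).aemeasurable.mul
    ((measurable_pi_apply l).comp_aemeasurable ((measurable_vpow _).comp_aemeasurable ha))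

lemma energy_congr {a b : ℝ → Fin T → ℂ} (h : a =ᵐ[leb] b) : energy α f a = energy α f b := by
  rw [energy_eq_lintegral, energy_eq_lintegral]
  refine lintegral_congr_ae ?_
  filter_upwards [h] with θ hθ
  rw [hθ]

lemma energy_smul (hα : 1 < α) (c : ℂ) (a : ℝ → Fin T → ℂ) :
    energy α f (c • a) = ENNReal.ofReal (‖c‖ ^ α) * energy α f a := by
  rw [energy_eq_lintegral, energy_eq_lintegral, ← lintegral_const_mul' _ _ ENNReal.ofReal_ne_top]
  refine lintegral_congr fun θ => ?_
  rw [Pi.smul_apply, form_smul hα, ENNReal.ofReal_mul (by positivity)]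

lemma energy_neg (hα : 1 < α) (a : ℝ → Fin T → ℂ) : energy α f (-a) = energy α f a := by
  have := energy_smul (f := f) hα (-1) a
  simpa using this

lemma energy_sub_comm (hα : 1 < α) (a b : ℝ → Fin T → ℂ) :
    energy α f (a - b) = energy α f (b - a) := by
  rw [← neg_sub, energy_neg hα]

lemma energy_zero : energy α f (0 : ℝ → Fin T → ℂ) = 0 := by
  simp [energy_eq_lintegral]

lemma RegularDensity.energy_eq_zero (hα : 1 < α) (hf : RegularDensity α f) {a : ℝ → Fin T → ℂ}
    (ha : AEMeasurable a leb) (h : energy α f a = 0) : a =ᵐ[leb] 0 := by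
  rw [energy_eq_lintegral, lintegral_eq_zero_iff' (hf.aemeasurable_form ha).ennreal_ofReal] at h
  filter_upwards [h, hf.admissible] with θ h1 h2
  simp only [Pi.zero_apply, ENNReal.ofReal_eq_zero] at h1
  exact (h2.form_eq_zero hα).1 (le_antisymm h1 (h2.form_nonneg hα _))

/-- Minkowski twice: for the form at each `θ`, then for the integral over `θ`. -/
lemma RegularDensity.energy_add_rpow_le (hα : 1 < α) (hf : RegularDensity α f)
    {a b : ℝ → Fin T → ℂ} (ha : AEMeasurable a leb) (hb : AEMeasurable b leb) :
    energy α f (a + b) ^ (1 / α) ≤ energy α f a ^ (1 / α) + energy α f b ^ (1 / α) := by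
  have hα0 : 0 < α := by linarith
  have hα1 : 0 ≤ 1 / α := by positivity
  have key : ∀ {a : ℝ → Fin T → ℂ}, energy α f a =
      ∫⁻ θ, (ENNReal.ofReal (form α (f θ) (a θ) ^ (1 / α))) ^ α ∂leb := fun {a} => by
    rw [energy_eq_lintegral]
    refine lintegral_congr_ae ?_
    filter_upwards [hf.admissible] with θ hθ
    rw [ENNReal.ofReal_rpow_of_nonneg (Real.rpow_nonneg (hθ.form_nonneg hα _) _) hα0.le,
      ← Real.rpow_mul (hθ.form_nonneg hα _), one_div_mul_cancel hα0.ne', Real.rpow_one]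
  have hm : ∀ {a : ℝ → Fin T → ℂ}, AEMeasurable a leb →
      AEMeasurable (fun θ => ENNReal.ofReal (form α (f θ) (a θ) ^ (1 / α))) leb := fun {a} ha =>
    ((hf.aemeasurable_form ha).pow_const _).ennreal_ofReal
  rw [key, key, key]
  refine le_trans ?_ (ENNReal.lintegral_Lp_add_le (hm ha) (hm hb) hα.le)
  refine ENNReal.rpow_le_rpow (lintegral_mono_ae ?_) hα1
  filter_upwards [hf.admissible] with θ hθ
  refine ENNReal.rpow_le_rpow ?_ hα0.le
  rw [Pi.add_apply, Pi.add_apply, ← ENNReal.ofReal_add (Real.rpow_nonneg (hθ.form_nonneg hα _) _)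
    (Real.rpow_nonneg (hθ.form_nonneg hα _) _)]
  exact ENNReal.ofReal_le_ofReal (hθ.form_add_rpow_le hα _ _)

lemma tendsto_rpow_zero_iff {ι : Type*} {l : Filter ι} {p : ℝ} (hp : 0 < p) {u : ι → ℝ≥0∞} :
    Tendsto (fun i => u i ^ p) l (𝓝 0) ↔ Tendsto u l (𝓝 0) := by
  constructor
  · intro h
    have := (ENNReal.continuous_rpow_const (y := 1 / p)).tendsto 0 |>.comp h
    rw [ENNReal.zero_rpow_of_pos (by positivity)] at this
    refine this.congr fun i => ?_
    rw [Function.comp_apply, ← ENNReal.rpow_mul, mul_one_div_cancel hp.ne', ENNReal.rpow_one]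
  · intro h
    have := (ENNReal.continuous_rpow_const (y := p)).tendsto 0 |>.comp h
    rwa [ENNReal.zero_rpow_of_pos hp] at this

lemma RegularDensity.tendsto_energy_add (hα : 1 < α) (hf : RegularDensity α f) {ι : Type*}
    {l : Filter ι} {a b : ι → ℝ → Fin T → ℂ} (ha : ∀ i, AEMeasurable (a i) leb)
    (hb : ∀ i, AEMeasurable (b i) leb) (h1 : Tendsto (fun i => energy α f (a i)) l (𝓝 0))
    (h2 : Tendsto (fun i => energy α f (b i)) l (𝓝 0)) :
    Tendsto (fun i => energy α f (a i + b i)) l (𝓝 0) := by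
  have hp : 0 < 1 / α := by have : 0 < α := by linarith
                            positivity
  rw [← tendsto_rpow_zero_iff hp] at h1 h2 ⊢
  have h3 := h1.add h2
  rw [add_zero] at h3
  refine tendsto_of_tendsto_of_tendsto_of_le_of_le tendsto_const_nhds h3
    (fun i => zero_le) (fun i => ?_)
  exact hf.energy_add_rpow_le hα (ha i) (hb i)

lemma RegularDensity.energy_add_lt_top (hα : 1 < α) (hf : RegularDensity α f)
    {a b : ℝ → Fin T → ℂ} (ha : AEMeasurable a leb) (hb : AEMeasurable b leb)
    (h1 : energy α f a < ⊤) (h2 : energy α f b < ⊤) : energy α f (a + b) < ⊤ := by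
  have hp : 0 < 1 / α := by have : 0 < α := by linarith
                            positivity
  have h := hf.energy_add_rpow_le hα ha hb
  rw [← ENNReal.rpow_lt_top_iff_of_pos hp] at h1 h2 ⊢
  exact h.trans_lt (ENNReal.add_lt_top.2 ⟨h1, h2⟩)

/-- The energy is continuous with respect to `L^α(μ)`-convergence. -/
lemma RegularDensity.tendsto_energy (hα : 1 < α) (hf : RegularDensity α f) {ι : Type*}
    {l : Filter ι} {a : ι → ℝ → Fin T → ℂ} {b : ℝ → Fin T → ℂ} (ha : ∀ i, AEMeasurable (a i) leb)
    (hb : AEMeasurable b leb) (hfin : energy α f b < ⊤)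
    (h : Tendsto (fun i => energy α f (b - a i)) l (𝓝 0)) :
    Tendsto (fun i => energy α f (a i)) l (𝓝 (energy α f b)) := by
  have hα0 : 0 < α := by linarith
  have hp : 0 < 1 / α := by positivity
  have h0 := (tendsto_rpow_zero_iff hp).2 h
  have h3 : Tendsto (fun i => energy α f (a i) ^ (1 / α)) l (𝓝 (energy α f b ^ (1 / α))) := by
    have hne : energy α f b ^ (1 / α) ≠ ⊤ := ((ENNReal.rpow_lt_top_iff_of_pos hp).2 hfin).ne
    have hlow := ENNReal.Tendsto.sub (tendsto_const_nhds (x := energy α f b ^ (1 / α)) (f := l)) h0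
      (Or.inl hne)
    have hup := (tendsto_const_nhds (x := energy α f b ^ (1 / α)) (f := l)).add h0
    rw [tsub_zero] at hlow
    rw [add_zero] at hup
    refine tendsto_of_tendsto_of_tendsto_of_le_of_le hlow hup (fun i => ?_) (fun i => ?_)
    · rw [tsub_le_iff_right]
      have := hf.energy_add_rpow_le hα (ha i) (hb.sub (ha i))
      rwa [add_sub_cancel] at this
    · have := hf.energy_add_rpow_le hα hb ((ha i).sub hb)
      rwa [add_sub_cancel, energy_sub_comm hα] at this
  have h4 := (ENNReal.continuous_rpow_const (y := α)).tendsto _ |>.comp h3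
  simpa [Function.comp_def, ← ENNReal.rpow_mul, inv_mul_cancel₀ hα0.ne'] using h4

lemma RegularDensity.energy_le (hα : 1 < α) (hf : RegularDensity α f) {a : ℝ → Fin T → ℂ} {B : ℝ}
    (hB : ∀ θ, ‖a θ‖ ≤ B) :
    energy α f a ≤ ENNReal.ofReal ((∫ θ, ∑ k, ∑ l, ‖f θ k l‖ ∂leb) * B ^ α) := by
  have hi : Integrable (fun θ => ∑ k, ∑ l, ‖f θ k l‖) leb :=
    integrable_finsetSum _ fun k _ => integrable_finsetSum _ fun l _ => (hf.integrable k l).norm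
  have hB0 : 0 ≤ B := (norm_nonneg _).trans (hB 0)
  rw [← integral_mul_const, ofReal_integral_eq_lintegral_ofReal (hi.mul_const _)
    (ae_of_all _ fun θ => by positivity), energy_eq_lintegral]
  refine lintegral_mono fun θ => ENNReal.ofReal_le_ofReal ((form_le hα _).trans ?_)
  exact mul_le_mul_of_nonneg_left (Real.rpow_le_rpow (norm_nonneg _) (hB θ) (by linarith))
    (by positivity)

lemma RegularDensity.energy_lt_top (hα : 1 < α) (hf : RegularDensity α f) {a : ℝ → Fin T → ℂ}
    {B : ℝ} (hB : ∀ θ, ‖a θ‖ ≤ B) : energy α f a < ⊤ :=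
  (hf.energy_le hα hB).trans_lt ENNReal.ofReal_lt_top

/-! ### `L^α(μ)` embeds into `L¹` -/

/-- Young's inequality against the dual vector of `C = t u δ_k`, where the phase `u` satisfies `w_k
u = |w_k|`: it bounds `t|w_k|` by the form of `w` plus that of the dual vector, the latter being at
most `t · t^{1/(α-1)}` times the sum over `F⁻¹`. The parameter `t` stays free so that small energy
can later be played against small `t`. -/
lemma Admissible.norm_le (hα : 1 < α) {F : Matrix (Fin T) (Fin T) ℂ} (hF : Admissible α F)
    (w : Fin T → ℂ) {t : ℝ} (ht : 0 < t) :
    ‖w‖ ≤ t⁻¹ * form α F w +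
      t ^ (1 / (α - 1)) * ∑ k, (∑ l, ‖F⁻¹ k l‖) ^ (1 / (α - 1)) := by
  have hw0 := hF.form_nonneg hα w
  set b := ∑ k, (∑ l, ‖F⁻¹ k l‖) ^ (1 / (α - 1)) with hb
  have hb0 : 0 ≤ b := by positivity
  rw [pi_norm_le_iff_of_nonneg (by positivity)]
  intro k
  obtain ⟨u, hu, huw⟩ : ∃ u : ℂ, ‖u‖ = 1 ∧ w k * u = ‖w k‖ := by
    rcases eq_or_ne (w k) 0 with h | h
    · exact ⟨1, by simp, by simp [h]⟩
    · have hne : (‖w k‖ : ℂ) ≠ 0 := by exact_mod_cast norm_ne_zero_iff.2 h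
      refine ⟨(starRingEnd ℂ) (w k) / ‖w k‖, ?_, ?_⟩
      · rw [norm_div, RCLike.norm_conj, Complex.norm_real, norm_norm, div_self]
        exact norm_ne_zero_iff.2 h
      · rw [← mul_div_assoc, Complex.mul_conj', sq, mul_div_assoc, div_self hne, mul_one]
  set C : Fin T → ℂ := Pi.single k ((t : ℂ) * u) with hC
  have hCn : ‖C‖ ≤ t := by
    rw [pi_norm_le_iff_of_nonneg ht.le]
    intro j
    rw [hC, Pi.single_apply]
    split_ifs
    · rw [norm_mul, hu, mul_one, Complex.norm_real, Real.norm_of_nonneg ht.le]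
    · simpa using ht.le
  have h1 := (hF.young hα w (dualVec α F C)).1
  rw [hF.mulVec_vpow_dualVec hα, hC, dotProduct_single, mul_left_comm, huw,
    ← Complex.ofReal_mul, Complex.ofReal_re] at h1
  have h2 : form α F (dualVec α F C) ≤ t * (b * t ^ (1 / (α - 1))) := by
    rw [hF.form_dualVec hα]
    nth_rewrite 2 [hC]
    rw [dotProduct_single]
    refine (Complex.re_le_norm _).trans ?_
    rw [norm_mul, norm_mul, hu, mul_one, Complex.norm_real, Real.norm_of_nonneg ht.le, mul_comm]
    refine mul_le_mul_of_nonneg_left ((norm_le_pi_norm _ k).trans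
      ((norm_dualVec_le hα C).trans ?_)) ht.le
    refine mul_le_mul_of_nonneg_left (Real.rpow_le_rpow (norm_nonneg _) hCn ?_) hb0
    have : 0 < α - 1 := by linarith
    positivity
  have h3 : 0 ≤ form α F (dualVec α F C) := hF.form_nonneg hα _
  have h4 : t * ‖w k‖ ≤ form α F w + t * (b * t ^ (1 / (α - 1))) := by
    have h5 : form α F w / α ≤ form α F w := div_le_self hw0 hα.le
    have h6 : (1 - 1 / α) * form α F (dualVec α F C) ≤ form α F (dualVec α F C) := by
      have : 0 ≤ 1 / α := by positivity
      nlinarith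
    linarith
  have h7 : t * ‖w k‖ ≤ t * (t⁻¹ * form α F w + t ^ (1 / (α - 1)) * b) := by
    rw [mul_add, ← mul_assoc t t⁻¹, mul_inv_cancel₀ ht.ne', one_mul]
    linarith
  exact le_of_mul_le_mul_left h7 ht

lemma RegularDensity.lintegral_norm_le (hα : 1 < α) (hf : RegularDensity α f)
    {a : ℝ → Fin T → ℂ} (ha : AEMeasurable a leb) {t : ℝ} (ht : 0 < t) :
    ∫⁻ θ, ‖a θ‖ₑ ∂leb ≤ ENNReal.ofReal t⁻¹ * energy α f a + ENNReal.ofReal (t ^ (1 / (α - 1)) *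
      ∫ θ, ∑ k, (∑ l, ‖(f θ)⁻¹ k l‖) ^ (1 / (α - 1)) ∂leb) := by
  have ht1 : 0 ≤ t⁻¹ := by positivity
  have ht2 : 0 ≤ t ^ (1 / (α - 1)) := by positivity
  rw [← integral_const_mul, ofReal_integral_eq_lintegral_ofReal (hf.dual.const_mul _)
    (ae_of_all _ fun θ => by positivity), energy_eq_lintegral,
    ← lintegral_const_mul' _ _ ENNReal.ofReal_ne_top,
    ← lintegral_add_left' ((hf.aemeasurable_form ha).ennreal_ofReal.const_mul _)]
  refine lintegral_mono_ae ?_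
  filter_upwards [hf.admissible] with θ hθ
  rw [← ENNReal.ofReal_mul ht1, ← ENNReal.ofReal_add (mul_nonneg ht1 (hθ.form_nonneg hα _))
    (by positivity), ← ofReal_norm]
  exact ENNReal.ofReal_le_ofReal (hθ.norm_le hα _ ht)

/-- First `t` is chosen to make the term without energy small, then the energy is let tend to `0`.
-/
lemma RegularDensity.tendsto_lintegral_norm (hα : 1 < α) (hf : RegularDensity α f) {ι : Type*}
    {l : Filter ι} {a : ι → ℝ → Fin T → ℂ} (ha : ∀ i, AEMeasurable (a i) leb)
    (h : Tendsto (fun i => energy α f (a i)) l (𝓝 0)) :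
    Tendsto (fun i => ∫⁻ θ, ‖a i θ‖ₑ ∂leb) l (𝓝 0) := by
  set b := ∫ θ, ∑ k, (∑ l, ‖(f θ)⁻¹ k l‖) ^ (1 / (α - 1)) ∂leb with hb
  have hp : 0 < 1 / (α - 1) := by have : 0 < α - 1 := by linarith
                                  positivity
  have hlim : Tendsto (fun t : ℝ => ENNReal.ofReal (t ^ (1 / (α - 1)) * b)) (𝓝[>] 0) (𝓝 0) := by
    have h1 : Continuous fun t : ℝ => ENNReal.ofReal (t ^ (1 / (α - 1)) * b) :=
      ENNReal.continuous_ofReal.comp ((continuous_id.rpow_const fun _ => Or.inr hp.le).mul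
        continuous_const)
    have h2 := h1.tendsto 0
    rw [Real.zero_rpow hp.ne', zero_mul, ENNReal.ofReal_zero] at h2
    exact h2.mono_left nhdsWithin_le_nhds
  rw [ENNReal.tendsto_nhds_zero]
  intro ε hε
  have hε2 : 0 < ε / 2 := ENNReal.half_pos hε.ne'
  obtain ⟨t, ht1, ht0⟩ := (((ENNReal.tendsto_nhds_zero.1 hlim) (ε / 2) hε2).and
    self_mem_nhdsWithin).exists
  have ht0 : 0 < t := ht0
  have h3 : Tendsto (fun i => ENNReal.ofReal t⁻¹ * energy α f (a i)) l (𝓝 0) := by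
    simpa using ENNReal.Tendsto.const_mul h (Or.inr ENNReal.ofReal_ne_top)
  filter_upwards [(ENNReal.tendsto_nhds_zero.1 h3) (ε / 2) hε2] with i hi
  refine (hf.lintegral_norm_le hα (ha i) ht0).trans ((add_le_add hi ht1).trans ?_)
  rw [ENNReal.add_halves]

lemma RegularDensity.lintegral_norm_lt_top (hα : 1 < α) (hf : RegularDensity α f)
    {a : ℝ → Fin T → ℂ} (ha : AEMeasurable a leb) (h : energy α f a < ⊤) :
    ∫⁻ θ, ‖a θ‖ₑ ∂leb < ⊤ :=
  (hf.lintegral_norm_le hα ha one_pos).trans_lt (ENNReal.add_lt_top.2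
    ⟨ENNReal.mul_lt_top ENNReal.ofReal_lt_top h, ENNReal.ofReal_lt_top⟩)

lemma continuous_form (hα : 1 < α) (F : Matrix (Fin T) (Fin T) ℂ) : Continuous (form α F) := by
  unfold form
  refine Complex.continuous_re.comp (continuous_id.dotProduct ?_)
  exact continuous_const.matrix_mulVec (continuous_vpow (by linarith))

/-- `L^α(μ)` is complete. -/
lemma RegularDensity.exists_tendsto_energy (hα : 1 < α) (hf : RegularDensity α f)
    {a : ℕ → ℝ → Fin T → ℂ} (ha : ∀ n, AEMeasurable (a n) leb)
    (h : Tendsto (fun p : ℕ × ℕ => energy α f (a p.1 - a p.2)) (atTop ×ˢ atTop) (𝓝 0)) :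
    ∃ b : ℝ → Fin T → ℂ, AEMeasurable b leb ∧
      Tendsto (fun n => energy α f (b - a n)) atTop (𝓝 0) := by
  have hL := hf.tendsto_lintegral_norm hα (fun p : ℕ × ℕ => (ha p.1).sub (ha p.2)) h
  have hL' : ∀ N : ℕ, ∃ M : ℕ, ∀ n m, M ≤ n → M ≤ m →
      ∫⁻ θ, ‖(a n - a m) θ‖ₑ ∂leb < (2⁻¹ : ℝ≥0∞) ^ N := fun N => by
    have h1 := hL.eventually (gt_mem_nhds (show (0 : ℝ≥0∞) < 2⁻¹ ^ N from
      ENNReal.pow_pos (by simp) N))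
    rw [prod_atTop_atTop_eq, eventually_atTop] at h1
    obtain ⟨⟨M1, M2⟩, hM⟩ := h1
    exact ⟨max M1 M2, fun n m hn hm => hM (n, m)
      ⟨(le_max_left _ _).trans hn, (le_max_right _ _).trans hm⟩⟩
  choose M hM using hL'
  -- Energy-Cauchy sequences are `L¹`-Cauchy. This `φ` dominates both `n` and every threshold `M N`
  -- with `N ≤ n`, so the subsequence is geometrically Cauchy in `L¹` and converges almost
  -- everywhere.
  set φ : ℕ → ℕ := fun n => n + ∑ i ∈ Finset.range (n + 1), M i with hφ
  have hφmono : Monotone φ := fun n m hnm => add_le_add hnm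
    (Finset.sum_le_sum_of_subset (Finset.range_mono (by omega)))
  have hφM : ∀ N n, N ≤ n → M N ≤ φ n := fun N n hn => by
    refine le_trans ?_ (Nat.le_add_left _ _)
    exact Finset.single_le_sum (f := M) (fun _ _ => Nat.zero_le _) (Finset.mem_range.2 (by omega))
  have hφt : Tendsto φ atTop atTop :=
    tendsto_atTop_mono (fun n => Nat.le_add_right n _) tendsto_id
  have hae := Lp.ae_tendsto_of_cauchy_eLpNorm (p := 1) (μ := leb) (f := fun n => a (φ n))
    (fun n => (ha (φ n)).aestronglyMeasurable) le_rfl (B := fun N => (2⁻¹ : ℝ≥0∞) ^ N)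
    (by rw [ENNReal.tsum_geometric]; simp [ENNReal.one_sub_inv_two]) (fun N n m hn hm => by
      rw [eLpNorm_one_eq_lintegral_enorm]
      exact hM N _ _ (hφM N n hn) (hφM N m hm))
  classical
  set b : ℝ → Fin T → ℂ := fun θ =>
    if hθ : ∃ v, Tendsto (fun n => a (φ n) θ) atTop (𝓝 v) then hθ.choose else 0 with hb
  have hbt : ∀ᵐ θ ∂leb, Tendsto (fun n => a (φ n) θ) atTop (𝓝 (b θ)) := by
    filter_upwards [hae] with θ hθ
    rw [hb]
    simp only [dif_pos hθ]
    exact hθ.choose_spec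
  have hbm : AEMeasurable b leb :=
    aemeasurable_of_tendsto_metrizable_ae atTop (fun n => ha (φ n)) hbt
  refine ⟨b, hbm, ?_⟩
  rw [ENNReal.tendsto_nhds_zero]
  intro ε hε
  have h1 := (ENNReal.tendsto_nhds_zero.1 h) ε hε
  rw [prod_atTop_atTop_eq, eventually_atTop] at h1
  obtain ⟨⟨M1, M2⟩, hM12⟩ := h1
  filter_upwards [eventually_ge_atTop M2] with n hn
  -- Fatou's lemma along the subsequence: the integrands converge almost everywhere because the form
  -- is continuous in its vector argument.
  have h2 : energy α f (b - a n) ≤ liminf (fun k => energy α f (a (φ k) - a n)) atTop := by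
    refine le_trans ?_ (lintegral_liminf_le' fun k =>
      (hf.aemeasurable_form ((ha (φ k)).sub (ha n))).ennreal_ofReal)
    refine lintegral_mono_ae ?_
    filter_upwards [hbt] with θ hθ
    refine le_of_eq (Tendsto.liminf_eq ?_).symm
    refine (ENNReal.continuous_ofReal.tendsto _).comp
      (((continuous_form hα (f θ)).tendsto _).comp ?_)
    exact hθ.sub_const _
  refine h2.trans (liminf_le_of_frequently_le' ?_)
  refine Eventually.frequently ?_
  filter_upwards [hφt.eventually_ge_atTop M1] with k hk
  exact hM12 (φ k, n) ⟨hk, hn⟩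

end

/-! ### Density of trigonometric polynomials and the Fourier description of `L^α_N(μ)`. -/

section

/-! ### Trigonometric polynomials -/

variable {T N : ℕ} {α : ℝ} {f : ℝ → Matrix (Fin T) (Fin T) ℂ}

instance fact_two_pi_pos : Fact (0 < 2 * Real.pi) := ⟨Real.two_pi_pos⟩

/-- The span of the exponentials `e^{ijθ}`. -/
def scalarTrig : Submodule ℂ (ℝ → ℂ) :=
  Submodule.span ℂ {p | ∃ j : ℤ, p = fun θ : ℝ => Complex.exp (Complex.I * (j : ℂ) * (θ : ℂ))}

/-- The span of all functions `e^{ijθ} δ_k`. -/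
def fullTrig (T : ℕ) : Submodule ℂ (ℝ → Fin T → ℂ) :=
  Submodule.span ℂ {p | ∃ (j : ℤ) (k : Fin T), p = expVec j k}

lemma fourier_comp_coe_mem_scalarTrig {q : C(AddCircle (2 * Real.pi), ℂ)}
    (hq : q ∈ Submodule.span ℂ (Set.range (fourier (T := 2 * Real.pi)))) :
    (fun θ : ℝ => q (θ : AddCircle (2 * Real.pi))) ∈ scalarTrig := by
  induction hq using Submodule.span_induction with
  | mem x hx =>
    obtain ⟨n, rfl⟩ := hx
    refine Submodule.subset_span ⟨n, funext fun θ => ?_⟩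
    rw [fourier_coe_apply]
    congr 1
    have : (Real.pi : ℂ) ≠ 0 := by exact_mod_cast Real.pi_ne_zero
    push_cast
    field_simp
  | zero => exact scalarTrig.zero_mem
  | add x y _ _ hx hy => exact scalarTrig.add_mem hx hy
  | smul c x _ hx => exact scalarTrig.smul_mem c hx

lemma single_mem_fullTrig {q : ℝ → ℂ} (hq : q ∈ scalarTrig) (k : Fin T) :
    (fun θ => (Pi.single k (q θ) : Fin T → ℂ)) ∈ fullTrig T := by
  induction hq using Submodule.span_induction with
  | mem x hx =>
    obtain ⟨j, rfl⟩ := hx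
    exact Submodule.subset_span ⟨j, k, rfl⟩
  | zero =>
    convert (fullTrig T).zero_mem
    simp
  | add x y _ _ hx hy =>
    convert (fullTrig T).add_mem hx hy using 1
    funext θ
    simp [Pi.single_add]
  | smul c x _ hx =>
    convert (fullTrig T).smul_mem c hx using 1
    funext θ
    simp only [Pi.smul_apply, ← Pi.single_smul]

/-- One `δ` pays for approximation by a continuous function in `L^p`, the other for uniform
approximation by characters on the circle. -/
lemma exists_fourier_eLpNorm_le {ν : Measure (AddCircle (2 * Real.pi))} [IsFiniteMeasure ν]
    {p : ℝ≥0∞} (hp : 1 ≤ p) (hpt : p ≠ ⊤) {G : AddCircle (2 * Real.pi) → ℂ} (hG : MemLp G p ν)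
    {δ : ℝ≥0∞} (hδ : 0 < δ) :
    ∃ q ∈ Submodule.span ℂ (Set.range (fourier (T := 2 * Real.pi))),
      eLpNorm (G - ⇑q) p ν ≤ δ + δ := by
  obtain ⟨c, -, hc, hcc, hcL⟩ := hG.exists_hasCompactSupport_eLpNorm_sub_le hpt hδ.ne'
  obtain ⟨r, hr0, hr⟩ : ∃ r : ℝ, 0 < r ∧ ν Set.univ ^ p.toReal⁻¹ * ENNReal.ofReal r ≤ δ := by
    have hne : ν Set.univ ^ p.toReal⁻¹ ≠ ⊤ :=
      ENNReal.rpow_ne_top_of_nonneg (by positivity) (measure_ne_top _ _)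
    have h1 : Tendsto (fun r : ℝ => ν Set.univ ^ p.toReal⁻¹ * ENNReal.ofReal r) (𝓝[>] 0) (𝓝 0) := by
      have h2 := ENNReal.Tendsto.const_mul (ENNReal.continuous_ofReal.tendsto 0) (Or.inr hne)
      rw [ENNReal.ofReal_zero, mul_zero] at h2
      exact h2.mono_left nhdsWithin_le_nhds
    obtain ⟨r, h3, h4⟩ := ((h1.eventually (ge_mem_nhds hδ)).and self_mem_nhdsWithin).exists
    exact ⟨r, h4, h3⟩
  obtain ⟨c', rfl⟩ : ∃ c' : C(AddCircle (2 * Real.pi), ℂ), ⇑c' = c := ⟨⟨c, hcc⟩, rfl⟩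
  have hcl : c' ∈ closure
      (Submodule.span ℂ (Set.range (fourier (T := 2 * Real.pi))) : Set _) := by
    rw [← Submodule.topologicalClosure_coe, span_fourier_closure_eq_top]
    trivial
  obtain ⟨q, hq, hqd⟩ := Metric.mem_closure_iff.1 hcl r hr0
  refine ⟨q, hq, ?_⟩
  have e : G - ⇑q = (G - ⇑c') + (⇑c' - ⇑q) := by
    rw [sub_add_sub_cancel]
  rw [e]
  refine (eLpNorm_add_le (hG.1.sub hcc.aestronglyMeasurable)
    (hcc.aestronglyMeasurable.sub q.continuous.aestronglyMeasurable) hp).trans ?_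
  refine add_le_add hc ((eLpNorm_le_of_ae_bound (C := r) (ae_of_all _ fun x => ?_)).trans hr)
  rw [Pi.sub_apply, ← dist_eq_norm]
  exact (ContinuousMap.dist_apply_le_dist x).trans hqd.le

/-- The weighted measure `w dθ` is pushed to the circle, for which `(-π, π]` is a fundamental
domain; this reduces the claim to density of characters in `L^α` of a finite measure. -/
lemma exists_scalarTrig (hα : 1 < α) {w : ℝ → ℝ} (hw : Integrable w leb) {g : ℝ → ℂ}
    (hg : Measurable g) {B : ℝ} (hB : ∀ θ, ‖g θ‖ ≤ B) {ε : ℝ≥0∞} (hε : 0 < ε) :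
    ∃ q ∈ scalarTrig, Continuous q ∧
      ∫⁻ θ, ENNReal.ofReal (w θ) * ‖g θ - q θ‖ₑ ^ α ∂leb < ε := by
  have hα0 : 0 < α := by linarith
  have hfinν : IsFiniteMeasure (leb.withDensity fun θ => ENNReal.ofReal (w θ)) :=
    isFiniteMeasure_withDensity_ofReal hw.2
  obtain ⟨ν, hν⟩ : ∃ ν : Measure ℝ, ν = leb.withDensity fun θ => ENNReal.ofReal (w θ) := ⟨_, rfl⟩
  rw [← hν] at hfinν
  have hmk : Measurable fun θ : ℝ => (θ : AddCircle (2 * Real.pi)) := AddCircle.measurable_mk'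
  obtain ⟨G, hGm, hGB, hGe⟩ : ∃ G : AddCircle (2 * Real.pi) → ℂ, Measurable G ∧
      (∀ x, ‖G x‖ ≤ B) ∧ ∀ θ ∈ Set.Ioc (-Real.pi) Real.pi,
        G (θ : AddCircle (2 * Real.pi)) = g θ := by
    refine ⟨fun x => g ((AddCircle.measurableEquivIoc (2 * Real.pi) (-Real.pi) x :
      Set.Ioc (-Real.pi) (-Real.pi + 2 * Real.pi)) : ℝ),
      hg.comp (measurable_subtype_coe.comp (MeasurableEquiv.measurable _)), fun x => hB _,
      fun θ hθ => ?_⟩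
    have hθ' : θ ∈ Set.Ioc (-Real.pi) (-Real.pi + 2 * Real.pi) := ⟨hθ.1, by linarith [hθ.2]⟩
    exact AddCircle.liftIoc_coe_apply (f := g) hθ'
  obtain ⟨δ, hδ0, hδ⟩ : ∃ δ : ℝ≥0∞, 0 < δ ∧ (δ + δ) ^ α < ε := by
    have h1 : Tendsto (fun δ : ℝ≥0∞ => (δ + δ) ^ α) (𝓝[>] 0) (𝓝 0) := by
      have h2 : Continuous fun δ : ℝ≥0∞ => (δ + δ) ^ α :=
        ENNReal.continuous_rpow_const.comp (continuous_id.add continuous_id)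
      have := h2.tendsto 0
      rw [add_zero, ENNReal.zero_rpow_of_pos hα0] at this
      exact this.mono_left nhdsWithin_le_nhds
    obtain ⟨δ, h3, h4⟩ := ((h1.eventually (gt_mem_nhds hε)).and self_mem_nhdsWithin).exists
    exact ⟨δ, h4, h3⟩
  have hp1 : 1 ≤ ENNReal.ofReal α := by
    rw [← ENNReal.ofReal_one]; exact ENNReal.ofReal_le_ofReal hα.le
  have hp0 : ENNReal.ofReal α ≠ 0 := (zero_lt_one.trans_le hp1).ne'
  obtain ⟨q, hq, hd⟩ := exists_fourier_eLpNorm_le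
    (ν := ν.map (fun θ : ℝ => (θ : AddCircle (2 * Real.pi)))) hp1 ENNReal.ofReal_ne_top
    (MemLp.of_bound hGm.aestronglyMeasurable B (ae_of_all _ hGB)) hδ0
  refine ⟨fun θ => q (θ : AddCircle (2 * Real.pi)), fourier_comp_coe_mem_scalarTrig hq,
    q.continuous.comp (AddCircle.continuous_mk' _), ?_⟩
  rw [eLpNorm_eq_lintegral_rpow_enorm_toReal hp0 ENNReal.ofReal_ne_top,
    ENNReal.toReal_ofReal hα0.le] at hd
  have hmeas : Measurable fun x => ‖(G - ⇑q) x‖ₑ ^ α :=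
    ((hGm.sub q.continuous.measurable).enorm).pow_const α
  rw [lintegral_map hmeas hmk, hν, lintegral_withDensity_eq_lintegral_mul₀
    (g := fun θ : ℝ => ‖(G - ⇑q) (θ : AddCircle (2 * Real.pi))‖ₑ ^ α)
    hw.aemeasurable.ennreal_ofReal (hmeas.comp hmk).aemeasurable] at hd
  have hd2 := ENNReal.rpow_le_rpow hd hα0.le
  rw [← ENNReal.rpow_mul, one_div_mul_cancel hα0.ne', ENNReal.rpow_one] at hd2
  refine lt_of_le_of_lt (le_of_eq (lintegral_congr_ae ?_)) (hd2.trans_lt hδ)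
  rw [leb]
  filter_upwards [ae_restrict_mem measurableSet_Ioc] with θ hθ
  simp only [Pi.mul_apply, Pi.sub_apply, hGe θ hθ]

lemma rpow_norm_le_sum (hα : 1 < α) (v : Fin T → ℂ) : ‖v‖ₑ ^ α ≤ ∑ k, ‖v k‖ₑ ^ α := by
  have hα0 : 0 < α := by linarith
  rcases isEmpty_or_nonempty (Fin T) with h | h
  · have : v = 0 := Subsingleton.elim _ _
    simp [this, hα0]
  · obtain ⟨k, hk⟩ : ∃ k, ‖v‖ ≤ ‖v k‖ := by
      by_contra! hcon
      exact lt_irrefl _ ((pi_norm_lt_iff ((norm_nonneg _).trans_lt (hcon h.some))).2 hcon)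
    have h1 : ‖v‖ₑ ≤ ‖v k‖ₑ := by
      rw [← ofReal_norm, ← ofReal_norm]; exact ENNReal.ofReal_le_ofReal hk
    exact (ENNReal.rpow_le_rpow h1 hα0.le).trans
      (Finset.single_le_sum (f := fun k => ‖v k‖ₑ ^ α) (fun _ _ => zero_le) (Finset.mem_univ k))

lemma continuous_expVec (j : ℤ) (k : Fin T) : Continuous (expVec (T := T) j k) := by
  unfold expVec
  exact (continuous_single k).comp (by fun_prop)

lemma continuous_of_mem_fullTrig {p : ℝ → Fin T → ℂ} (hp : p ∈ fullTrig T) : Continuous p := by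
  induction hp using Submodule.span_induction with
  | mem x hx => obtain ⟨j, k, rfl⟩ := hx; exact continuous_expVec j k
  | zero => exact continuous_const
  | add x y _ _ hx hy => exact hx.add hy
  | smul c x _ hx => exact hx.const_smul c

lemma trigSpan_le_fullTrig : trigSpan T N ≤ fullTrig T :=
  Submodule.span_mono fun _ ⟨j, k, _, h⟩ => ⟨j, k, h⟩

lemma RegularDensity.exists_fullTrig_of_bounded (hα : 1 < α) (hf : RegularDensity α f)
    {h : ℝ → Fin T → ℂ} (hm : Measurable h) {B : ℝ} (hB : ∀ θ, ‖h θ‖ ≤ B) {ε : ℝ≥0∞}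
    (hε : 0 < ε) (hεt : ε ≠ ⊤) : ∃ p ∈ fullTrig T, energy α f (h - p) < ε := by
  set w : ℝ → ℝ := fun θ => ∑ k, ∑ l, ‖f θ k l‖ with hw
  have hwi : Integrable w leb :=
    integrable_finsetSum _ fun k _ => integrable_finsetSum _ fun l _ => (hf.integrable k l).norm
  -- One share per coordinate; `T + 1` instead of `T` leaves room for the strict inequality and
  -- covers `T = 0`.
  have hε' : 0 < ε / (T + 1) := ENNReal.div_pos hε.ne' (by simp)
  have hex := fun k : Fin T => exists_scalarTrig hα hwi ((measurable_pi_apply k).comp hm)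
    (fun θ => (norm_le_pi_norm (h θ) k).trans (hB θ)) hε'
  choose q hq hqc hqe using hex
  refine ⟨∑ k, fun θ => Pi.single k (q k θ), Submodule.sum_mem _ fun k _ =>
    single_mem_fullTrig (hq k) k, ?_⟩
  have happ : ∀ θ k, (h - ∑ k, fun θ => (Pi.single k (q k θ) : Fin T → ℂ)) θ k =
      h θ k - q k θ := fun θ k => by
    simp only [Pi.sub_apply, Finset.sum_apply]
    congr 1
    rw [Finset.sum_eq_single k]
    · simp
    · intro j _ hj
      exact Pi.single_eq_of_ne hj.symm _
    · simp
  have hα0 : 0 < α := by linarith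
  have hstep : energy α f (h - ∑ k, fun θ => (Pi.single k (q k θ) : Fin T → ℂ)) ≤
      ∑ k, ∫⁻ θ, ENNReal.ofReal (w θ) * ‖h θ k - q k θ‖ₑ ^ α ∂leb := by
    rw [← lintegral_finsetSum']
    · refine lintegral_mono fun θ => ?_
      refine (ENNReal.ofReal_le_ofReal (form_le hα _)).trans ?_
      rw [ENNReal.ofReal_mul (by positivity), ← Finset.mul_sum,
        ← ENNReal.ofReal_rpow_of_nonneg (norm_nonneg _) hα0.le, ofReal_norm]
      refine mul_le_mul_right ((rpow_norm_le_sum hα _).trans (le_of_eq ?_)) _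
      exact Finset.sum_congr rfl fun k _ => by rw [happ]
    · intro k _
      refine hwi.aemeasurable.ennreal_ofReal.mul (AEMeasurable.pow_const ?_ _)
      exact ((((measurable_pi_apply k).comp hm).sub (hqc k).measurable).enorm).aemeasurable
  refine hstep.trans_lt ?_
  calc _ ≤ ∑ _k : Fin T, ε / (T + 1) := Finset.sum_le_sum fun k _ => (hqe k).le
    _ = T * (ε / (T + 1)) := by simp
    _ < ε := by
      have h1 : (T : ℝ≥0∞) * (ε / (T + 1)) < (T + 1) * (ε / (T + 1)) := by
        refine ENNReal.mul_lt_mul_left hε'.ne' ?_ ?_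
        · exact ENNReal.div_ne_top hεt (by simp)
        · exact ENNReal.lt_add_right (by simp) (by simp)
      refine h1.trans_le ?_
      rw [ENNReal.mul_div_cancel (by simp) (by finiteness)]

/-- Truncation `G n` at height `n` reduces to bounded functions: `g - G n` is pointwise either `0`
or `g`, so dominated convergence applies. -/
lemma RegularDensity.exists_fullTrig (hα : 1 < α) (hf : RegularDensity α f)
    {h : ℝ → Fin T → ℂ} (hm : AEMeasurable h leb) (hfin : energy α f h < ⊤) :
    ∃ p : ℕ → ℝ → Fin T → ℂ, (∀ n, p n ∈ fullTrig T) ∧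
      Tendsto (fun n => energy α f (h - p n)) atTop (𝓝 0) := by
  set g : ℝ → Fin T → ℂ := hm.mk h with hg
  have hgm : Measurable g := hm.measurable_mk
  have hgh : h =ᵐ[leb] g := hm.ae_eq_mk
  set G : ℕ → ℝ → Fin T → ℂ := fun n => {θ | ‖g θ‖ ≤ n}.indicator g with hG
  have hset : ∀ n : ℕ, MeasurableSet {θ | ‖g θ‖ ≤ n} := fun n =>
    measurableSet_le hgm.norm measurable_const
  have hGm : ∀ n, Measurable (G n) := fun n => hgm.indicator (hset n)
  have hGB : ∀ n θ, ‖G n θ‖ ≤ n := fun n θ => by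
    rw [hG]
    by_cases hθ : ‖g θ‖ ≤ n
    · simp only [Set.indicator_of_mem (show θ ∈ {θ | ‖g θ‖ ≤ n} from hθ)]
      exact hθ
    · simp [Set.indicator_of_notMem (show θ ∉ {θ | ‖g θ‖ ≤ n} from hθ)]
  have hgfin : energy α f g < ⊤ := by rwa [← energy_congr hgh]
  have hGlim : Tendsto (fun n => energy α f (g - G n)) atTop (𝓝 0) := by
    have h1 := tendsto_lintegral_of_dominated_convergence' (μ := leb)
      (F := fun n θ => ENNReal.ofReal (form α (f θ) ((g - G n) θ))) (f := fun _ => 0)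
      (fun θ => ENNReal.ofReal (form α (f θ) (g θ)))
      (fun n => (hf.aemeasurable_form (hgm.sub (hGm n)).aemeasurable).ennreal_ofReal)
      (fun n => ae_of_all _ fun θ => ?_) hgfin.ne (ae_of_all _ fun θ => ?_)
    · rw [lintegral_zero] at h1
      exact h1
    · by_cases hθ : ‖g θ‖ ≤ n
      · simp [hG, Set.indicator_of_mem (show θ ∈ {θ | ‖g θ‖ ≤ n} from hθ)]
      · simp [hG, Set.indicator_of_notMem (show θ ∉ {θ | ‖g θ‖ ≤ n} from hθ)]
    · refine tendsto_const_nhds.congr' ?_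
      obtain ⟨M, hM⟩ := exists_nat_ge ‖g θ‖
      filter_upwards [eventually_ge_atTop M] with n hn
      have hθ : ‖g θ‖ ≤ n := hM.trans (by exact_mod_cast hn)
      simp [hG, Set.indicator_of_mem (show θ ∈ {θ | ‖g θ‖ ≤ n} from hθ)]
  have hex : ∀ n : ℕ, ∃ p ∈ fullTrig T, energy α f (G n - p) < ENNReal.ofReal (1 / (n + 1)) :=
    fun n => hf.exists_fullTrig_of_bounded hα (hGm n) (hGB n)
      (ENNReal.ofReal_pos.2 (by positivity)) ENNReal.ofReal_ne_top
  choose p hp hpe using hex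
  refine ⟨p, hp, ?_⟩
  have h2 : Tendsto (fun n => energy α f (G n - p n)) atTop (𝓝 0) := by
    have h3 : Tendsto (fun n : ℕ => ENNReal.ofReal (1 / ((n : ℝ) + 1))) atTop (𝓝 0) := by
      have := (ENNReal.continuous_ofReal.tendsto 0).comp
        (tendsto_one_div_add_atTop_nhds_zero_nat (𝕜 := ℝ))
      rwa [ENNReal.ofReal_zero] at this
    exact tendsto_of_tendsto_of_tendsto_of_le_of_le tendsto_const_nhds h3
      (fun _ => zero_le) (fun n => (hpe n).le)
  have h4 := hf.tendsto_energy_add hα (fun n => (hgm.sub (hGm n)).aemeasurable)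
    (fun n => ((hGm n).sub (continuous_of_mem_fullTrig (hp n)).measurable).aemeasurable) hGlim h2
  refine h4.congr fun n => ?_
  rw [sub_add_sub_cancel]
  exact energy_congr (hgh.symm.sub (EventuallyEq.refl _ _))

/-! ### Fourier coefficients -/

lemma integrable_leb_of_continuous {E : Type*} [NormedAddCommGroup E] {g : ℝ → E}
    (hg : Continuous g) : Integrable g leb :=
  (hg.integrableOn_Icc (a := -Real.pi) (b := Real.pi)).mono_set Set.Ioc_subset_Icc_self

lemma integral_exp_leb (m : ℤ) :
    ∫ θ : ℝ, Complex.exp (Complex.I * (m : ℂ) * (θ : ℂ)) ∂leb =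
      if m = 0 then 2 * (Real.pi : ℂ) else 0 := by
  have hpi : -Real.pi ≤ Real.pi := by linarith [Real.pi_pos]
  rw [leb, ← intervalIntegral.integral_of_le hpi]
  split_ifs with h
  · simp [h]; ring
  · have hne : Complex.I * (m : ℂ) ≠ 0 := mul_ne_zero Complex.I_ne_zero (by exact_mod_cast h)
    rw [integral_exp_mul_complex hne]
    have : Complex.exp (Complex.I * (m : ℂ) * (Real.pi : ℂ)) =
        Complex.exp (Complex.I * (m : ℂ) * ((-Real.pi : ℝ) : ℂ)) := by
      rw [Complex.exp_eq_exp_iff_exists_int]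
      exact ⟨m, by push_cast; ring⟩
    rw [this]; simp

/-- The vector `∫ e^{-ikθ} h(θ) dθ`. -/
def coeff (k : ℕ) (h : ℝ → Fin T → ℂ) : Fin T → ℂ :=
  ∫ θ, Complex.exp (-(Complex.I * ((k : ℤ) : ℂ) * (θ : ℂ))) • h θ ∂leb

lemma norm_exp_neg (k : ℕ) (θ : ℝ) :
    ‖Complex.exp (-(Complex.I * ((k : ℤ) : ℂ) * (θ : ℂ)))‖ = 1 := by
  have : -(Complex.I * ((k : ℤ) : ℂ) * (θ : ℂ)) = Complex.I * ((-(k * θ) : ℝ) : ℂ) := by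
    push_cast; ring
  rw [this, Complex.norm_exp_I_mul_ofReal]

lemma continuous_exp_neg (k : ℕ) :
    Continuous fun θ : ℝ => Complex.exp (-(Complex.I * ((k : ℤ) : ℂ) * (θ : ℂ))) := by fun_prop

lemma integrable_exp_smul (k : ℕ) {h : ℝ → Fin T → ℂ} (hh : Integrable h leb) :
    Integrable (fun θ : ℝ => Complex.exp (-(Complex.I * ((k : ℤ) : ℂ) * (θ : ℂ))) • h θ) leb := by
  refine hh.norm.mono' ?_ (ae_of_all _ fun θ => ?_)
  · exact (continuous_exp_neg k).aestronglyMeasurable.smul hh.aestronglyMeasurable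
  · rw [norm_smul, norm_exp_neg, one_mul]

lemma coeff_add (k : ℕ) {g h : ℝ → Fin T → ℂ} (hg : Integrable g leb) (hh : Integrable h leb) :
    coeff k (g + h) = coeff k g + coeff k h := by
  simp only [coeff, Pi.add_apply, smul_add]
  exact integral_add (integrable_exp_smul k hg) (integrable_exp_smul k hh)

lemma coeff_sub (k : ℕ) {g h : ℝ → Fin T → ℂ} (hg : Integrable g leb) (hh : Integrable h leb) :
    coeff k (g - h) = coeff k g - coeff k h := by
  simp only [coeff, Pi.sub_apply, smul_sub]
  exact integral_sub (integrable_exp_smul k hg) (integrable_exp_smul k hh)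

lemma coeff_smul (k : ℕ) (c : ℂ) (h : ℝ → Fin T → ℂ) : coeff k (c • h) = c • coeff k h := by
  simp only [coeff, Pi.smul_apply]
  rw [← integral_smul]
  exact integral_congr_ae (ae_of_all _ fun θ => smul_comm _ _ _)

lemma enorm_coeff_le (k : ℕ) (h : ℝ → Fin T → ℂ) : ‖coeff k h‖ₑ ≤ ∫⁻ θ, ‖h θ‖ₑ ∂leb := by
  refine (enorm_integral_le_lintegral_enorm _).trans (le_of_eq ?_)
  refine lintegral_congr fun θ => ?_
  rw [← ofReal_norm, norm_smul, norm_exp_neg, one_mul, ofReal_norm]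

lemma coeff_expVec (k : ℕ) (j : ℤ) (i : Fin T) :
    coeff k (expVec j i) = if j = k then Pi.single i (2 * (Real.pi : ℂ)) else 0 := by
  have h1 : ∀ θ : ℝ, Complex.exp (-(Complex.I * ((k : ℤ) : ℂ) * (θ : ℂ))) •
      (expVec j i θ : Fin T → ℂ) = Complex.exp (Complex.I * ((j - k : ℤ) : ℂ) * (θ : ℂ)) •
        (Pi.single i 1 : Fin T → ℂ) := fun θ => by
    rw [expVec, ← Pi.single_smul, ← Pi.single_smul, smul_eq_mul, smul_eq_mul, mul_one,
      ← Complex.exp_add]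
    congr 2
    push_cast; ring
  simp only [coeff, h1]
  rw [integral_smul_const, integral_exp_leb]
  simp only [sub_eq_zero]
  split_ifs
  · rw [← Pi.single_smul, smul_eq_mul, mul_one]
  · simp

lemma coeff_of_mem_trigSpan {p : ℝ → Fin T → ℂ} (hp : p ∈ trigSpan T N) {k : ℕ} (hk : k ≤ N) :
    coeff k p = 0 := by
  have hc : ∀ {x : ℝ → Fin T → ℂ}, x ∈ trigSpan T N → Integrable x leb := fun hx =>
    integrable_leb_of_continuous (continuous_of_mem_fullTrig (trigSpan_le_fullTrig hx))
  induction hp using Submodule.span_induction with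
  | mem x hx =>
    obtain ⟨j, i, hj, rfl⟩ := hx
    rw [coeff_expVec, if_neg]
    rintro rfl
    exact hj ⟨by positivity, by exact_mod_cast hk⟩
  | zero => simp [coeff]
  | add x y hx hy ihx ihy => rw [coeff_add k (hc hx) (hc hy), ihx, ihy, add_zero]
  | smul c x _ ih => rw [coeff_smul, ih, smul_zero]

lemma polyA_add (a b : Fin (N + 1) → Fin T → ℂ) : polyA (a + b) = polyA a + polyA b := by
  funext θ; simp [polyA, Finset.sum_add_distrib]

lemma polyA_smul (c : ℂ) (a : Fin (N + 1) → Fin T → ℂ) : polyA (c • a) = c • polyA a := by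
  funext θ
  simp only [polyA, Pi.smul_apply, Finset.smul_sum]
  exact Finset.sum_congr rfl fun j _ => smul_comm _ _ _

lemma polyA_single (j : Fin (N + 1)) (i : Fin T) :
    polyA (Pi.single j (Pi.single i 1)) = expVec (((j : ℕ) : ℤ)) i := by
  funext θ
  rw [polyA, Finset.sum_eq_single j]
  · rw [Pi.single_eq_same, expVec, ← Pi.single_smul, smul_eq_mul, mul_one]
  · intro b _ hb
    rw [Pi.single_eq_of_ne hb, smul_zero]
  · simp

lemma polyA_mem_fullTrig (a : Fin (N + 1) → Fin T → ℂ) : polyA a ∈ fullTrig T := by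
  have : polyA a = ∑ j, ∑ i, a j i • expVec (((j : Fin (N + 1)) : ℕ) : ℤ) i := by
    funext θ
    simp only [polyA, Finset.sum_apply, Pi.smul_apply]
    refine Finset.sum_congr rfl fun j _ => funext fun k => ?_
    simp [expVec, Finset.sum_apply, Pi.single_apply, mul_comm]
  rw [this]
  exact Submodule.sum_mem _ fun j _ => Submodule.sum_mem _ fun i _ =>
    Submodule.smul_mem _ _ (Submodule.subset_span ⟨_, i, rfl⟩)

lemma continuous_polyA (a : Fin (N + 1) → Fin T → ℂ) : Continuous (polyA a) :=
  continuous_of_mem_fullTrig (polyA_mem_fullTrig a)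

lemma norm_polyA_le (a : Fin (N + 1) → Fin T → ℂ) (θ : ℝ) : ‖polyA a θ‖ ≤ ∑ j, ‖a j‖ := by
  refine (norm_sum_le _ _).trans (Finset.sum_le_sum fun j _ => ?_)
  rw [norm_smul]
  have : Complex.I * ((((j : ℕ) : ℤ)) : ℂ) * (θ : ℂ) = Complex.I * (((j : ℕ) * θ : ℝ) : ℂ) := by
    push_cast; ring
  rw [this, Complex.norm_exp_I_mul_ofReal, one_mul]

lemma coeff_polyA (a : Fin (N + 1) → Fin T → ℂ) (k : Fin (N + 1)) :
    coeff k (polyA a) = (2 * (Real.pi : ℂ)) • a k := by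
  have h1 : ∀ θ : ℝ, Complex.exp (-(Complex.I * (((k : ℕ) : ℤ) : ℂ) * (θ : ℂ))) • polyA a θ =
      ∑ j : Fin (N + 1), Complex.exp (Complex.I * (((j : ℕ) : ℤ) - ((k : ℕ) : ℤ) : ℤ) * (θ : ℂ)) •
        a j := fun θ => by
    rw [polyA, Finset.smul_sum]
    refine Finset.sum_congr rfl fun j _ => ?_
    rw [smul_smul, ← Complex.exp_add]
    congr 2
    push_cast; ring
  simp only [coeff, h1]
  rw [integral_finsetSum]
  · simp only [integral_smul_const, integral_exp_leb]
    rw [Finset.sum_eq_single k]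
    · simp
    · intro j _ hj
      rw [if_neg, zero_smul]
      intro h
      exact hj (Fin.ext (by omega))
    · simp
  · intro j _
    exact integrable_leb_of_continuous (by fun_prop)

/-- Every trigonometric polynomial splits into its part with frequencies `0, …, N`, which has the
form `polyA b`, and a remainder in `trigSpan`. -/
lemma exists_sub_polyA_mem {p : ℝ → Fin T → ℂ} (hp : p ∈ fullTrig T) (N : ℕ) :
    ∃ b : Fin (N + 1) → Fin T → ℂ, p - polyA b ∈ trigSpan T N := by
  induction hp using Submodule.span_induction with
  | mem x hx =>
    obtain ⟨j, i, rfl⟩ := hx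
    by_cases hj : 0 ≤ j ∧ j ≤ N
    · refine ⟨Pi.single ⟨j.toNat, by omega⟩ (Pi.single i 1), ?_⟩
      rw [polyA_single]
      simp only [Int.toNat_of_nonneg hj.1, sub_self]
      exact Submodule.zero_mem _
    · refine ⟨0, ?_⟩
      have : polyA (0 : Fin (N + 1) → Fin T → ℂ) = 0 := by funext θ; simp [polyA]
      rw [this, sub_zero]
      exact Submodule.subset_span ⟨j, i, hj, rfl⟩
  | zero =>
    refine ⟨0, ?_⟩
    have : polyA (0 : Fin (N + 1) → Fin T → ℂ) = 0 := by funext θ; simp [polyA]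
    rw [this, sub_zero]
    exact Submodule.zero_mem _
  | add x y _ _ hx hy =>
    obtain ⟨b, hb⟩ := hx
    obtain ⟨c, hc⟩ := hy
    refine ⟨b + c, ?_⟩
    rw [polyA_add, add_sub_add_comm]
    exact Submodule.add_mem _ hb hc
  | smul c x _ hx =>
    obtain ⟨b, hb⟩ := hx
    refine ⟨c • b, ?_⟩
    rw [polyA_smul, ← smul_sub]
    exact Submodule.smul_mem _ _ hb

lemma RegularDensity.integrable_of_energy (hα : 1 < α) (hf : RegularDensity α f)
    {h : ℝ → Fin T → ℂ} (hm : AEMeasurable h leb) (hfin : energy α f h < ⊤) : Integrable h leb :=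
  ⟨hm.aestronglyMeasurable, hf.lintegral_norm_lt_top hα hm hfin⟩

/-- A function of finite energy whose Fourier coefficients with indices `0, …, N` vanish belongs to
`L^α_N(μ)`. -/
lemma RegularDensity.memLN_of_coeff (hα : 1 < α) (hf : RegularDensity α f)
    {h : ℝ → Fin T → ℂ} (hm : AEMeasurable h leb) (hfin : energy α f h < ⊤)
    (hc : ∀ k : Fin (N + 1), coeff k h = 0) : MemLN α N f h := by
  refine ⟨hm, fun ε hε => ?_⟩
  obtain ⟨p, hp, hpt⟩ := hf.exists_fullTrig hα hm hfin
  choose b hb using fun n => exists_sub_polyA_mem (hp n) N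
  have hpi : ∀ n, Integrable (p n) leb := fun n =>
    integrable_leb_of_continuous (continuous_of_mem_fullTrig (hp n))
  have hhi := hf.integrable_of_energy hα hm hfin
  have hpm : ∀ n, AEMeasurable (h - p n) leb := fun n =>
    hm.sub (continuous_of_mem_fullTrig (hp n)).measurable.aemeasurable
  have hL := hf.tendsto_lintegral_norm hα hpm hpt
  -- The approximants `p n` need not lie in `trigSpan`; `polyA (b n)` is the part to be removed.
  -- Since the coefficients of `h` vanish, those of `polyA (b n)` are minus the coefficients of `h -
  -- p n`, which tend to `0` by the embedding into `L¹`. So the correction costs no energy in the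
  -- limit.
  have hco : ∀ n (k : Fin (N + 1)), (2 * (Real.pi : ℂ)) • b n k = - coeff k (h - p n) :=
    fun n k => by
    have h1 := coeff_of_mem_trigSpan (hb n) (Nat.lt_succ_iff.1 k.2)
    rw [coeff_sub k (hpi n) (integrable_leb_of_continuous (continuous_polyA _)), coeff_polyA,
      sub_eq_zero] at h1
    rw [coeff_sub k hhi (hpi n), hc k, h1]; simp
  have hbt : ∀ k, Tendsto (fun n => ‖b n k‖) atTop (𝓝 0) := fun k => by
    have h1 : Tendsto (fun n => ‖coeff k (h - p n)‖ₑ) atTop (𝓝 0) :=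
      tendsto_of_tendsto_of_tendsto_of_le_of_le tendsto_const_nhds hL (fun _ => zero_le)
        (fun n => enorm_coeff_le _ _)
    have h2 := (ENNReal.continuousAt_toReal ENNReal.zero_ne_top).tendsto.comp h1
    simp only [Function.comp_def, toReal_enorm, ENNReal.toReal_zero] at h2
    have h3 := h2.const_mul (1 / (2 * Real.pi))
    rw [mul_zero] at h3
    refine h3.congr fun n => ?_
    rw [← norm_neg, ← hco, norm_smul, norm_mul, Complex.norm_real,
      Real.norm_of_nonneg Real.pi_pos.le]
    simp
    field_simp
  have hbs : Tendsto (fun n => ∑ k, ‖b n k‖) atTop (𝓝 0) := by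
    simpa using tendsto_finsetSum Finset.univ fun k _ => hbt k
  have hE : Tendsto (fun n => energy α f (polyA (b n))) atTop (𝓝 0) := by
    have h1 : Continuous fun x : ℝ =>
        ENNReal.ofReal ((∫ θ, ∑ k, ∑ l, ‖f θ k l‖ ∂leb) * x ^ α) :=
      ENNReal.continuous_ofReal.comp (continuous_const.mul
        (continuous_id.rpow_const fun _ => Or.inr (by linarith)))
    have h2 := (h1.tendsto 0).comp hbs
    rw [Real.zero_rpow (by linarith), mul_zero, ENNReal.ofReal_zero] at h2
    exact tendsto_of_tendsto_of_tendsto_of_le_of_le tendsto_const_nhds h2 (fun _ => zero_le)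
      fun n => hf.energy_le hα fun θ => norm_polyA_le (b n) θ
  have hfinal := hf.tendsto_energy_add hα hpm
    (fun n => (continuous_polyA (b n)).measurable.aemeasurable) hpt hE
  obtain ⟨n, hn⟩ := (hfinal.eventually (gt_mem_nhds hε)).exists
  refine ⟨p n - polyA (b n), hb n, ?_⟩
  rwa [sub_sub_eq_add_sub, add_sub_right_comm]

end

/-! ### Existence and uniqueness for the system of equations by convex duality. -/

section

/-! ### The system of equations -/

variable {T N : ℕ} {α : ℝ} {f : ℝ → Matrix (Fin T) (Fin T) ℂ}

lemma errChar_eq (c : Fin (N + 1) → Fin T → ℂ) (θ : ℝ) :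
    errChar α f c θ = dualVec α (f θ) (polyC c θ) := rfl

lemma polyC_add (c d : Fin (N + 1) → Fin T → ℂ) (θ : ℝ) :
    polyC (c + d) θ = polyC c θ + polyC d θ := by
  simp [polyC, Finset.sum_add_distrib]

lemma polyC_smul (r : ℂ) (c : Fin (N + 1) → Fin T → ℂ) (θ : ℝ) :
    polyC (r • c) θ = r • polyC c θ := by
  simp only [polyC, Pi.smul_apply, Finset.smul_sum]
  exact Finset.sum_congr rfl fun j _ => smul_comm _ _ _

lemma polyC_sub (c d : Fin (N + 1) → Fin T → ℂ) (θ : ℝ) :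
    polyC (c - d) θ = polyC c θ - polyC d θ := by
  simp [polyC, smul_sub, Finset.sum_sub_distrib]

lemma norm_polyC_le (c : Fin (N + 1) → Fin T → ℂ) (θ : ℝ) : ‖polyC c θ‖ ≤ (N + 1) * ‖c‖ := by
  refine (norm_sum_le _ _).trans ?_
  calc _ ≤ ∑ _j : Fin (N + 1), ‖c‖ := Finset.sum_le_sum fun j _ => by
        rw [norm_smul, norm_exp_neg, one_mul]; exact norm_le_pi_norm c j
    _ = _ := by simp

lemma continuous_polyC (c : Fin (N + 1) → Fin T → ℂ) : Continuous (polyC c) := by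
  unfold polyC; fun_prop

lemma continuous_polyC_left (θ : ℝ) :
    Continuous fun c : Fin (N + 1) → Fin T → ℂ => polyC c θ := by
  unfold polyC; fun_prop

/-- Conjugation turns `polyC c` into `polyA (star c)`, whose Fourier coefficients return `2π · star
c`. -/
lemma eq_zero_of_polyC_ae_eq_zero {c : Fin (N + 1) → Fin T → ℂ}
    (h : ∀ᵐ θ ∂leb, polyC c θ = 0) : c = 0 := by
  have h1 : ∀ θ, polyA (star c) θ = star (polyC c θ) := fun θ => by
    simp only [polyA, polyC, star_sum, star_smul, Pi.star_apply]
    refine Finset.sum_congr rfl fun j _ => ?_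
    congr 1
    simp only [Complex.star_def, ← Complex.exp_conj, map_neg, map_mul, Complex.conj_I,
      Complex.conj_ofReal, map_intCast]
    ring_nf
  have h2 : ∀ k, (2 * (Real.pi : ℂ)) • (star c) k = 0 := fun k => by
    rw [← coeff_polyA, coeff]
    refine integral_eq_zero_of_ae ?_
    filter_upwards [h] with θ hθ
    rw [h1, hθ]; simp
  funext k
  have h3 := h2 k
  rw [smul_eq_zero] at h3
  rcases h3 with h3 | h3
  · exact absurd h3 (mul_ne_zero two_ne_zero (by exact_mod_cast Real.pi_ne_zero))
  · simpa using h3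

/-- The functional `w ↦ vᵀ w`. -/
def dotCLM (v : Fin T → ℂ) : (Fin T → ℂ) →L[ℂ] ℂ :=
  ∑ i, v i • ContinuousLinearMap.proj (R := ℂ) (φ := fun _ : Fin T => ℂ) i

lemma dotCLM_apply (v w : Fin T → ℂ) : dotCLM v w = v ⬝ᵥ w := by
  simp [dotCLM, dotProduct]

lemma polyC_dotProduct (d : Fin (N + 1) → Fin T → ℂ) (h : ℝ → Fin T → ℂ) (θ : ℝ) :
    polyC d θ ⬝ᵥ h θ = ∑ k : Fin (N + 1), dotCLM (d k)
      (Complex.exp (-(Complex.I * (((k : ℕ) : ℤ) : ℂ) * (θ : ℂ))) • h θ) := by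
  simp only [polyC, sum_dotProduct, dotCLM_apply, smul_dotProduct, dotProduct_smul]

lemma integrable_polyC_dotProduct (d : Fin (N + 1) → Fin T → ℂ) {h : ℝ → Fin T → ℂ}
    (hh : Integrable h leb) : Integrable (fun θ => polyC d θ ⬝ᵥ h θ) leb := by
  simp only [polyC_dotProduct]
  exact integrable_finsetSum _ fun k _ =>
    (dotCLM (d k)).integrable_comp (integrable_exp_smul k hh)

lemma integral_polyC_dotProduct (d : Fin (N + 1) → Fin T → ℂ) {h : ℝ → Fin T → ℂ}
    (hh : Integrable h leb) :
    ∫ θ, polyC d θ ⬝ᵥ h θ ∂leb = ∑ k : Fin (N + 1), d k ⬝ᵥ coeff k h := by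
  simp only [polyC_dotProduct]
  rw [integral_finsetSum _ fun k _ => (dotCLM (d k)).integrable_comp (integrable_exp_smul k hh)]
  refine Finset.sum_congr rfl fun k _ => ?_
  rw [(dotCLM (d k)).integral_comp_comm (integrable_exp_smul k hh), dotCLM_apply]
  rfl

/-- The function dominating `errChar`. -/
def dualBound (α : ℝ) (f : ℝ → Matrix (Fin T) (Fin T) ℂ) (θ : ℝ) : ℝ :=
  ∑ k, (∑ l, ‖(f θ)⁻¹ k l‖) ^ (1 / (α - 1))

lemma norm_errChar_le (hα : 1 < α) (c : Fin (N + 1) → Fin T → ℂ) {R : ℝ} (hR : ‖c‖ ≤ R) (θ : ℝ) :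
    ‖errChar α f c θ‖ ≤ dualBound α f θ * ((N + 1) * R) ^ (1 / (α - 1)) := by
  have hp : 0 ≤ 1 / (α - 1) := by have : 0 < α - 1 := by linarith
                                  positivity
  refine (norm_dualVec_le hα _).trans (mul_le_mul_of_nonneg_left ?_ (by positivity))
  refine Real.rpow_le_rpow (norm_nonneg _) ((norm_polyC_le c θ).trans ?_) hp
  exact mul_le_mul_of_nonneg_left hR (by positivity)

lemma RegularDensity.aemeasurable_errChar (hf : RegularDensity α f)
    (c : Fin (N + 1) → Fin T → ℂ) : AEMeasurable (errChar α f c) leb := by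
  refine (measurable_vpow (1 / (α - 1))).comp_aemeasurable (f := fun θ => (f θ)⁻¹ *ᵥ polyC c θ) ?_
  unfold mulVec dotProduct
  refine aemeasurable_pi_lambda _ fun k => Finset.aemeasurable_fun_sum _ fun l _ => ?_
  refine (aemeasurable_inv_apply (fun k l => (hf.integrable k l).aemeasurable) k l).mul ?_
  exact ((measurable_pi_apply l).comp (continuous_polyC c).measurable).aemeasurable

lemma RegularDensity.integrable_errChar (hα : 1 < α) (hf : RegularDensity α f)
    (c : Fin (N + 1) → Fin T → ℂ) : Integrable (errChar α f c) leb :=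
  Integrable.mono' (hf.dual.mul_const _) (hf.aemeasurable_errChar c).aestronglyMeasurable
    (ae_of_all _ fun θ => norm_errChar_le hα c le_rfl θ)

lemma continuous_dualVec (hα : 1 < α) (F : Matrix (Fin T) (Fin T) ℂ) :
    Continuous (dualVec α F) := by
  have hp : 0 < 1 / (α - 1) := by have : 0 < α - 1 := by linarith
                                  positivity
  exact (continuous_vpow hp).comp (continuous_const.matrix_mulVec continuous_id)

/-- Dominated convergence in `c`, with the integrable bound of the minimality condition on a ball
around `c₀`. -/
lemma RegularDensity.continuous_coeff_errChar (hα : 1 < α) (hf : RegularDensity α f) (k : ℕ) :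
    Continuous fun c : Fin (N + 1) → Fin T → ℂ => coeff k (errChar α f c) := by
  rw [continuous_iff_continuousAt]
  intro c₀
  refine continuousAt_of_dominated
    (bound := fun θ => dualBound α f θ * ((N + 1) * (‖c₀‖ + 1)) ^ (1 / (α - 1))) ?_ ?_ ?_ ?_
  · exact Eventually.of_forall fun c =>
      (integrable_exp_smul k (hf.integrable_errChar hα c)).aestronglyMeasurable
  · have : ∀ᶠ c in 𝓝 c₀, ‖c‖ < ‖c₀‖ + 1 :=
      continuous_norm.continuousAt.eventually (gt_mem_nhds (by linarith))
    filter_upwards [this] with c hc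
    refine ae_of_all _ fun θ => ?_
    rw [norm_smul, norm_exp_neg, one_mul]
    exact norm_errChar_le hα c hc.le θ
  · exact hf.dual.mul_const _
  · refine ae_of_all _ fun θ => Continuous.continuousAt ?_
    exact ((continuous_dualVec hα (f θ)).comp (continuous_polyC_left θ)).const_smul
      (Complex.exp (-(Complex.I * ((k : ℤ) : ℂ) * (θ : ℂ))))

/-- `∫ gᵀ f g^{<α-1>} dθ` for `g = errChar α f c`. -/
def dualEnergy (α : ℝ) (f : ℝ → Matrix (Fin T) (Fin T) ℂ) (c : Fin (N + 1) → Fin T → ℂ) : ℝ :=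
  ∫ θ, form α (f θ) (errChar α f c θ) ∂leb

lemma Admissible.form_errChar (hα : 1 < α) {θ : ℝ} (hθ : Admissible α (f θ))
    (c : Fin (N + 1) → Fin T → ℂ) :
    form α (f θ) (errChar α f c θ) = (polyC c θ ⬝ᵥ errChar α f c θ).re := by
  rw [errChar_eq, hθ.form_dualVec hα, dotProduct_comm]

lemma RegularDensity.integrable_form_errChar (hα : 1 < α) (hf : RegularDensity α f)
    (c : Fin (N + 1) → Fin T → ℂ) :
    Integrable (fun θ => form α (f θ) (errChar α f c θ)) leb := by
  refine (integrable_polyC_dotProduct c (hf.integrable_errChar hα c)).re.congr ?_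
  filter_upwards [hf.admissible] with θ hθ
  exact (hθ.form_errChar hα c).symm

/-- As `f g^{<α-1>} = C` for `g = errChar α f c`, the form of `g` is `Re Cᵀ g`, and integration
leaves only the coefficients `0, …, N` of `g`. -/
lemma RegularDensity.dualEnergy_eq (hα : 1 < α) (hf : RegularDensity α f)
    (c : Fin (N + 1) → Fin T → ℂ) :
    dualEnergy α f c = (∑ k : Fin (N + 1), c k ⬝ᵥ coeff k (errChar α f c)).re := by
  rw [← integral_polyC_dotProduct c (hf.integrable_errChar hα c), dualEnergy]
  refine Eq.trans (integral_congr_ae ?_)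
    (integral_re (integrable_polyC_dotProduct c (hf.integrable_errChar hα c)))
  filter_upwards [hf.admissible] with θ hθ
  exact hθ.form_errChar hα c

lemma RegularDensity.continuous_dualEnergy (hα : 1 < α) (hf : RegularDensity α f) :
    Continuous (dualEnergy (N := N) α f) := by
  have h1 : dualEnergy (N := N) α f =
      fun c => (∑ k : Fin (N + 1), c k ⬝ᵥ coeff k (errChar α f c)).re :=
    funext fun c => hf.dualEnergy_eq hα c
  rw [h1]
  refine Complex.continuous_re.comp (continuous_finsetSum _ fun k _ => ?_)
  exact (continuous_apply k).dotProduct (hf.continuous_coeff_errChar hα k)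

lemma RegularDensity.polyC_eq_zero (hα : 1 < α) {θ : ℝ} (hθ : Admissible α (f θ))
    {c : Fin (N + 1) → Fin T → ℂ} (h : errChar α f c θ = 0) : polyC c θ = 0 := by
  rw [← hθ.mulVec_vpow_dualVec hα (polyC c θ), ← errChar_eq, h]; simp

lemma RegularDensity.dualEnergy_pos (hα : 1 < α) (hf : RegularDensity α f)
    {c : Fin (N + 1) → Fin T → ℂ} (hc : c ≠ 0) : 0 < dualEnergy α f c := by
  have h0 : 0 ≤ᵐ[leb] fun θ => form α (f θ) (errChar α f c θ) := by
    filter_upwards [hf.admissible] with θ hθ using hθ.form_nonneg hα _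
  refine lt_of_le_of_ne (integral_nonneg_of_ae h0) fun h => hc ?_
  have h1 := (integral_eq_zero_iff_of_nonneg_ae h0 (hf.integrable_form_errChar hα c)).1 h.symm
  refine eq_zero_of_polyC_ae_eq_zero ?_
  filter_upwards [h1, hf.admissible] with θ h2 hθ
  exact RegularDensity.polyC_eq_zero hα hθ ((hθ.form_eq_zero hα).1 h2)

lemma dualEnergy_smul (hα : 1 < α) {r : ℝ} (hr : 0 ≤ r) (c : Fin (N + 1) → Fin T → ℂ) :
    dualEnergy α f ((r : ℂ) • c) = r ^ (1 / (α - 1) * α) * dualEnergy α f c := by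
  have hp : 0 < 1 / (α - 1) := by have : 0 < α - 1 := by linarith
                                  positivity
  rw [dualEnergy, dualEnergy, ← integral_const_mul]
  refine integral_congr_ae (ae_of_all _ fun θ => ?_)
  simp only [errChar_eq]
  rw [polyC_smul, dualVec_smul, form_smul hα, norm_spow hp, Complex.norm_real,
    Real.norm_of_nonneg hr, Real.rpow_mul hr]

/-- The energy is continuous, positive off `0` and homogeneous of degree `α/(α-1)`, so its minimum
on the unit sphere controls it everywhere. An empty sphere means a trivial coefficient space. -/
lemma RegularDensity.exists_le_dualEnergy (hα : 1 < α) (hf : RegularDensity α f) :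
    ∃ m : ℝ, 0 < m ∧ ∀ c : Fin (N + 1) → Fin T → ℂ,
      m * ‖c‖ ^ (1 / (α - 1) * α) ≤ dualEnergy α f c := by
  have hq : 0 < 1 / (α - 1) * α := by have : 0 < α - 1 := by linarith
                                      positivity
  have hzero : ∀ m : ℝ, m * ‖(0 : Fin (N + 1) → Fin T → ℂ)‖ ^ (1 / (α - 1) * α) = 0 := fun m => by
    rw [norm_zero, Real.zero_rpow hq.ne', mul_zero]
  have hnn : ∀ c : Fin (N + 1) → Fin T → ℂ, 0 ≤ dualEnergy α f c := fun c => by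
    refine integral_nonneg_of_ae ?_
    filter_upwards [hf.admissible] with θ hθ using hθ.form_nonneg hα _
  have hunit : ∀ c : Fin (N + 1) → Fin T → ℂ, c ≠ 0 →
      ((‖c‖⁻¹ : ℝ) : ℂ) • c ∈ Metric.sphere (0 : Fin (N + 1) → Fin T → ℂ) 1 := fun c hc => by
    rw [mem_sphere_zero_iff_norm, norm_smul, Complex.norm_real, norm_inv, norm_norm,
      inv_mul_cancel₀ (norm_ne_zero_iff.2 hc)]
  by_cases hne : (Metric.sphere (0 : Fin (N + 1) → Fin T → ℂ) 1).Nonempty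
  · obtain ⟨c₀, hc₀, hmin⟩ := (isCompact_sphere (0 : Fin (N + 1) → Fin T → ℂ) 1).exists_isMinOn hne
      (hf.continuous_dualEnergy hα).continuousOn
    refine ⟨dualEnergy α f c₀, hf.dualEnergy_pos hα ?_, fun c => ?_⟩
    · rintro rfl; simp at hc₀
    · by_cases hc : c = 0
      · rw [hc, hzero]; exact hnn 0
      · have h1 := hmin (hunit c hc)
        have h2 : c = ((‖c‖ : ℝ) : ℂ) • (((‖c‖⁻¹ : ℝ) : ℂ) • c) := by
          rw [smul_smul, ← Complex.ofReal_mul, mul_inv_cancel₀ (norm_ne_zero_iff.2 hc)]; simp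
        conv_rhs => rw [h2, dualEnergy_smul hα (norm_nonneg _)]
        rw [mul_comm]
        exact mul_le_mul_of_nonneg_left h1 (by positivity)
  · refine ⟨1, one_pos, fun c => ?_⟩
    have hc : c = 0 := by
      by_contra hc
      exact hne ⟨_, hunit c hc⟩
    rw [hc, hzero]; exact hnn 0

/-- The convex functional whose Euler equation is the system. -/
def dualFunctional (α : ℝ) (f : ℝ → Matrix (Fin T) (Fin T) ℂ) (v c : Fin (N + 1) → Fin T → ℂ) : ℝ :=
  (1 - 1 / α) * dualEnergy α f c - (∑ k, c k ⬝ᵥ v k).re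

/-- Coercivity: the degree `q = α/(α-1)` of the energy exceeds `1`, so it outgrows the linear term.
-/
lemma RegularDensity.exists_isMin (hα : 1 < α) (hf : RegularDensity α f)
    (v : Fin (N + 1) → Fin T → ℂ) :
    ∃ c, ∀ d, dualFunctional α f v c ≤ dualFunctional α f v d := by
  have hα1 : 0 < α - 1 := by linarith
  have hlin : Continuous fun c : Fin (N + 1) → Fin T → ℂ => (∑ k, c k ⬝ᵥ v k).re :=
    Complex.continuous_re.comp (continuous_finsetSum _ fun k _ =>
      (continuous_apply k).dotProduct continuous_const)
  have hcont : Continuous (dualFunctional α f v) :=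
    (continuous_const.mul (hf.continuous_dualEnergy hα)).sub hlin
  refine hcont.exists_forall_le ?_
  obtain ⟨m, hm, hle⟩ := hf.exists_le_dualEnergy (N := N) hα
  set A : ℝ := ∑ k, ∑ i, ‖v k i‖ with hA
  have hA' : ∀ c : Fin (N + 1) → Fin T → ℂ, (∑ k, c k ⬝ᵥ v k).re ≤ A * ‖c‖ := fun c => by
    refine (Complex.re_le_norm _).trans ((norm_sum_le _ _).trans ?_)
    rw [hA, Finset.sum_mul]
    refine Finset.sum_le_sum fun k _ => ?_
    rw [dotProduct, Finset.sum_mul]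
    refine (norm_sum_le _ _).trans (Finset.sum_le_sum fun i _ => ?_)
    rw [norm_mul, mul_comm]
    exact mul_le_mul_of_nonneg_left ((norm_le_pi_norm _ i).trans (norm_le_pi_norm c k))
      (norm_nonneg _)
  have hκ : 0 < 1 - 1 / α := by
    rw [sub_pos, div_lt_one (by linarith)]; exact hα
  set q : ℝ := 1 / (α - 1) * α with hq
  have hq1 : 0 < q - 1 := by
    have : q - 1 = 1 / (α - 1) := by rw [hq]; field_simp; ring
    rw [this]; positivity
  have hlow : ∀ c : Fin (N + 1) → Fin T → ℂ,
      ‖c‖ * ((1 - 1 / α) * m * ‖c‖ ^ (q - 1) - A) ≤ dualFunctional α f v c := fun c => by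
    have h1 := mul_le_mul_of_nonneg_left (hle c) hκ.le
    have h2 : ‖c‖ ^ q = ‖c‖ * ‖c‖ ^ (q - 1) := by
      have := Real.rpow_add' (norm_nonneg c) (y := 1) (z := q - 1) (by linarith)
      rw [Real.rpow_one] at this
      rw [← this]; congr 1; ring
    rw [h2] at h1
    have h3 := hA' c
    rw [dualFunctional]
    nlinarith
  refine tendsto_atTop_mono hlow ?_
  have hx : Tendsto (fun x : ℝ => x * ((1 - 1 / α) * m * x ^ (q - 1) - A)) atTop atTop := by
    refine tendsto_id.atTop_mul_atTop₀ ?_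
    refine tendsto_atTop_add_const_right _ (-A) ?_
    exact (tendsto_rpow_atTop hq1).const_mul_atTop (by positivity)
  exact hx.comp (tendsto_norm_cocompact_atTop (E := Fin (N + 1) → Fin T → ℂ))

/-- The gradient inequality for the convex energy, with the gradient taken at the far point `c + d`.
It is Young's inequality for the pair of `errChar` at `c + d` and at `c`, and it replaces
differentiation under the integral sign. -/
lemma RegularDensity.dualEnergy_sub_le (hα : 1 < α) (hf : RegularDensity α f)
    (c d : Fin (N + 1) → Fin T → ℂ) :
    (1 - 1 / α) * dualEnergy α f (c + d) - (1 - 1 / α) * dualEnergy α f c ≤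
      (∑ k : Fin (N + 1), d k ⬝ᵥ coeff k (errChar α f (c + d))).re := by
  have hi := integrable_polyC_dotProduct d (hf.integrable_errChar hα (c + d))
  rw [← integral_polyC_dotProduct d (hf.integrable_errChar hα (c + d)), dualEnergy, dualEnergy,
    ← integral_const_mul, ← integral_const_mul,
    ← integral_sub ((hf.integrable_form_errChar hα _).const_mul _)
      ((hf.integrable_form_errChar hα _).const_mul _)]
  refine le_trans (integral_mono_ae (((hf.integrable_form_errChar hα _).const_mul _).sub
    ((hf.integrable_form_errChar hα _).const_mul _)) hi.re ?_) (le_of_eq (integral_re hi))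
  filter_upwards [hf.admissible] with θ hθ
  have h1 := (hθ.young hα (errChar α f (c + d) θ) (errChar α f c θ)).1
  rw [errChar_eq c, hθ.mulVec_vpow_dualVec hα, ← errChar_eq, dotProduct_comm] at h1
  have h2 := hθ.form_errChar hα (c + d)
  rw [polyC_add, add_dotProduct, Complex.add_re] at h2
  have h3 : form α (f θ) (errChar α f (c + d) θ) / α =
      1 / α * form α (f θ) (errChar α f (c + d) θ) := by ring
  simp only [RCLike.re_eq_complex_re]
  linarith

/-- At a minimiser `c` the gradient inequality along `t d`, divided by `t > 0`, bounds `Re ∑ d_kᵀ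
v_k` by `Re ∑ d_kᵀ coeff k` at `c + t d`. Letting `t → 0` gives the same bound at `c`, for every
direction `d`. -/
lemma RegularDensity.exists_coeff_eq (hα : 1 < α) (hf : RegularDensity α f)
    (v : Fin (N + 1) → Fin T → ℂ) :
    ∃ c : Fin (N + 1) → Fin T → ℂ, ∀ k : Fin (N + 1), coeff k (errChar α f c) = v k := by
  obtain ⟨c, hc⟩ := hf.exists_isMin hα v
  refine ⟨c, ?_⟩
  have key : ∀ d : Fin (N + 1) → Fin T → ℂ,
      (∑ k, d k ⬝ᵥ v k).re ≤ (∑ k : Fin (N + 1), d k ⬝ᵥ coeff k (errChar α f c)).re := fun d => by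
    have h1 : ∀ t : ℝ, 0 < t → (∑ k, d k ⬝ᵥ v k).re ≤
        (∑ k : Fin (N + 1), d k ⬝ᵥ coeff k (errChar α f (c + (t : ℂ) • d))).re := fun t ht => by
      have h2 := hc (c + (t : ℂ) • d)
      have h3 := hf.dualEnergy_sub_le hα c ((t : ℂ) • d)
      have e1 : (∑ k, (c + (t : ℂ) • d) k ⬝ᵥ v k).re =
          (∑ k, c k ⬝ᵥ v k).re + t * (∑ k, d k ⬝ᵥ v k).re := by
        simp only [Pi.add_apply, Pi.smul_apply, add_dotProduct, smul_dotProduct,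
          Finset.sum_add_distrib, smul_eq_mul, ← Finset.mul_sum, Complex.add_re,
          Complex.re_ofReal_mul]
      have e2 : (∑ k : Fin (N + 1), ((t : ℂ) • d) k ⬝ᵥ
          coeff k (errChar α f (c + (t : ℂ) • d))).re =
          t * (∑ k : Fin (N + 1), d k ⬝ᵥ coeff k (errChar α f (c + (t : ℂ) • d))).re := by
        simp only [Pi.smul_apply, smul_dotProduct, smul_eq_mul, ← Finset.mul_sum,
          Complex.re_ofReal_mul]
      rw [dualFunctional, dualFunctional, e1] at h2
      rw [e2] at h3
      exact le_of_mul_le_mul_left (by linarith) ht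
    have hcont : Continuous fun t : ℝ =>
        (∑ k : Fin (N + 1), d k ⬝ᵥ coeff k (errChar α f (c + (t : ℂ) • d))).re := by
      refine Complex.continuous_re.comp (continuous_finsetSum _ fun k _ => ?_)
      refine continuous_const.dotProduct ((hf.continuous_coeff_errChar hα k).comp ?_)
      exact continuous_const.add (Complex.continuous_ofReal.smul continuous_const)
    have h4 := hcont.tendsto 0
    simp only [Complex.ofReal_zero, zero_smul, add_zero] at h4
    refine ge_of_tendsto (h4.mono_left (nhdsWithin_le_nhds (s := Set.Ioi 0))) ?_
    filter_upwards [self_mem_nhdsWithin] with t ht using h1 t ht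
  -- In the direction opposite to the conjugate of the residual `u` the inequality reads `∑ |u_k|² ≤
  -- 0`.
  set u : Fin (N + 1) → Fin T → ℂ := fun k => coeff k (errChar α f c) - v k with hu
  have h5 := key (-star u)
  have h6 : (∑ k, (star u) k ⬝ᵥ u k).re ≤ 0 := by
    have e : ∑ k, (star u) k ⬝ᵥ u k =
        ∑ k, (-star u) k ⬝ᵥ v k - ∑ k : Fin (N + 1), (-star u) k ⬝ᵥ coeff k (errChar α f c) := by
      rw [← Finset.sum_sub_distrib]
      refine Finset.sum_congr rfl fun k _ => ?_
      simp only [hu, Pi.neg_apply, neg_dotProduct, dotProduct_sub]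
      ring
    rw [e, Complex.sub_re]; linarith
  have h7 : (∑ k, (star u) k ⬝ᵥ u k).re = ∑ k, ∑ i, ‖u k i‖ ^ 2 := by
    rw [Complex.re_sum]
    refine Finset.sum_congr rfl fun k _ => ?_
    rw [dotProduct, Complex.re_sum]
    refine Finset.sum_congr rfl fun i _ => ?_
    simp only [Pi.star_apply, Complex.star_def, Complex.conj_mul']
    norm_cast
  rw [h7] at h6
  have h8 : ∑ k, ∑ i, ‖u k i‖ ^ 2 = 0 := le_antisymm h6 (by positivity)
  intro k
  rw [Finset.sum_eq_zero_iff_of_nonneg fun _ _ => by positivity] at h8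
  have h9 := h8 k (Finset.mem_univ k)
  rw [Finset.sum_eq_zero_iff_of_nonneg fun _ _ => by positivity] at h9
  have h10 : u k = 0 := funext fun i => by simpa using h9 i (Finset.mem_univ i)
  exact sub_eq_zero.1 h10

/-- Strict monotonicity: adding Young's inequality in both orders gives `Re (C_c - C_d)ᵀ(g_c - g_d)
≥ 0`, with equality only if `g_c = g_d`. The integral of this quantity involves only differences of
equal coefficients, so it is zero; hence `g_c = g_d`, and then `C_c = C_d`, almost everywhere. -/
lemma RegularDensity.coeff_errChar_injective (hα : 1 < α) (hf : RegularDensity α f)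
    {c d : Fin (N + 1) → Fin T → ℂ}
    (h : ∀ k : Fin (N + 1), coeff k (errChar α f c) = coeff k (errChar α f d)) : c = d := by
  have hci := hf.integrable_errChar hα c
  have hdi := hf.integrable_errChar hα d
  have hi := integrable_polyC_dotProduct (c - d) (hci.sub hdi)
  have h1 : ∫ θ, (polyC (c - d) θ ⬝ᵥ (errChar α f c - errChar α f d) θ).re ∂leb = 0 := by
    refine Eq.trans (integral_re hi) ?_
    rw [integral_polyC_dotProduct _ (hci.sub hdi)]
    simp [coeff_sub _ hci hdi, h]
  have key : ∀ᵐ θ ∂leb, 0 ≤ (polyC (c - d) θ ⬝ᵥ (errChar α f c - errChar α f d) θ).re ∧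
      ((polyC (c - d) θ ⬝ᵥ (errChar α f c - errChar α f d) θ).re = 0 →
        errChar α f c θ = errChar α f d θ) := by
    filter_upwards [hf.admissible] with θ hθ
    have y1 := hθ.young hα (errChar α f c θ) (errChar α f d θ)
    have y2 := (hθ.young hα (errChar α f d θ) (errChar α f c θ)).1
    rw [errChar_eq d, hθ.mulVec_vpow_dualVec hα, ← errChar_eq, dotProduct_comm] at y1
    rw [errChar_eq c, hθ.mulVec_vpow_dualVec hα, ← errChar_eq, dotProduct_comm] at y2
    have e : (polyC (c - d) θ ⬝ᵥ (errChar α f c - errChar α f d) θ).re =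
        form α (f θ) (errChar α f c θ) + form α (f θ) (errChar α f d θ)
          - (polyC d θ ⬝ᵥ errChar α f c θ).re - (polyC c θ ⬝ᵥ errChar α f d θ).re := by
      rw [hθ.form_errChar hα, hθ.form_errChar hα, polyC_sub, Pi.sub_apply]
      simp only [sub_dotProduct, dotProduct_sub, Complex.sub_re]
      ring
    have e1 : form α (f θ) (errChar α f c θ) / α = 1 / α * form α (f θ) (errChar α f c θ) := by ring
    have e2 : form α (f θ) (errChar α f d θ) / α = 1 / α * form α (f θ) (errChar α f d θ) := by ring
    rw [e]
    refine ⟨by linarith [y1.1], fun h0 => y1.2 ?_⟩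
    linarith [y1.1]
  have h2 := (integral_eq_zero_iff_of_nonneg_ae
    (by filter_upwards [key] with θ hθ using hθ.1) hi.re).1 h1
  rw [← sub_eq_zero]
  refine eq_zero_of_polyC_ae_eq_zero ?_
  filter_upwards [key, h2, hf.admissible] with θ h3 h4 hθ
  have h5 := h3.2 h4
  rw [polyC_sub, ← hθ.mulVec_vpow_dualVec hα (polyC c θ), ← hθ.mulVec_vpow_dualVec hα (polyC d θ),
    ← errChar_eq, ← errChar_eq, h5, sub_self]

lemma RegularDensity.integrable_specChar (hα : 1 < α) (hf : RegularDensity α f)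
    (a c : Fin (N + 1) → Fin T → ℂ) : Integrable (specChar α f a c) leb :=
  (integrable_leb_of_continuous (continuous_polyA a)).sub (hf.integrable_errChar hα c)

lemma RegularDensity.coeff_specChar (hα : 1 < α) (hf : RegularDensity α f)
    (a c : Fin (N + 1) → Fin T → ℂ) (k : Fin (N + 1)) :
    coeff k (specChar α f a c) = (2 * (Real.pi : ℂ)) • a k - coeff k (errChar α f c) := by
  have : specChar α f a c = polyA a - errChar α f c := rfl
  rw [this, coeff_sub k (integrable_leb_of_continuous (continuous_polyA a))
    (hf.integrable_errChar hα c), coeff_polyA]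

lemma RegularDensity.solvesSystem_iff (hα : 1 < α) (hf : RegularDensity α f)
    (a c : Fin (N + 1) → Fin T → ℂ) :
    SolvesSystem α f a c ↔
      ∀ k : Fin (N + 1), coeff k (errChar α f c) = (2 * (Real.pi : ℂ)) • a k := by
  constructor
  · rintro ⟨-, h⟩ k
    have : coeff k (specChar α f a c) = 0 := h k
    rw [hf.coeff_specChar hα, sub_eq_zero] at this
    exact this.symm
  · intro h
    refine ⟨hf.integrable_specChar hα a c, fun k => ?_⟩
    change coeff k (specChar α f a c) = 0
    rw [hf.coeff_specChar hα, h k, sub_self]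

/-- The system of equations has exactly one solution. -/
lemma RegularDensity.existsUnique_solvesSystem (hα : 1 < α) (hf : RegularDensity α f)
    (a : Fin (N + 1) → Fin T → ℂ) : ∃! c, SolvesSystem α f a c := by
  simp only [hf.solvesSystem_iff hα]
  obtain ⟨c, hc⟩ := hf.exists_coeff_eq hα fun k => (2 * (Real.pi : ℂ)) • a k
  exact ⟨c, hc, fun d hd => hf.coeff_errChar_injective hα fun k => (hd k).trans (hc k).symm⟩

lemma RegularDensity.energy_errChar (hα : 1 < α) (hf : RegularDensity α f)
    (c : Fin (N + 1) → Fin T → ℂ) :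
    energy α f (errChar α f c) = ENNReal.ofReal (dualEnergy α f c) := by
  rw [dualEnergy, ofReal_integral_eq_lintegral_ofReal (hf.integrable_form_errChar hα c),
    energy_eq_lintegral]
  filter_upwards [hf.admissible] with θ hθ using hθ.form_nonneg hα _

lemma RegularDensity.memLN_specChar (hα : 1 < α) (hf : RegularDensity α f)
    {a c : Fin (N + 1) → Fin T → ℂ} (h : SolvesSystem α f a c) :
    MemLN α N f (specChar α f a c) := by
  have hm : AEMeasurable (specChar α f a c) leb := (hf.integrable_specChar hα a c).aemeasurable
  refine hf.memLN_of_coeff hα hm ?_ fun k => h.2 k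
  have e : specChar α f a c = polyA a + -errChar α f c := by
    rw [← sub_eq_add_neg]; rfl
  rw [e]
  refine hf.energy_add_lt_top hα (continuous_polyA a).measurable.aemeasurable
    (hf.aemeasurable_errChar c).neg (hf.energy_lt_top hα (norm_polyA_le a)) ?_
  rw [energy_neg hα, hf.energy_errChar hα]
  exact ENNReal.ofReal_lt_top

end

/-! ### Step functions and the isometry for their integrals. -/

section

variable {T : ℕ} {α : ℝ} {f : ℝ → Matrix (Fin T) (Fin T) ℂ}

/-! ### Step functions on a common partition -/

lemma exists_monotone_partition {n : ℕ} {l r : Fin n → Freq} (h : ∀ i, l i ≤ r i) :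
    ∃ (τ : ℕ → Freq) (p q : Fin n → ℕ), Monotone τ ∧ (∀ i, p i ≤ q i) ∧
      (∀ i, τ (p i) = l i) ∧ ∀ i, τ (q i) = r i := by
  classical
  -- All endpoints, sorted; `π` is added to make the set nonempty. The enumeration below is
  -- continued as a constant after its last point, so that it becomes a monotone sequence on `ℕ`.
  set s : Finset Freq := insert ⟨Real.pi, by simp [Real.pi_pos.le]⟩
    (Finset.univ.image l ∪ Finset.univ.image r) with hs
  have hpos : 0 < s.card := Finset.card_pos.2 ⟨_, Finset.mem_insert_self _ _⟩
  set e := s.orderEmbOfFin rfl with he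
  set τ : ℕ → Freq := fun i => e ⟨min i (s.card - 1), by omega⟩ with hτ
  have hmono : Monotone τ := fun i j hij => by
    refine e.monotone ?_
    rw [Fin.mk_le_mk]
    omega
  have hex : ∀ x ∈ s, ∃ i : ℕ, τ i = x := fun x hx => by
    have : x ∈ Set.range e := by rw [he, Finset.range_orderEmbOfFin]; exact hx
    obtain ⟨i, rfl⟩ := this
    refine ⟨i, ?_⟩
    simp only [hτ]
    congr 1
    ext
    simp only
    omega
  choose p hp using fun i => hex (l i) (by simp [hs])
  choose q hq using fun i => hex (r i) (by simp [hs])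
  refine ⟨τ, p, fun i => max (p i) (q i), hmono, fun i => le_max_left _ _, hp, fun i => ?_⟩
  change τ (max (p i) (q i)) = r i
  -- The indices are chosen independently and the sequence is eventually constant, so `q i < p i`
  -- may occur. Monotonicity then forces both endpoints to coincide, and the larger index still
  -- works.
  rcases le_total (p i) (q i) with hpq | hpq
  · rw [max_eq_right hpq, hq]
  · rw [max_eq_left hpq]
    refine le_antisymm ?_ ?_
    · rw [hp]; exact h i
    · rw [← hq]; exact hmono hpq

/-- The coefficients, on a refined partition, of a step function whose `j`-th interval consists of
the intervals `p j, …, q j - 1` of the partition. -/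
def refinedCoef {n : ℕ} (p q : Fin n → ℕ) (u : Fin n → Fin T → ℂ) (i : ℕ) : Fin T → ℂ :=
  ∑ j, if i ∈ Finset.Ico (p j) (q j) then u j else 0

/-- Telescoping on a common refinement. A general bilinear `B` lets one computation serve both the
values of a step function, with `x i` the indicator of `θ ≤ τ i`, and its integral, with `x i = Z (τ
i)`. -/
lemma sum_bilin_sub {E F : Type*} [AddCommGroup E] [AddCommGroup F] [Module ℂ E] [Module ℂ F]
    (B : (Fin T → ℂ) →ₗ[ℂ] E →ₗ[ℂ] F) {n : ℕ} {p q : Fin n → ℕ} (hpq : ∀ j, p j ≤ q j)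
    (u : Fin n → Fin T → ℂ) (x : ℕ → E) {m : ℕ} (hm : ∀ j, q j ≤ m) :
    ∑ j, B (u j) (x (q j) - x (p j)) =
      ∑ i ∈ Finset.range m, B (refinedCoef p q u i) (x (i + 1) - x i) := by
  have h1 : ∀ j, B (u j) (x (q j) - x (p j)) =
      ∑ i ∈ Finset.range m, B (if i ∈ Finset.Ico (p j) (q j) then u j else 0)
        (x (i + 1) - x i) := fun j => by
    have hsub : Finset.Ico (p j) (q j) ⊆ Finset.range m := fun i hi => by
      rw [Finset.mem_Ico] at hi
      rw [Finset.mem_range]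
      have := hm j
      omega
    rw [← Finset.sum_subset hsub]
    · rw [← Finset.sum_Ico_sub x (hpq j), map_sum]
      exact Finset.sum_congr rfl fun i hi => by rw [if_pos hi]
    · intro i _ hi
      rw [if_neg hi, map_zero, LinearMap.zero_apply]
  simp only [h1, refinedCoef, map_sum, LinearMap.sum_apply]
  exact Finset.sum_comm

lemma indicator_Ioc_eq {a b : ℝ} (hab : a ≤ b) (v : Fin T → ℂ) (θ : ℝ) :
    (Set.Ioc a b).indicator (fun _ => v) θ =
      ((if θ ≤ b then 1 else 0 : ℂ) - (if θ ≤ a then 1 else 0 : ℂ)) • v := by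
  by_cases h1 : θ ≤ a
  · simp [h1, h1.trans hab]
  · by_cases h2 : θ ≤ b
    · simp [h1, h2, Set.indicator, not_le.1 h1]
    · simp [h1, h2, Set.indicator]

lemma StepFn.toFun_eq_sum (S : StepFn T) {τ : ℕ → Freq} {p q : Fin S.n → ℕ} (hτ : Monotone τ)
    (hpq : ∀ j, p j ≤ q j) (hp : ∀ j, τ (p j) = S.left j) (hq : ∀ j, τ (q j) = S.right j)
    {m : ℕ} (hm : ∀ j, q j ≤ m) (θ : ℝ) :
    S.toFun θ = ∑ i ∈ Finset.range m,
      (Set.Ioc (τ i : ℝ) (τ (i + 1) : ℝ)).indicator (fun _ => refinedCoef p q S.coef i) θ := by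
  have h := sum_bilin_sub (LinearMap.lsmul ℂ (Fin T → ℂ)).flip hpq S.coef
    (fun i => if θ ≤ (τ i : ℝ) then (1 : ℂ) else 0) hm
  simp only [LinearMap.flip_apply, LinearMap.lsmul_apply] at h
  rw [StepFn.toFun]
  have e1 : ∀ j, (Set.Ioc (S.left j : ℝ) (S.right j : ℝ)).indicator (fun _ => S.coef j) θ =
      ((if θ ≤ (τ (q j) : ℝ) then 1 else 0 : ℂ) - (if θ ≤ (τ (p j) : ℝ) then 1 else 0 : ℂ)) •
        S.coef j := fun j => by
    rw [indicator_Ioc_eq (S.le j), hp, hq]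
  simp only [e1]
  rw [h]
  exact Finset.sum_congr rfl fun i _ => (indicator_Ioc_eq (hτ i.le_succ) _ _).symm

variable {Ω : Type*} {Z : Freq → Ω → (Fin T → ℂ)}

lemma StepFn.integral_eq_sum (S : StepFn T) {τ : ℕ → Freq} {p q : Fin S.n → ℕ}
    (hpq : ∀ j, p j ≤ q j) (hp : ∀ j, τ (p j) = S.left j) (hq : ∀ j, τ (q j) = S.right j)
    {m : ℕ} (hm : ∀ j, q j ≤ m) (ω : Ω) :
    S.integral Z ω = ∑ i ∈ Finset.range m,
      refinedCoef p q S.coef i ⬝ᵥ (Z (τ (i + 1)) ω - Z (τ i) ω) := by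
  have h := sum_bilin_sub (LinearMap.mk₂ ℂ (fun v w : Fin T → ℂ => v ⬝ᵥ w) add_dotProduct
    smul_dotProduct dotProduct_add (fun c v w => dotProduct_smul c v w)) hpq S.coef
    (fun i => Z (τ i) ω) hm
  simp only [LinearMap.mk₂_apply, hp, hq] at h
  exact h

/-- The intervals are disjoint, so at most one term is active and the nonlinear form passes through
the sum. -/
lemma form_sum_indicator {τ : ℕ → Freq} (hτ : Monotone τ) (w : ℕ → Fin T → ℂ) (m : ℕ)
    (F : Matrix (Fin T) (Fin T) ℂ) (θ : ℝ) :
    ENNReal.ofReal (form α F (∑ i ∈ Finset.range m,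
      (Set.Ioc (τ i : ℝ) (τ (i + 1) : ℝ)).indicator (fun _ => w i) θ)) =
    ∑ i ∈ Finset.range m, (Set.Ioc (τ i : ℝ) (τ (i + 1) : ℝ)).indicator
      (fun _ => ENNReal.ofReal (form α F (w i))) θ := by
  have hdis : ∀ i j, θ ∈ Set.Ioc (τ i : ℝ) (τ (i + 1) : ℝ) →
      θ ∈ Set.Ioc (τ j : ℝ) (τ (j + 1) : ℝ) → i = j := by
    intro i j hi hj
    by_contra hij
    have hτ' : Monotone fun i => (τ i : ℝ) := fun i j h => hτ h
    exact Set.disjoint_left.1 (hτ'.pairwise_disjoint_on_Ioc_succ hij) hi hj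
  by_cases h : ∃ i ∈ Finset.range m, θ ∈ Set.Ioc (τ i : ℝ) (τ (i + 1) : ℝ)
  · obtain ⟨i, him, hi⟩ := h
    rw [Finset.sum_eq_single_of_mem i him, Finset.sum_eq_single_of_mem i him,
      Set.indicator_of_mem hi, Set.indicator_of_mem hi]
    · exact fun j _ hj => Set.indicator_of_notMem (fun h' => hj (hdis j i h' hi)) _
    · exact fun j _ hj => Set.indicator_of_notMem (fun h' => hj (hdis j i h' hi)) _
  · push Not at h
    rw [Finset.sum_eq_zero fun i hi => Set.indicator_of_notMem (h i hi) _,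
      Finset.sum_eq_zero fun i hi => Set.indicator_of_notMem (h i hi) _, form_zero,
      ENNReal.ofReal_zero]

/-! ### Algebra of step functions -/

/-- The sum of two step functions. -/
def StepFn.add (S R : StepFn T) : StepFn T where
  n := S.n + R.n
  left := Fin.append S.left R.left
  right := Fin.append S.right R.right
  le := fun i => by
    refine Fin.addCases (fun i => ?_) (fun i => ?_) i
    · simpa using S.le i
    · simpa using R.le i
  coef := Fin.append S.coef R.coef

/-- A multiple of a step function. -/
def StepFn.smul (c : ℂ) (S : StepFn T) : StepFn T := { S with coef := fun i => c • S.coef i }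

lemma StepFn.toFun_add (S R : StepFn T) : (S.add R).toFun = S.toFun + R.toFun := by
  funext θ
  refine (Fin.sum_univ_add _).trans ?_
  simp [StepFn.toFun, StepFn.add]

lemma StepFn.integral_add (S R : StepFn T) :
    (S.add R).integral Z = S.integral Z + R.integral Z := by
  funext ω
  refine (Fin.sum_univ_add _).trans ?_
  simp [StepFn.integral, StepFn.add]

lemma StepFn.toFun_smul (c : ℂ) (S : StepFn T) : (S.smul c).toFun = c • S.toFun := by
  funext θ
  simp only [StepFn.toFun, StepFn.smul, Pi.smul_apply, Finset.smul_sum]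
  exact Finset.sum_congr rfl fun i _ => Set.indicator_const_smul_apply _ _ _ _

lemma StepFn.integral_smul (c : ℂ) (S : StepFn T) :
    (S.smul c).integral Z = c • S.integral Z := by
  funext ω
  simp only [StepFn.integral, StepFn.smul, Pi.smul_apply, Finset.smul_sum, smul_dotProduct]
  rfl

/-! ### The isometry for step functions -/

variable [MeasurableSpace Ω] {P : Measure Ω}

/-- The integral of `wᵀ f w^{<α-1>}` over an interval is the scale of the increment of `wᵀ Z`. -/
lemma HasSpectralDensity.hasScale_increment [IsProbabilityMeasure P] (hα : 1 < α)
    (hZ : HasSpectralDensity P α Z f) (hf : RegularDensity α f) {s t : Freq} (hst : s ≤ t)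
    (w : Fin T → ℂ) :
    HasScale P α (fun ω => w ⬝ᵥ (Z t ω - Z s ω))
      (∫⁻ θ in Set.Ioc (s : ℝ) (t : ℝ), ENNReal.ofReal (form α (f θ) w) ∂leb).toReal := by
  have hsub : Set.Ioc (s : ℝ) (t : ℝ) ⊆ Set.Ioc (-Real.pi) Real.pi :=
    Set.Ioc_subset_Ioc s.2.1 t.2.2
  have hr : leb.restrict (Set.Ioc (s : ℝ) (t : ℝ)) = volume.restrict (Set.Ioc (s : ℝ) (t : ℝ)) := by
    rw [leb, Measure.restrict_restrict measurableSet_Ioc, Set.inter_eq_left.2 hsub]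
  have hi : ∀ k l, Integrable (fun θ => f θ k l) (leb.restrict (Set.Ioc (s : ℝ) (t : ℝ))) :=
    fun k l => (hf.integrable k l).mono_measure Measure.restrict_le_self
  have hint : Integrable (fun θ => w ⬝ᵥ (f θ *ᵥ vpow (α - 1) w))
      (leb.restrict (Set.Ioc (s : ℝ) (t : ℝ))) := by
    simp only [dotProduct, mulVec]
    exact integrable_finsetSum _ fun k _ => (integrable_finsetSum _ fun l _ =>
      (hi k l).mul_const _).const_mul _
  have h1 := ((hZ.2 s t hst w w).hasScale hα).1
  convert h1 using 1
  rw [← integral_toReal]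
  · have e1 : ∫ θ in Set.Ioc (s : ℝ) (t : ℝ), (ENNReal.ofReal (form α (f θ) w)).toReal ∂leb =
        ∫ θ in Set.Ioc (s : ℝ) (t : ℝ), RCLike.re (w ⬝ᵥ (f θ *ᵥ vpow (α - 1) w)) ∂leb := by
      refine integral_congr_ae ?_
      filter_upwards [ae_restrict_of_ae hf.admissible] with θ hθ
      exact ENNReal.toReal_ofReal (hθ.form_nonneg hα w)
    rw [e1, integral_re hint, RCLike.re_eq_complex_re]
    congr 1
    simp only [dotProduct, mulVec]
    rw [integral_finsetSum _ fun k _ => (integrable_finsetSum _ fun l _ =>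
      (hi k l).mul_const _).const_mul _]
    refine Finset.sum_congr rfl fun k _ => ?_
    rw [integral_const_mul, integral_finsetSum _ fun l _ => (hi k l).mul_const _, Finset.mul_sum]
    refine Finset.sum_congr rfl fun l _ => ?_
    rw [integral_mul_const, hr, intervalIntegral.integral_of_le (by exact_mod_cast hst), mul_assoc]
  · exact (hf.aemeasurable_form aemeasurable_const).ennreal_ofReal.restrict
  · exact ae_of_all _ fun θ => ENNReal.ofReal_lt_top

lemma StepFn.measurable_toFun (S : StepFn T) : Measurable S.toFun := by
  unfold StepFn.toFun
  exact Finset.measurable_fun_sum _ fun i _ => measurable_const.indicator measurableSet_Ioc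

lemma StepFn.norm_toFun_le (S : StepFn T) (θ : ℝ) : ‖S.toFun θ‖ ≤ ∑ i, ‖S.coef i‖ :=
  (norm_sum_le _ _).trans (Finset.sum_le_sum fun _ _ => norm_indicator_le_norm_self _ _)

lemma RegularDensity.energy_stepFn_lt_top (hα : 1 < α) (hf : RegularDensity α f) (S : StepFn T) :
    energy α f S.toFun < ⊤ := hf.energy_lt_top hα S.norm_toFun_le

/-- The integral of a step function is symmetric `α`-stable, with scale the energy of the step
function. -/
lemma StepFn.hasScale_integral [IsProbabilityMeasure P] (hα : 1 < α)
    (hZ : HasSpectralDensity P α Z f) (hind : HasIndepIncrements Z P) (hf : RegularDensity α f)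
    (S : StepFn T) : HasScale P α (S.integral Z) (energy α f S.toFun).toReal := by
  obtain ⟨τ, p, q, hτ, hpq, hp, hq⟩ := exists_monotone_partition S.le
  have hm : ∀ j, q j ≤ ∑ j, q j := fun j =>
    Finset.single_le_sum (f := q) (fun _ _ => Nat.zero_le _) (Finset.mem_univ j)
  set m := ∑ j, q j
  set w := refinedCoef p q S.coef
  have hI : S.integral Z = ∑ i ∈ Finset.range m,
      fun ω => w i ⬝ᵥ (Z (τ (i + 1)) ω - Z (τ i) ω) := by
    funext ω
    rw [S.integral_eq_sum hpq hp hq hm, Finset.sum_apply]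
  have hE : energy α f S.toFun = ∑ i ∈ Finset.range m,
      ∫⁻ θ in Set.Ioc (τ i : ℝ) (τ (i + 1) : ℝ), ENNReal.ofReal (form α (f θ) (w i)) ∂leb := by
    rw [energy_eq_lintegral]
    simp only [S.toFun_eq_sum hτ hpq hp hq hm, form_sum_indicator hτ]
    rw [lintegral_finsetSum']
    · refine Finset.sum_congr rfl fun i _ => ?_
      rw [← lintegral_indicator measurableSet_Ioc]
      rfl
    · intro i _
      exact ((hf.aemeasurable_form aemeasurable_const).ennreal_ofReal).indicator measurableSet_Ioc
  have hfin := hf.energy_stepFn_lt_top hα S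
  rw [hE, ENNReal.sum_lt_top] at hfin
  rw [hI, hE, ENNReal.toReal_sum fun i hi => (hfin i hi).ne]
  refine HasScale.sum hα (fun i => hZ.hasScale_increment hα hf (hτ i.le_succ) (w i)) ?_ _
  -- Increments of `Z` along a monotone sequence are independent, so the scales of the summands add
  -- up to the energy.
  exact (hind.nat hτ).comp (fun i v => w i ⬝ᵥ v) fun i =>
    (continuous_const.dotProduct continuous_id).measurable

end

/-! ### Stochastic integrals as an isometric image of `L^α(μ)`. -/

section

variable {T N : ℕ} {α : ℝ} {f : ℝ → Matrix (Fin T) (Fin T) ℂ}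
  {Ω : Type*} [MeasurableSpace Ω] {P : Measure Ω} {Z : Freq → Ω → (Fin T → ℂ)}

/-! ### Convergence in measure -/

lemma tendstoInMeasure_add {ι : Type*} {l : Filter ι} {X Y : ι → Ω → ℂ} {x y : Ω → ℂ}
    (hX : TendstoInMeasure P X l x) (hY : TendstoInMeasure P Y l y) :
    TendstoInMeasure P (fun i => X i + Y i) l (x + y) := by
  rw [tendstoInMeasure_iff_norm] at hX hY ⊢
  intro ε hε
  have h := (hX (ε / 2) (by positivity)).add (hY (ε / 2) (by positivity))
  rw [add_zero] at h
  refine tendsto_of_tendsto_of_tendsto_of_le_of_le tendsto_const_nhds h (fun _ => zero_le)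
    fun i => (measure_mono fun ω hω => ?_).trans (measure_union_le _ _)
  simp only [Set.mem_ofPred_eq, Set.mem_union, Pi.add_apply] at hω ⊢
  by_contra! hcon
  have : X i ω + Y i ω - (x ω + y ω) = (X i ω - x ω) + (Y i ω - y ω) := by ring
  rw [this] at hω
  linarith [norm_add_le (X i ω - x ω) (Y i ω - y ω)]

lemma tendstoInMeasure_smul {ι : Type*} {l : Filter ι} {X : ι → Ω → ℂ} {x : Ω → ℂ} (c : ℂ)
    (hX : TendstoInMeasure P X l x) : TendstoInMeasure P (fun i => c • X i) l (c • x) := by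
  rw [tendstoInMeasure_iff_norm] at hX ⊢
  intro ε hε
  refine tendsto_of_tendsto_of_tendsto_of_le_of_le tendsto_const_nhds
    (hX (ε / (‖c‖ + 1)) (by positivity)) (fun _ => zero_le) fun i => measure_mono fun ω hω => ?_
  simp only [Set.mem_ofPred_eq, Pi.smul_apply] at hω ⊢
  rw [← smul_sub, norm_smul] at hω
  rw [div_le_iff₀ (by positivity)]
  nlinarith [norm_nonneg (X i ω - x ω)]

lemma tendstoInMeasure_sub {ι : Type*} {l : Filter ι} {X Y : ι → Ω → ℂ} {x y : Ω → ℂ}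
    (hX : TendstoInMeasure P X l x) (hY : TendstoInMeasure P Y l y) :
    TendstoInMeasure P (fun i => X i - Y i) l (x - y) := by
  have := tendstoInMeasure_add hX (tendstoInMeasure_smul (-1) hY)
  simpa only [neg_smul, one_smul, ← sub_eq_add_neg] using this

/-- Convergence in probability is complete. -/
lemma exists_tendstoInMeasure [IsProbabilityMeasure P] {X : ℕ → Ω → ℂ}
    (hm : ∀ n, AEMeasurable (X n) P)
    (h : TendstoInMeasure P (fun p : ℕ × ℕ => X p.1 - X p.2) (atTop ×ˢ atTop) (fun _ => 0)) :
    ∃ Y, TendstoInMeasure P X atTop Y := by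
  have hc : ∀ k : ℕ, ∃ M : ℕ, ∀ n m, M ≤ n → M ≤ m →
      P {ω | (1 / 2 : ℝ) ^ k ≤ ‖X n ω - X m ω‖} ≤ (2⁻¹ : ℝ≥0∞) ^ k := fun k => by
    rw [tendstoInMeasure_iff_norm] at h
    have h1 := (h ((1 / 2 : ℝ) ^ k) (by positivity)).eventually
      (ge_mem_nhds (ENNReal.pow_pos (by simp : (0 : ℝ≥0∞) < 2⁻¹) k))
    rw [prod_atTop_atTop_eq, eventually_atTop] at h1
    obtain ⟨⟨M, M'⟩, hM⟩ := h1
    refine ⟨max M M', fun n m hn hm => ?_⟩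
    simpa using hM (n, m) ⟨(le_max_left _ _).trans hn, (le_max_right _ _).trans hm⟩
  choose M hM using hc
  set φ : ℕ → ℕ := fun k => k + ∑ j ∈ Finset.range (k + 1), M j with hφ
  have hφM : ∀ k, M k ≤ φ k := fun k =>
    (Finset.single_le_sum (f := M) (fun _ _ => Nat.zero_le _) (by simp)).trans
      (Nat.le_add_left _ _)
  have hφmono : ∀ k, φ k ≤ φ (k + 1) := fun k => by
    simp only [hφ, Finset.sum_range_succ]; omega
  have hφt : Tendsto φ atTop atTop :=
    tendsto_atTop_mono (fun k => Nat.le_add_right k _) tendsto_id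
  -- Borel–Cantelli: along `φ` consecutive differences exceed `2^{-k}` only finitely often, so the
  -- subsequence converges almost surely.
  have hBC : ∀ᵐ ω ∂P, ∀ᶠ k in atTop,
      ω ∉ {ω | (1 / 2 : ℝ) ^ k ≤ ‖X (φ k) ω - X (φ (k + 1)) ω‖} := by
    refine ae_eventually_notMem (ne_top_of_le_ne_top ?_ (ENNReal.tsum_le_tsum fun k =>
      hM k _ _ (hφM k) ((hφM k).trans (hφmono k))))
    rw [ENNReal.tsum_geometric]
    simp
  have hlim : ∀ᵐ ω ∂P, ∃ y, Tendsto (fun k => X (φ k) ω) atTop (𝓝 y) := by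
    filter_upwards [hBC] with ω hω
    refine cauchySeq_tendsto_of_complete (cauchySeq_of_summable_dist ?_)
    refine Summable.of_norm_bounded_eventually_nat (g := fun k => (1 / 2 : ℝ) ^ k)
      summable_geometric_two ?_
    filter_upwards [hω] with k hk
    simp only [not_le] at hk
    rw [Real.norm_of_nonneg dist_nonneg, dist_eq_norm]
    exact hk.le
  refine ⟨fun ω => limUnder atTop fun k => X (φ k) ω, ?_⟩
  have h1 : TendstoInMeasure P (fun k => X (φ k)) atTop
      (fun ω => limUnder atTop fun k => X (φ k) ω) := by
    refine tendstoInMeasure_of_tendsto_ae (fun k => (hm _).aestronglyMeasurable) ?_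
    filter_upwards [hlim] with ω hω
    exact tendsto_nhds_limUnder hω
  -- The full sequence is the subsequence plus `X n - X (φ n)`, which tends to `0` by the Cauchy
  -- property.
  have h2 := tendstoInMeasure_add (h.comp (ns := fun n : ℕ => (n, φ n))
    (tendsto_id.prodMk hφt)) h1
  convert h2 using 1
  · funext n; simp
  · funext ω; simp

/-! ### Stochastic integrals -/

/-- `Z` has independent increments and spectral density `f`, which is regular. -/
structure IsSpectralProcess (P : Measure Ω) (α : ℝ) (Z : Freq → Ω → (Fin T → ℂ))
    (f : ℝ → Matrix (Fin T) (Fin T) ℂ) : Prop where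
  indep : HasIndepIncrements Z P
  density : HasSpectralDensity P α Z f
  regular : RegularDensity α f

lemma StepFn.aemeasurable_toFun (S : StepFn T) : AEMeasurable S.toFun leb :=
  S.measurable_toFun.aemeasurable

lemma RegularDensity.energy_lt_top_of_isStochIntegral (hα : 1 < α) (hf : RegularDensity α f)
    {a : ℝ → Fin T → ℂ} {X : Ω → ℂ} (h : IsStochIntegral P α Z f a X) : energy α f a < ⊤ := by
  obtain ⟨hm, S, hS, -⟩ := h
  obtain ⟨n, hn⟩ := (hS.eventually (gt_mem_nhds ENNReal.zero_lt_top)).exists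
  have e : a = (fun θ => a θ - (S n).toFun θ) + (S n).toFun := by funext θ; simp
  rw [e]
  exact hf.energy_add_lt_top hα (hm.sub (S n).aemeasurable_toFun) (S n).aemeasurable_toFun hn
    (hf.energy_stepFn_lt_top hα _)

/-- The isometry: it holds for step functions, and both the scale and the energy are continuous
along the defining approximation. -/
lemma IsSpectralProcess.hasScale [IsProbabilityMeasure P] (hα : 1 < α)
    (hZ : IsSpectralProcess P α Z f) {a : ℝ → Fin T → ℂ} {X : Ω → ℂ}
    (h : IsStochIntegral P α Z f a X) : HasScale P α X (energy α f a).toReal := by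
  have hfin := hZ.regular.energy_lt_top_of_isStochIntegral hα h
  obtain ⟨hm, S, hS, hX⟩ := h
  refine HasScale.of_tendstoInMeasure hα
    (fun n => (S n).hasScale_integral hα hZ.density hZ.indep hZ.regular) hX ?_
  exact (ENNReal.tendsto_toReal hfin.ne).comp
    (hZ.regular.tendsto_energy hα (fun n => (S n).aemeasurable_toFun) hm hfin hS)

lemma IsStochIntegral.zero : IsStochIntegral P α Z f 0 0 := by
  refine ⟨aemeasurable_const,
    fun _ => ⟨0, Fin.elim0, Fin.elim0, fun i => i.elim0, Fin.elim0⟩, ?_, ?_⟩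
  · have e : ∀ θ, (⟨0, Fin.elim0, Fin.elim0, fun i => i.elim0, Fin.elim0⟩ : StepFn T).toFun θ = 0 :=
      fun θ => by simp [StepFn.toFun]
    simp only [e, Pi.zero_apply, sub_zero]
    have := energy_zero (α := α) (f := f)
    exact tendsto_const_nhds.congr fun _ => this.symm
  · have e : (⟨0, Fin.elim0, Fin.elim0, fun i => i.elim0, Fin.elim0⟩ : StepFn T).integral Z =
      (0 : Ω → ℂ) := by funext ω; simp [StepFn.integral]
    simp only [e]
    intro ε hε
    simp [hε.ne']

lemma RegularDensity.isStochIntegral_add (hα : 1 < α) (hf : RegularDensity α f)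
    {a b : ℝ → Fin T → ℂ} {X Y : Ω → ℂ} (ha : IsStochIntegral P α Z f a X)
    (hb : IsStochIntegral P α Z f b Y) : IsStochIntegral P α Z f (a + b) (X + Y) := by
  obtain ⟨ham, S, hS, hX⟩ := ha
  obtain ⟨hbm, R, hR, hY⟩ := hb
  refine ⟨ham.add hbm, fun n => (S n).add (R n), ?_, ?_⟩
  · refine (hf.tendsto_energy_add hα (fun n => ham.sub (S n).aemeasurable_toFun)
      (fun n => hbm.sub (R n).aemeasurable_toFun) hS hR).congr fun n => ?_
    congr 1
    funext θ
    rw [StepFn.toFun_add]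
    simp only [Pi.add_apply, Pi.sub_apply]
    abel
  · simp only [StepFn.integral_add]
    exact tendstoInMeasure_add hX hY

lemma IsStochIntegral.smul (hα : 1 < α) {a : ℝ → Fin T → ℂ} {X : Ω → ℂ} (c : ℂ)
    (ha : IsStochIntegral P α Z f a X) : IsStochIntegral P α Z f (c • a) (c • X) := by
  obtain ⟨ham, S, hS, hX⟩ := ha
  refine ⟨ham.const_smul c, fun n => (S n).smul c, ?_, ?_⟩
  · have e : ∀ n, (fun θ => (c • a) θ - ((S n).smul c).toFun θ) =
        c • fun θ => a θ - (S n).toFun θ := fun n => by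
      funext θ
      rw [StepFn.toFun_smul]
      simp only [Pi.smul_apply, smul_sub]
    simp only [e, energy_smul hα]
    simpa using ENNReal.Tendsto.const_mul hS (Or.inr ENNReal.ofReal_ne_top)
  · simp only [StepFn.integral_smul]
    exact tendstoInMeasure_smul c hX

lemma RegularDensity.isStochIntegral_sub (hα : 1 < α) (hf : RegularDensity α f)
    {a b : ℝ → Fin T → ℂ} {X Y : Ω → ℂ} (ha : IsStochIntegral P α Z f a X)
    (hb : IsStochIntegral P α Z f b Y) : IsStochIntegral P α Z f (a - b) (X - Y) := by
  have := hf.isStochIntegral_add hα ha (hb.smul hα (-1))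
  simpa only [neg_smul, one_smul, ← sub_eq_add_neg] using this

lemma RegularDensity.isStochIntegral_sum (hα : 1 < α) (hf : RegularDensity α f) {ι : Type*}
    (s : Finset ι) {a : ι → ℝ → Fin T → ℂ} {X : ι → Ω → ℂ}
    (h : ∀ i, IsStochIntegral P α Z f (a i) (X i)) :
    IsStochIntegral P α Z f (∑ i ∈ s, a i) (∑ i ∈ s, X i) := by
  classical
  induction s using Finset.induction_on with
  | empty => simpa using! IsStochIntegral.zero
  | insert i s hi ih =>
    rw [Finset.sum_insert hi, Finset.sum_insert hi]
    exact hf.isStochIntegral_add hα (h i) ih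

/-- Limits of stochastic integrals are stochastic integrals. -/
lemma RegularDensity.isStochIntegral_of_tendsto [IsProbabilityMeasure P] (hα : 1 < α)
    (hf : RegularDensity α f) {a : ℕ → ℝ → Fin T → ℂ} {X : ℕ → Ω → ℂ} {b : ℝ → Fin T → ℂ}
    {Y : Ω → ℂ} (h : ∀ n, IsStochIntegral P α Z f (a n) (X n)) (hb : AEMeasurable b leb)
    (hab : Tendsto (fun n => energy α f (b - a n)) atTop (𝓝 0))
    (hXY : TendstoInMeasure P X atTop Y) : IsStochIntegral P α Z f b Y := by
  -- Diagonal choice: for each `n` one step function that is close to `a n` in energy and whose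
  -- integral is close to `X n` in probability.
  have hex : ∀ n : ℕ, ∃ S : StepFn T, energy α f (fun θ => a n θ - S.toFun θ) < ((n : ℝ≥0∞) + 1)⁻¹ ∧
      P {ω | 1 / ((n : ℝ) + 1) ≤ ‖S.integral Z ω - X n ω‖} < ((n : ℝ≥0∞) + 1)⁻¹ := fun n => by
    obtain ⟨-, S, hS, hX⟩ := h n
    have hpos : (0 : ℝ≥0∞) < ((n : ℝ≥0∞) + 1)⁻¹ := by simp
    rw [tendstoInMeasure_iff_norm] at hX
    obtain ⟨k, hk⟩ := ((hS.eventually (gt_mem_nhds hpos)).and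
      ((hX (1 / ((n : ℝ) + 1)) (by positivity)).eventually (gt_mem_nhds hpos))).exists
    exact ⟨S k, hk⟩
  choose S hS hS' using hex
  have hinv : Tendsto (fun n : ℕ => ((n : ℝ≥0∞) + 1)⁻¹) atTop (𝓝 0) := by
    have := (tendsto_add_atTop_iff_nat 1).2 ENNReal.tendsto_inv_nat_nhds_zero
    simpa using this
  refine ⟨hb, S, ?_, ?_⟩
  · have h1 : Tendsto (fun n => energy α f (fun θ => a n θ - (S n).toFun θ)) atTop (𝓝 0) :=
      tendsto_of_tendsto_of_tendsto_of_le_of_le tendsto_const_nhds hinv (fun _ => zero_le)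
        fun n => (hS n).le
    refine (hf.tendsto_energy_add hα (fun n => hb.sub (h n).1)
      (fun n => (h n).1.sub (S n).aemeasurable_toFun) hab h1).congr fun n => ?_
    congr 1
    funext θ
    simp
  · have h1 : TendstoInMeasure P (fun n => (S n).integral Z - X n) atTop (fun _ => 0) := by
      rw [tendstoInMeasure_iff_norm]
      intro ε hε
      refine tendsto_of_tendsto_of_tendsto_of_le_of_le' tendsto_const_nhds hinv
        (Eventually.of_forall fun _ => zero_le) ?_
      filter_upwards [tendsto_one_div_add_atTop_nhds_zero_nat.eventually (gt_mem_nhds hε)] with n hn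
      refine (measure_mono fun ω hω => ?_).trans (hS' n).le
      simp only [Set.mem_ofPred_eq, Pi.sub_apply, sub_zero] at hω ⊢
      exact hn.le.trans hω
    have h2 := tendstoInMeasure_add h1 hXY
    convert h2 using 1
    · funext n; simp
    · funext ω; simp

lemma RegularDensity.tendsto_energy_sub_prod (hα : 1 < α) (hf : RegularDensity α f)
    {a : ℕ → ℝ → Fin T → ℂ} {b : ℝ → Fin T → ℂ} (ha : ∀ n, AEMeasurable (a n) leb)
    (hb : AEMeasurable b leb) (hab : Tendsto (fun n => energy α f (b - a n)) atTop (𝓝 0)) :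
    Tendsto (fun p : ℕ × ℕ => energy α f (a p.1 - a p.2)) (atTop ×ˢ atTop) (𝓝 0) := by
  have h1 : Tendsto (fun p : ℕ × ℕ => energy α f (a p.1 - b)) (atTop ×ˢ atTop) (𝓝 0) := by
    simp only [energy_sub_comm hα _ b]
    exact hab.comp tendsto_fst
  refine (hf.tendsto_energy_add hα (fun p : ℕ × ℕ => (ha p.1).sub hb)
    (fun p : ℕ × ℕ => hb.sub (ha p.2)) h1 (hab.comp tendsto_snd)).congr fun p => ?_
  rw [sub_add_sub_cancel]

/-- Convergence in energy makes the scales of the differences tend to `0`; the integrals are then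
Cauchy in probability and have a limit. -/
lemma IsSpectralProcess.exists_isStochIntegral [IsProbabilityMeasure P] (hα : 1 < α)
    (hZ : IsSpectralProcess P α Z f) {a : ℕ → ℝ → Fin T → ℂ} {X : ℕ → Ω → ℂ} {b : ℝ → Fin T → ℂ}
    (h : ∀ n, IsStochIntegral P α Z f (a n) (X n)) (hb : AEMeasurable b leb)
    (hab : Tendsto (fun n => energy α f (b - a n)) atTop (𝓝 0)) :
    ∃ Y, IsStochIntegral P α Z f b Y := by
  have hE := hZ.regular.tendsto_energy_sub_prod hα (fun n => (h n).1) hb hab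
  have h1 : TendstoInMeasure P (fun p : ℕ × ℕ => X p.1 - X p.2) (atTop ×ˢ atTop) (fun _ => 0) := by
    refine tendstoInMeasure_zero_of_hasScale hα (fun p : ℕ × ℕ =>
      hZ.hasScale hα (hZ.regular.isStochIntegral_sub hα (h p.1) (h p.2))) ?_
    exact (ENNReal.tendsto_toReal ENNReal.zero_ne_top).comp hE
  obtain ⟨Y, hY⟩ := exists_tendstoInMeasure (fun n => (hZ.hasScale hα (h n)).aemeasurable) h1
  exact ⟨Y, hZ.regular.isStochIntegral_of_tendsto hα h hb hab hY⟩

/-- The converse passage: convergence in probability forces the scales of the differences, which are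
energies, to `0`, and completeness of `L^α(μ)` supplies the integrand. -/
lemma IsSpectralProcess.exists_of_tendstoInMeasure [IsProbabilityMeasure P] (hα : 1 < α)
    (hα' : α ≤ 2) (hZ : IsSpectralProcess P α Z f) {a : ℕ → ℝ → Fin T → ℂ} {X : ℕ → Ω → ℂ}
    {Y : Ω → ℂ} (h : ∀ n, IsStochIntegral P α Z f (a n) (X n))
    (hXY : TendstoInMeasure P X atTop Y) :
    ∃ b : ℝ → Fin T → ℂ, Tendsto (fun n => energy α f (b - a n)) atTop (𝓝 0) ∧
      IsStochIntegral P α Z f b Y := by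
  have h1 : TendstoInMeasure P (fun p : ℕ × ℕ => X p.1 - X p.2) (atTop ×ˢ atTop) (fun _ => 0) := by
    have := tendstoInMeasure_sub (hXY.comp (tendsto_fst (f := atTop) (g := (atTop : Filter ℕ))))
      (hXY.comp (tendsto_snd (f := (atTop : Filter ℕ)) (g := atTop)))
    rw [sub_self] at this
    exact this
  have hs := fun p : ℕ × ℕ => hZ.regular.isStochIntegral_sub hα (h p.1) (h p.2)
  have h2 := tendsto_scale_zero hα hα' (fun p : ℕ × ℕ => hZ.hasScale hα (hs p)) h1
  have h3 : Tendsto (fun p : ℕ × ℕ => energy α f (a p.1 - a p.2)) (atTop ×ˢ atTop) (𝓝 0) := by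
    rw [← ENNReal.ofReal_zero]
    refine (ENNReal.tendsto_ofReal h2).congr fun p => ENNReal.ofReal_toReal ?_
    exact (hZ.regular.energy_lt_top_of_isStochIntegral hα (hs p)).ne
  obtain ⟨b, hb, hab⟩ := hZ.regular.exists_tendsto_energy hα (fun n => (h n).1) h3
  exact ⟨b, hab, hZ.regular.isStochIntegral_of_tendsto hα h hb hab hXY⟩

lemma IsSpectralProcess.ae_eq_of_isStochIntegral [IsProbabilityMeasure P] (hα : 1 < α)
    (hZ : IsSpectralProcess P α Z f) {a b : ℝ → Fin T → ℂ} {X Y : Ω → ℂ} (hab : a =ᵐ[leb] b)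
    (ha : IsStochIntegral P α Z f a X) (hb : IsStochIntegral P α Z f b Y) : X =ᵐ[P] Y := by
  have h1 := hZ.hasScale hα (hZ.regular.isStochIntegral_sub hα ha hb)
  have h2 : energy α f (a - b) = 0 := by
    rw [energy_congr (b := 0), energy_zero]
    filter_upwards [hab] with θ hθ
    simp [hθ]
  rw [h2, ENNReal.toReal_zero] at h1
  have h3 := tendstoInMeasure_zero_of_hasScale hα (l := (atTop : Filter ℕ)) (fun _ => h1)
    tendsto_const_nhds
  have h4 : TendstoInMeasure P (fun _ : ℕ => X - Y) atTop (X - Y) := fun ε hε => by simp [hε.ne']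
  filter_upwards [tendstoInMeasure_ae_unique h3 h4] with ω hω
  exact sub_eq_zero.1 hω.symm

/-- The zero variable `X - X` is the integral of `a - b`, so that difference has zero energy. -/
lemma IsSpectralProcess.ae_eq_of_isStochIntegral_right [IsProbabilityMeasure P] (hα : 1 < α)
    (hZ : IsSpectralProcess P α Z f) {a b : ℝ → Fin T → ℂ} {X : Ω → ℂ}
    (ha : IsStochIntegral P α Z f a X) (hb : IsStochIntegral P α Z f b X) : a =ᵐ[leb] b := by
  have h0 := hZ.regular.isStochIntegral_sub hα ha hb
  have h1 := hZ.hasScale hα h0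
  rw [sub_self] at h1
  have h2 := h1.unique hα hasScale_zero
  rw [ENNReal.toReal_eq_zero_iff] at h2
  have h3 := hZ.regular.energy_eq_zero hα h0.1
    (h2.resolve_right (hZ.regular.energy_lt_top_of_isStochIntegral hα h0).ne)
  filter_upwards [h3] with θ hθ
  exact sub_eq_zero.1 hθ

lemma IsStochIntegral.congr {a b : ℝ → Fin T → ℂ} {X : Ω → ℂ} (h : IsStochIntegral P α Z f a X)
    (hab : a =ᵐ[leb] b) : IsStochIntegral P α Z f b X := by
  obtain ⟨hm, S, hS, hX⟩ := h
  refine ⟨hm.congr hab, S, hS.congr fun n => energy_congr ?_, hX⟩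
  filter_upwards [hab] with θ hθ
  rw [hθ]

end

/-! ### The extremal problem in `L^α(μ)` and its transfer to the observed values. -/

section

variable {T N : ℕ} {α : ℝ} {f : ℝ → Matrix (Fin T) (Fin T) ℂ}

/-! ### The extremal problem in `L^α(μ)` -/

lemma norm_expVec_le (j : ℤ) (k : Fin T) (θ : ℝ) : ‖expVec j k θ‖ ≤ 1 := by
  rw [expVec, Pi.norm_single]
  have : Complex.I * (j : ℂ) * (θ : ℂ) = Complex.I * ((j * θ : ℝ) : ℂ) := by push_cast; ring
  rw [this, Complex.norm_exp_I_mul_ofReal]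

lemma aemeasurable_of_mem_trigSpan {p : ℝ → Fin T → ℂ} (hp : p ∈ trigSpan T N) :
    AEMeasurable p leb :=
  (continuous_of_mem_fullTrig (trigSpan_le_fullTrig hp)).measurable.aemeasurable

lemma RegularDensity.energy_lt_top_of_mem_trigSpan (hα : 1 < α) (hf : RegularDensity α f)
    {p : ℝ → Fin T → ℂ} (hp : p ∈ trigSpan T N) : energy α f p < ⊤ := by
  induction hp using Submodule.span_induction with
  | mem x hx => obtain ⟨j, k, -, rfl⟩ := hx; exact hf.energy_lt_top hα (norm_expVec_le j k)
  | zero => rw [energy_zero]; exact ENNReal.zero_lt_top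
  | add x y hx hy ihx ihy =>
    exact hf.energy_add_lt_top hα (aemeasurable_of_mem_trigSpan hx)
      (aemeasurable_of_mem_trigSpan hy) ihx ihy
  | smul c x _ ih =>
    rw [energy_smul hα]
    exact ENNReal.mul_lt_top ENNReal.ofReal_lt_top ih

lemma MemLN.exists_seq {h : ℝ → Fin T → ℂ} (hh : MemLN α N f h) :
    ∃ p : ℕ → ℝ → Fin T → ℂ, (∀ n, p n ∈ trigSpan T N) ∧
      Tendsto (fun n => energy α f (h - p n)) atTop (𝓝 0) := by
  choose p hp hE using fun n : ℕ => hh.2 ((n : ℝ≥0∞) + 1)⁻¹ (by simp)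
  refine ⟨p, hp, tendsto_of_tendsto_of_tendsto_of_le_of_le tendsto_const_nhds ?_
    (fun _ => zero_le) fun n => (hE n).le⟩
  simpa using (tendsto_add_atTop_iff_nat 1).2 ENNReal.tendsto_inv_nat_nhds_zero

lemma MemLN.of_tendsto {h : ℝ → Fin T → ℂ} (hm : AEMeasurable h leb) {p : ℕ → ℝ → Fin T → ℂ}
    (hp : ∀ n, p n ∈ trigSpan T N) (hE : Tendsto (fun n => energy α f (h - p n)) atTop (𝓝 0)) :
    MemLN α N f h := by
  refine ⟨hm, fun ε hε => ?_⟩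
  obtain ⟨n, hn⟩ := (hE.eventually (gt_mem_nhds hε)).exists
  exact ⟨p n, hp n, hn⟩

lemma RegularDensity.energy_lt_top_of_memLN (hα : 1 < α) (hf : RegularDensity α f)
    {h : ℝ → Fin T → ℂ} (hh : MemLN α N f h) : energy α f h < ⊤ := by
  obtain ⟨p, hp, hE⟩ := hh.2 1 one_pos
  rw [← sub_add_cancel h p]
  exact hf.energy_add_lt_top hα (hh.1.sub (aemeasurable_of_mem_trigSpan hp))
    (aemeasurable_of_mem_trigSpan hp) (hE.trans ENNReal.one_lt_top)
    (hf.energy_lt_top_of_mem_trigSpan hα hp)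

/-- The Fourier coefficients with indices `0, …, N` vanish on `L^α_N(μ)`. -/
lemma RegularDensity.coeff_of_memLN (hα : 1 < α) (hf : RegularDensity α f) {h : ℝ → Fin T → ℂ}
    (hh : MemLN α N f h) (k : Fin (N + 1)) : coeff k h = 0 := by
  obtain ⟨p, hp, hE⟩ := hh.exists_seq
  have hi := hf.integrable_of_energy hα hh.1 (hf.energy_lt_top_of_memLN hα hh)
  have h1 := hf.tendsto_lintegral_norm hα
    (fun n => hh.1.sub (aemeasurable_of_mem_trigSpan (hp n))) hE
  have h2 : ∀ n, ‖coeff k h‖ₑ ≤ ∫⁻ θ, ‖(h - p n) θ‖ₑ ∂leb := fun n => by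
    have hpi := hf.integrable_of_energy hα (aemeasurable_of_mem_trigSpan (hp n))
      (hf.energy_lt_top_of_mem_trigSpan hα (hp n))
    have := enorm_coeff_le k (h - p n)
    rwa [coeff_sub _ hi hpi, coeff_of_mem_trigSpan (hp n) (Nat.lt_succ_iff.1 k.2), sub_zero] at this
  have h3 : ‖coeff k h‖ₑ ≤ 0 := ge_of_tendsto' h1 h2
  simpa using h3

lemma RegularDensity.integrable_form (hα : 1 < α) (hf : RegularDensity α f) {w : ℝ → Fin T → ℂ}
    (hw : AEMeasurable w leb) (hE : energy α f w < ⊤) :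
    Integrable (fun θ => form α (f θ) (w θ)) leb ∧
      energy α f w = ENNReal.ofReal (∫ θ, form α (f θ) (w θ) ∂leb) := by
  have hnn : 0 ≤ᵐ[leb] fun θ => form α (f θ) (w θ) := by
    filter_upwards [hf.admissible] with θ hθ using hθ.form_nonneg hα _
  have hi : Integrable (fun θ => form α (f θ) (w θ)) leb :=
    ⟨(hf.aemeasurable_form hw).aestronglyMeasurable,
      (hasFiniteIntegral_iff_ofReal hnn).2 hE⟩
  exact ⟨hi, (ofReal_integral_eq_lintegral_ofReal hi hnn).symm⟩

/-- `specChar α f a c` is the only best approximation of `polyA a` in `L^α_N(μ)`. -/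
lemma RegularDensity.energy_errChar_le (hα : 1 < α) (hf : RegularDensity α f)
    {a c : Fin (N + 1) → Fin T → ℂ} (hc : SolvesSystem α f a c) {h : ℝ → Fin T → ℂ}
    (hh : MemLN α N f h) :
    energy α f (errChar α f c) ≤ energy α f (polyA a - h) ∧
    (energy α f (polyA a - h) ≤ energy α f (errChar α f c) → h =ᵐ[leb] specChar α f a c) := by
  have hα0 : 0 < α := by linarith
  have hhE := hf.energy_lt_top_of_memLN hα hh
  have hhi := hf.integrable_of_energy hα hh.1 hhE
  have hAi : Integrable (polyA a) leb := integrable_leb_of_continuous (continuous_polyA a)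
  set w := polyA a - h with hw
  have hwi : Integrable w leb := hAi.sub hhi
  have hwE : energy α f w < ⊤ := by
    rw [hw, sub_eq_add_neg]
    exact hf.energy_add_lt_top hα hAi.aemeasurable hh.1.neg (hf.energy_lt_top hα (norm_polyA_le a))
      (by rwa [energy_neg hα])
  obtain ⟨hFi, hFE⟩ := hf.integrable_form hα hwi.aemeasurable hwE
  have hgi := hf.integrable_errChar hα c
  -- Only the coefficients `0, …, N` of `w` enter its pairing with `polyC c`, and there `w` agrees
  -- with `errChar`. The pairing thus equals `dualEnergy` whatever `h` is.
  have hcoef : ∀ k : Fin (N + 1), coeff k w = coeff k (errChar α f c) := fun k => by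
    rw [hw, coeff_sub _ hAi hhi, coeff_polyA, hf.coeff_of_memLN hα hh, sub_zero,
      (hf.solvesSystem_iff hα a c).1 hc k]
  have hCw := integrable_polyC_dotProduct c hwi
  have hD : ∫ θ, (polyC c θ ⬝ᵥ w θ).re ∂leb = dualEnergy α f c := by
    have e1 : ∫ θ, (polyC c θ ⬝ᵥ w θ).re ∂leb = (∫ θ, polyC c θ ⬝ᵥ w θ ∂leb).re :=
      integral_re (𝕜 := ℂ) hCw
    rw [e1, integral_polyC_dotProduct c hwi, hf.dualEnergy_eq hα]
    simp only [hcoef]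
  have hgF := hf.integrable_form_errChar hα c
  have hRi : Integrable (fun θ => form α (f θ) (w θ) / α +
      (1 - 1 / α) * form α (f θ) (errChar α f c θ)) leb :=
    (hFi.div_const α).add (hgF.const_mul _)
  have hRint : ∫ θ, (form α (f θ) (w θ) / α + (1 - 1 / α) * form α (f θ) (errChar α f c θ)) ∂leb =
      (∫ θ, form α (f θ) (w θ) ∂leb) / α + (1 - 1 / α) * dualEnergy α f c := by
    rw [integral_add (hFi.div_const α) (hgF.const_mul _), integral_div, integral_const_mul]
    rfl
  have hY : ∀ᵐ θ ∂leb, (polyC c θ ⬝ᵥ w θ).re ≤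
        form α (f θ) (w θ) / α + (1 - 1 / α) * form α (f θ) (errChar α f c θ) ∧
      ((polyC c θ ⬝ᵥ w θ).re =
        form α (f θ) (w θ) / α + (1 - 1 / α) * form α (f θ) (errChar α f c θ) →
          w θ = errChar α f c θ) := by
    filter_upwards [hf.admissible] with θ hθ
    have := hθ.young hα (w θ) (errChar α f c θ)
    rwa [errChar_eq, hθ.mulVec_vpow_dualVec hα, dotProduct_comm] at this
  -- Integrated Young inequality. Its left side is the dual energy `D`, its right side energy(w)/α +
  -- (1 - 1/α)D; cancelling leaves `D ≤` energy(w).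
  have hle : ∫ θ, (polyC c θ ⬝ᵥ w θ).re ∂leb ≤
      ∫ θ, (form α (f θ) (w θ) / α + (1 - 1 / α) * form α (f θ) (errChar α f c θ)) ∂leb :=
    integral_mono_ae hCw.re hRi (by filter_upwards [hY] with θ hθ using hθ.1)
  have e2 : dualEnergy α f c = dualEnergy α f c / α + (1 - 1 / α) * dualEnergy α f c := by ring
  refine ⟨?_, fun hEle => ?_⟩
  · rw [hf.energy_errChar hα, hFE]
    refine ENNReal.ofReal_le_ofReal ?_
    rw [hD, hRint] at hle
    have : dualEnergy α f c / α ≤ (∫ θ, form α (f θ) (w θ) ∂leb) / α := by linarith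
    exact (div_le_div_iff_of_pos_right hα0).1 this
  · have hD0 : 0 ≤ dualEnergy α f c := integral_nonneg_of_ae (by
      filter_upwards [hf.admissible] with θ hθ using hθ.form_nonneg hα _)
    rw [hf.energy_errChar hα, hFE, ENNReal.ofReal_le_ofReal_iff hD0] at hEle
    have h1 : ∫ θ, (form α (f θ) (w θ) / α + (1 - 1 / α) * form α (f θ) (errChar α f c θ)) ∂leb ≤
        ∫ θ, (polyC c θ ⬝ᵥ w θ).re ∂leb := by
      rw [hD, hRint]
      have := div_le_div_of_nonneg_right hEle hα0.le
      linarith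
    -- Equal energies leave no gap in the integrated inequality, so the pointwise one is an equality
    -- almost everywhere, and its equality case identifies `w`.
    have h2 := (integral_eq_iff_of_ae_le hCw.re hRi
      (by filter_upwards [hY] with θ hθ using hθ.1)).1 (le_antisymm hle h1)
    filter_upwards [h2, hY] with θ h3 h4
    have h5 := h4.2 h3
    rw [specChar, ← h5, hw, Pi.sub_apply, sub_sub_cancel]

/-! ### The isometry between observed values and `L^α_N(μ)` -/

variable {Ω : Type*} [MeasurableSpace Ω] {P : Measure Ω} {Z : Freq → Ω → (Fin T → ℂ)}
  {ξ : ℤ → Ω → (Fin T → ℂ)}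

lemma IsHarmonizable.isSpectralProcess [IsProbabilityMeasure P] (hα : 1 < α) (hα' : α ≤ 2)
    (hξ : IsHarmonizable P α ξ Z f) (hf : Minimality α f) : IsSpectralProcess P α Z f :=
  ⟨hξ.indep, hξ.density, hξ.density.regularDensity hα hα' hf⟩

lemma IsHarmonizable.exists_of_mem_observedSpan (hα : 1 < α) (hξ : IsHarmonizable P α ξ Z f)
    (hf : RegularDensity α f) {ζ : Ω → ℂ} (hζ : ζ ∈ observedSpan N ξ) :
    ∃ p ∈ trigSpan T N, IsStochIntegral P α Z f p ζ := by
  induction hζ using Submodule.span_induction with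
  | mem x hx =>
    obtain ⟨j, k, hj, rfl⟩ := hx
    exact ⟨expVec j k, Submodule.subset_span ⟨j, k, hj, rfl⟩, hξ.representation j k⟩
  | zero => exact ⟨0, Submodule.zero_mem _, IsStochIntegral.zero⟩
  | add x y _ _ hx hy =>
    obtain ⟨p, hp, hpx⟩ := hx
    obtain ⟨q, hq, hqy⟩ := hy
    exact ⟨p + q, Submodule.add_mem _ hp hq, hf.isStochIntegral_add hα hpx hqy⟩
  | smul c x _ hx =>
    obtain ⟨p, hp, hpx⟩ := hx
    exact ⟨c • p, Submodule.smul_mem _ c hp, hpx.smul hα c⟩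

lemma IsHarmonizable.exists_of_mem_trigSpan (hα : 1 < α) (hξ : IsHarmonizable P α ξ Z f)
    (hf : RegularDensity α f) {p : ℝ → Fin T → ℂ} (hp : p ∈ trigSpan T N) :
    ∃ ζ ∈ observedSpan N ξ, IsStochIntegral P α Z f p ζ := by
  induction hp using Submodule.span_induction with
  | mem x hx =>
    obtain ⟨j, k, hj, rfl⟩ := hx
    exact ⟨fun ω => ξ j ω k, Submodule.subset_span ⟨j, k, hj, rfl⟩, hξ.representation j k⟩
  | zero => exact ⟨0, Submodule.zero_mem _, IsStochIntegral.zero⟩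
  | add x y _ _ hx hy =>
    obtain ⟨p, hp, hpx⟩ := hx
    obtain ⟨q, hq, hqy⟩ := hy
    exact ⟨p + q, Submodule.add_mem _ hp hq, hf.isStochIntegral_add hα hpx hqy⟩
  | smul c x _ hx =>
    obtain ⟨p, hp, hpx⟩ := hx
    exact ⟨c • p, Submodule.smul_mem _ c hp, hpx.smul hα c⟩

lemma IsHarmonizable.isStochIntegral_functional (hα : 1 < α) (hξ : IsHarmonizable P α ξ Z f)
    (hf : RegularDensity α f) (a : Fin (N + 1) → Fin T → ℂ) :
    IsStochIntegral P α Z f (polyA a) (functional a ξ) := by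
  have h := hf.isStochIntegral_sum hα Finset.univ fun j : Fin (N + 1) =>
    hf.isStochIntegral_sum hα Finset.univ fun i : Fin T =>
      (hξ.representation ((j : ℕ) : ℤ) i).smul hα (a j i)
  convert h using 1
  · funext θ
    simp only [polyA, Finset.sum_apply, Pi.smul_apply]
    refine Finset.sum_congr rfl fun j _ => funext fun k => ?_
    simp [expVec, Finset.sum_apply, Pi.single_apply, mul_comm]
  · funext ω
    simp only [functional, dotProduct, Finset.sum_apply, Pi.smul_apply, smul_eq_mul]

lemma IsSpectralProcess.stableNorm_eq [IsProbabilityMeasure P] (hα : 1 < α)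
    (hZ : IsSpectralProcess P α Z f) {a : ℝ → Fin T → ℂ} {X : Ω → ℂ}
    (h : IsStochIntegral P α Z f a X) : stableNorm P α X = energy α f a ^ (1 / α) := by
  have hα0 : 0 ≤ 1 / α := by have : 0 < α := by linarith
                             positivity
  rw [(hZ.hasScale hα h).stableNorm_eq hα, ← ENNReal.ofReal_rpow_of_nonneg ENNReal.toReal_nonneg
    hα0, ENNReal.ofReal_toReal (hZ.regular.energy_lt_top_of_isStochIntegral hα h).ne]

/-- Elements of the span approximating `η` in `‖·‖_α` are integrals of functions in `trigSpan` and
converge to `η` in probability; their integrands then converge in `L^α(μ)`. -/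
lemma IsHarmonizable.exists_of_memObserved [IsProbabilityMeasure P] (hα : 1 < α) (hα' : α ≤ 2)
    (hξ : IsHarmonizable P α ξ Z f) (hZ : IsSpectralProcess P α Z f) {η : Ω → ℂ}
    (hη : MemObserved P α N ξ η) : ∃ h, MemLN α N f h ∧ IsStochIntegral P α Z f h η := by
  have hα0 : 0 < α := by linarith
  choose ζ hζ hn using fun n : ℕ => hη ((n : ℝ≥0∞) + 1)⁻¹ (by simp)
  choose c hc hcn using fun n => exists_hasScale_of_stableNorm_lt hα (hn n)
  choose p hp hpζ using fun n => hξ.exists_of_mem_observedSpan hα hZ.regular (hζ n)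
  have hc0 : Tendsto c atTop (𝓝 0) := by
    have h1 : Tendsto (fun n => ENNReal.ofReal (c n) ^ (1 / α)) atTop (𝓝 0) := by
      refine tendsto_of_tendsto_of_tendsto_of_le_of_le tendsto_const_nhds
        (h := fun n : ℕ => ((n : ℝ≥0∞) + 1)⁻¹) ?_ (fun _ => zero_le) fun n => ?_
      · simpa using (tendsto_add_atTop_iff_nat 1).2 ENNReal.tendsto_inv_nat_nhds_zero
      · change ENNReal.ofReal (c n) ^ (1 / α) ≤ _
        rw [ENNReal.ofReal_rpow_of_nonneg (hc n).nonneg (by positivity)]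
        exact (hcn n).le
    rw [tendsto_rpow_zero_iff (by positivity)] at h1
    have h2 := (ENNReal.tendsto_toReal ENNReal.zero_ne_top).comp h1
    exact h2.congr fun n => ENNReal.toReal_ofReal (hc n).nonneg
  have h1 := tendstoInMeasure_zero_of_hasScale hα hc hc0
  have h2 : TendstoInMeasure P ζ atTop η := by
    have h4 : TendstoInMeasure P (fun _ : ℕ => η) atTop η := fun ε hε => by simp [hε.ne']
    have := tendstoInMeasure_sub h4 h1
    convert this using 1
    · funext n; simp
    · funext ω; simp
  obtain ⟨h, hE, hI⟩ := hZ.exists_of_tendstoInMeasure hα hα' hpζ h2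
  exact ⟨h, MemLN.of_tendsto hI.1 hp hE, hI⟩

lemma IsHarmonizable.memObserved_of_isStochIntegral [IsProbabilityMeasure P] (hα : 1 < α)
    (hξ : IsHarmonizable P α ξ Z f) (hZ : IsSpectralProcess P α Z f) {η : Ω → ℂ}
    {h : ℝ → Fin T → ℂ} (hh : MemLN α N f h) (hI : IsStochIntegral P α Z f h η) :
    MemObserved P α N ξ η := by
  have hα0 : 0 < 1 / α := by have : 0 < α := by linarith
                             positivity
  intro ε hε
  obtain ⟨p, hp, hE⟩ := hh.exists_seq
  rw [← tendsto_rpow_zero_iff hα0] at hE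
  obtain ⟨n, hn⟩ := (hE.eventually (gt_mem_nhds hε)).exists
  obtain ⟨ζ, hζ, hpζ⟩ := hξ.exists_of_mem_trigSpan hα hZ.regular (hp n)
  refine ⟨ζ, hζ, ?_⟩
  rwa [hZ.stableNorm_eq hα (hZ.regular.isStochIntegral_sub hα hI hpζ)]

/-- The optimal estimates are the integrals of `specChar α f a c`. -/
lemma IsHarmonizable.isOptimalEstimate_iff [IsProbabilityMeasure P] (hα : 1 < α) (hα' : α ≤ 2)
    (hξ : IsHarmonizable P α ξ Z f) (hZ : IsSpectralProcess P α Z f)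
    {a c : Fin (N + 1) → Fin T → ℂ} (hc : SolvesSystem α f a c) {X : Ω → ℂ} :
    IsOptimalEstimate P α N ξ (functional a ξ) X ↔
      IsStochIntegral P α Z f (specChar α f a c) X := by
  have hα0 : 0 < 1 / α := by have : 0 < α := by linarith
                             positivity
  have hf := hZ.regular
  have hA := hξ.isStochIntegral_functional hα hf a
  have hL := hf.memLN_specChar hα hc
  have hsub : polyA a - specChar α f a c = errChar α f c := by
    funext θ
    simp [specChar]
  constructor
  · rintro ⟨hX, hopt⟩
    obtain ⟨h, hh, hI⟩ := hξ.exists_of_memObserved hα hα' hZ hX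
    obtain ⟨p, hp, hE⟩ := hL.exists_seq
    choose ζ _ hpζ using fun n => hξ.exists_of_mem_trigSpan hα hf (hp n)
    -- An integral of `specChar` serves as competitor. Optimality of `X` against it gives the energy
    -- inequality whose equality case identifies the integrand of `X`.
    obtain ⟨Y, hY⟩ := hZ.exists_isStochIntegral hα hpζ hL.1 hE
    have h1 := hopt Y (hξ.memObserved_of_isStochIntegral hα hZ hL hY)
    rw [hZ.stableNorm_eq hα (hf.isStochIntegral_sub hα hA hI),
      hZ.stableNorm_eq hα (hf.isStochIntegral_sub hα hA hY), hsub,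
      ENNReal.rpow_le_rpow_iff hα0] at h1
    exact hI.congr ((hf.energy_errChar_le hα hc hh).2 h1)
  · intro hI
    refine ⟨hξ.memObserved_of_isStochIntegral hα hZ hL hI, fun η hη => ?_⟩
    obtain ⟨h, hh, hIh⟩ := hξ.exists_of_memObserved hα hα' hZ hη
    rw [hZ.stableNorm_eq hα (hf.isStochIntegral_sub hα hA hI),
      hZ.stableNorm_eq hα (hf.isStochIntegral_sub hα hA hIh), hsub,
      ENNReal.rpow_le_rpow_iff hα0]
    exact (hf.energy_errChar_le hα hc hh).1

lemma IsHarmonizable.exists_isStochIntegral_specChar [IsProbabilityMeasure P] (hα : 1 < α)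
    (hξ : IsHarmonizable P α ξ Z f) (hZ : IsSpectralProcess P α Z f)
    {a c : Fin (N + 1) → Fin T → ℂ} (hc : SolvesSystem α f a c) :
    ∃ X, IsStochIntegral P α Z f (specChar α f a c) X := by
  have hL := hZ.regular.memLN_specChar hα hc
  obtain ⟨p, hp, hE⟩ := hL.exists_seq
  choose ζ _ hpζ using fun n => hξ.exists_of_mem_trigSpan hα hZ.regular (hp n)
  exact hZ.exists_isStochIntegral hα hpζ hL.1 hE

lemma IsHarmonizable.stableNorm_error [IsProbabilityMeasure P] (hα : 1 < α)
    (hξ : IsHarmonizable P α ξ Z f) (hZ : IsSpectralProcess P α Z f)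
    {a c : Fin (N + 1) → Fin T → ℂ} {X : Ω → ℂ}
    (hX : IsStochIntegral P α Z f (specChar α f a c) X) :
    stableNorm P α (functional a ξ - X) ≠ ⊤ ∧
      (stableNorm P α (functional a ξ - X)).toReal ^ α = dualEnergy α f c := by
  have hα0 : 0 < α := by linarith
  have hsub : polyA a - specChar α f a c = errChar α f c := by
    funext θ
    simp [specChar]
  have hD0 : 0 ≤ dualEnergy α f c := integral_nonneg_of_ae (by
    filter_upwards [hZ.regular.admissible] with θ hθ using hθ.form_nonneg hα _)
  have h := hZ.stableNorm_eq hα (hZ.regular.isStochIntegral_sub hα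
    (hξ.isStochIntegral_functional hα hZ.regular a) hX)
  rw [hsub, hZ.regular.energy_errChar hα] at h
  rw [h]
  refine ⟨ENNReal.rpow_ne_top_of_nonneg (by positivity) ENNReal.ofReal_ne_top, ?_⟩
  rw [← ENNReal.toReal_rpow, ENNReal.toReal_ofReal hD0, ← Real.rpow_mul hD0,
    one_div_mul_cancel hα0.ne', Real.rpow_one]

lemma form_eq_of_eq_one (hα : 1 < α) (hT : T = 1) (F : Matrix (Fin T) (Fin T) ℂ)
    (w : Fin T → ℂ) (k : Fin T) : form α F w = ‖w k‖ ^ α * (F k k).re := by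
  subst hT
  have : w k * (F k k * spow (α - 1) (w k)) = ((‖w k‖ ^ α : ℝ) : ℂ) * F k k := by
    rw [← mul_spow_self hα]; ring
  have hk : k = 0 := Subsingleton.elim _ _
  subst hk
  simp only [form, dotProduct, mulVec, vpow, Fin.sum_univ_one, Fin.isValue, this,
    Complex.re_ofReal_mul]

end

end HSaS

end

theorem mainTheorem2 {Ω : Type*} [MeasurableSpace Ω] (P : Measure Ω) [IsProbabilityMeasure P]
    (α : ℝ) (hα : 1 < α) (hα' : α ≤ 2) (T N : ℕ)
    (ξ : ℤ → Ω → (Fin T → ℂ)) (Z : HSaS.Freq → Ω → (Fin T → ℂ))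
    (f : ℝ → Matrix (Fin T) (Fin T) ℂ)
    (hξ : HSaS.IsHarmonizable P α ξ Z f) (hf : HSaS.Minimality α f)
    (a : Fin (N + 1) → Fin T → ℂ) :
    -- the optimal estimate exists and is unique up to almost sure equality
    (∃ Ahat : Ω → ℂ, HSaS.IsOptimalEstimate P α N ξ (HSaS.functional a ξ) Ahat) ∧
    (∀ Ahat Ahat' : Ω → ℂ, HSaS.IsOptimalEstimate P α N ξ (HSaS.functional a ξ) Ahat →
      HSaS.IsOptimalEstimate P α N ξ (HSaS.functional a ξ) Ahat' → Ahat =ᵐ[P] Ahat') ∧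
    -- the system of equations determines the coefficients
    (∃! c : Fin (N + 1) → Fin T → ℂ, HSaS.SolvesSystem α f a c) ∧
    ∀ c : Fin (N + 1) → Fin T → ℂ, HSaS.SolvesSystem α f a c →
      HSaS.MemLN α N f (HSaS.specChar α f a c) ∧
      ∀ Ahat : Ω → ℂ, HSaS.IsOptimalEstimate P α N ξ (HSaS.functional a ξ) Ahat →
        -- the estimate is the integral of `h`, and `h` is its only spectral characteristic
        HSaS.IsStochIntegral P α Z f (HSaS.specChar α f a c) Ahat ∧
        (∀ h : ℝ → Fin T → ℂ, HSaS.IsStochIntegral P α Z f h Ahat →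
          h =ᵐ[HSaS.leb] HSaS.specChar α f a c) ∧
        -- the error of the estimate
        HSaS.stableNorm P α (HSaS.functional a ξ - Ahat) ≠ ⊤ ∧
        Integrable (fun θ => HSaS.errChar α f c θ ⬝ᵥ
          (f θ *ᵥ HSaS.vpow (α - 1) (HSaS.errChar α f c θ))) HSaS.leb ∧
        (((HSaS.stableNorm P α (HSaS.functional a ξ - Ahat)).toReal ^ α : ℝ) : ℂ) =
          ∫ θ, HSaS.errChar α f c θ ⬝ᵥ
            (f θ *ᵥ HSaS.vpow (α - 1) (HSaS.errChar α f c θ)) ∂HSaS.leb ∧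
        -- the error in the scalar case
        (T = 1 → ∀ k : Fin T,
          Integrable (fun θ => ‖HSaS.errChar α f c θ k‖ ^ α * (f θ k k).re) HSaS.leb ∧
          (HSaS.stableNorm P α (HSaS.functional a ξ - Ahat)).toReal ^ α =
            ∫ θ, ‖HSaS.errChar α f c θ k‖ ^ α * (f θ k k).re ∂HSaS.leb) := by
  have hZ := hξ.isSpectralProcess hα hα' hf
  have hr := hZ.regular
  obtain ⟨c₀, hc₀, huniq⟩ := hr.existsUnique_solvesSystem hα a
  refine ⟨?_, fun X Y hX hY => ?_, ⟨c₀, hc₀, huniq⟩, fun c hc => ⟨hr.memLN_specChar hα hc,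
    fun X hX => ?_⟩⟩
  · obtain ⟨X, hX⟩ := hξ.exists_isStochIntegral_specChar hα hZ hc₀
    exact ⟨X, (hξ.isOptimalEstimate_iff hα hα' hZ hc₀).2 hX⟩
  · rw [hξ.isOptimalEstimate_iff hα hα' hZ hc₀] at hX hY
    exact hZ.ae_eq_of_isStochIntegral hα Filter.EventuallyEq.rfl hX hY
  rw [hξ.isOptimalEstimate_iff hα hα' hZ hc] at hX
  obtain ⟨hfin, herr⟩ := hξ.stableNorm_error hα hZ hX
  -- The complex integrand of the error formula is real almost everywhere because `f(θ)` is
  -- admissible, so the real energy and its integrability carry over.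
  have hform : (fun θ => ((HSaS.form α (f θ) (HSaS.errChar α f c θ) : ℝ) : ℂ)) =ᵐ[HSaS.leb]
      fun θ => HSaS.errChar α f c θ ⬝ᵥ (f θ *ᵥ HSaS.vpow (α - 1) (HSaS.errChar α f c θ)) := by
    filter_upwards [hr.admissible] with θ hθ using hθ.ofReal_form hα _
  have hint := hr.integrable_form_errChar hα c
  refine ⟨hX, fun h hh => hZ.ae_eq_of_isStochIntegral_right hα hh hX, hfin,
    hint.ofReal.congr hform, ?_, fun hT k => ?_⟩
  · rw [herr, ← integral_congr_ae hform, HSaS.dualEnergy]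
    exact integral_ofReal.symm
  · simp only [← HSaS.form_eq_of_eq_one hα hT]
    exact ⟨hint, herr⟩
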